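/- \textbf{Lemma 1.} Consider a single-server retrial system with two classes of customers, $k=1,2$, and no waiting room. Class-$k$ customers arrive according to a Poisson process of rate $\lambda_k>0$ and have i.i.d. service times with an arbitrary distribution $F_k$ on $[0,\infty)$, $F_k\neq\delta_0$. A class-$k$ arrival enters the server if it is idle and otherwise joins orbit $k$. As long as orbit $k$ is non-empty, its first customer (FIFO) makes attempts to enter the server, separated by i.i.d. exponential retrial times of rate $\alpha_k>0$; an attempt is successful if and only if the server is idle. The arrival processes, retrial times and service times are independent. At time $t=0$ a first customer arrives in the empty system (zero initial state); it is of class $k$ with probability $\lambda_k/(\lambda_1+\lambda_2)$, independently of everything else. Let $\mathbf X(t)=(N(t),X^{(1)}(t),X^{(2)}(t))$, where $N(t)\in\{0,1\}$ indicates whether the server is busy and $X^{(k)}(t)$ is the size of orbit $k$, both at the instant $t^-$. Let $T_0=0$, and let $T_{n+1}$ be the first arrival instant $t>T_n$ with $\mathbf X(t)=\mathbf 0$ ($T_{n+1}=\infty$ if there is none); let $T=T_1-T_0$ be the regeneration period. The regenerative process $\{\mathbf X(t)\}$ is called positive recurrent if $\mathsf E\,T<\infty$. Let $\mathbf X_n\in\mathbb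 Z_{\ge 0}^2$, $n\ge 1$, be the vector of the orbit sizes just after the $n$-th departure from the system. Then $\{\mathbf X_n\}_{n\ge1}$ is a time-homogeneous Markov chain, and this chain is positive recurrent (from each state of $\mathbb Z_{\ge0}^2$ the return time is almost surely finite with a finite mean) if and only if $\{\mathbf X(t)\}$ is positive recurrent, that is, if and only if $\mathsf E\,T<\infty$. -/

import Mathlib

open MeasureTheory ProbabilityTheory
open scoped ENNReal

namespace RetrialQueue

noncomputable section

/-! ### Markov chains on a countable state space -/

/-- The sequence `Y` is a time-homogeneous Markov chain with transition matrix `P`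
(each row of which is a probability distribution). -/
def IsMarkovChain {Ω E : Type*} [MeasurableSpace Ω] (μ : Measure Ω) (Y : ℕ → Ω → E)
    (P : E → PMF E) : Prop :=
  ∀ (n : ℕ) (x : ℕ → E),
    μ {ω | ∀ i ≤ n + 1, Y i ω = x i} = μ {ω | ∀ i ≤ n, Y i ω = x i} * P (x n) (x (n + 1))

open Classical in
/-- `firstPassage P y n x` is the probability that the chain with transition matrix `P`, started
at `x` at time `0`, is in `y` at time `n + 1` and in none of the times `1, …, n`. -/
def firstPassage {E : Type*} (P : E → PMF E) (y : E) : ℕ → E → ℝ≥0∞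
  | 0, x => P x y
  | n + 1, x => ∑' z, if z = y then 0 else P x z * firstPassage P y n z

/-- Every state is positive recurrent: the return time is almost surely finite
and has a finite mean. -/
def IsPositiveRecurrent {E : Type*} (P : E → PMF E) : Prop :=
  ∀ y, ∑' n, firstPassage P y n y = 1 ∧
    ∑' n : ℕ, ((n : ℝ≥0∞) + 1) * firstPassage P y n y < ⊤

/-! ### The primitives of the two-class system (the classes are `0` and `1`) -/

/-- One realization of the primitives: the class of the customer who arrives at time `0`,
the successive interarrival times of each class after time `0`, the successive retrial times of
each orbit, and the successive service times of each class. -/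
structure Input where
  firstClass : Fin 2
  interarrival : Fin 2 → ℕ → ℝ
  retrial : Fin 2 → ℕ → ℝ
  service : Fin 2 → ℕ → ℝ

/-- Labels of the real-valued primitives. -/
inductive Source
  | interarrival (k : Fin 2) (n : ℕ)
  | retrial (k : Fin 2) (n : ℕ)
  | service (k : Fin 2) (n : ℕ)

/-- The primitive with a given label. -/
def Input.value (u : Input) : Source → ℝ
  | .interarrival k n => u.interarrival k n
  | .retrial k n => u.retrial k n
  | .service k n => u.service k n

/-- The random primitives of the system: class `k` arrives according to a Poisson process of
rate `lam k`, retrial times of orbit `k` are exponential with rate `alpha k`, service times of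
class `k` have the distribution `F k`, and everything is independent. The customer arriving at
time `0` is an arrival of the superposed Poisson process, hence of class `k` with
probability `lam k / (lam 0 + lam 1)`. -/
structure IsRetrialInput {Ω : Type*} [MeasurableSpace Ω] (μ : Measure Ω) (lam alpha : Fin 2 → ℝ)
    (F : Fin 2 → Measure ℝ) (U : Ω → Input) : Prop where
  measurable_firstClass : Measurable fun ω => (U ω).firstClass
  firstClass_law : ∀ k, μ {ω | (U ω).firstClass = k} = ENNReal.ofReal (lam k / (lam 0 + lam 1))
  interarrival_law : ∀ k n, HasLaw (fun ω => (U ω).interarrival k n) (expMeasure (lam k)) μ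
  retrial_law : ∀ k n, HasLaw (fun ω => (U ω).retrial k n) (expMeasure (alpha k)) μ
  service_law : ∀ k n, HasLaw (fun ω => (U ω).service k n) (F k) μ
  indep : iIndepFun (fun (i : Source) ω => (U ω).value i) μ
  indep_firstClass : IndepFun (fun ω => (U ω).firstClass) (fun ω i => (U ω).value i) μ

/-! ### The dynamics -/

/-- What can happen: the customer in service departs, a customer of class `k` arrives from
outside, or the first customer of orbit `k` makes an attempt to enter the server. -/
inductive Event
  | departure
  | arrival (k : Fin 2)
  | retrial (k : Fin 2)

/-- The full state of the system right after an event. -/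
structure SysState where
  /-- current time -/
  time : ℝ
  /-- whether the server is busy -/
  busy : Bool
  /-- orbit sizes -/
  orbit : Fin 2 → ℕ
  /-- remaining service time (meaningful if the server is busy) -/
  residual : ℝ
  /-- remaining time until the next external arrival of each class -/
  arrivalClock : Fin 2 → ℝ
  /-- remaining time until the next attempt from each orbit; while an orbit is empty,
  this is the still unused next retrial time, and it does not run -/
  retrialClock : Fin 2 → ℝ
  /-- how many interarrival times of each class have been used -/
  usedInterarrival : Fin 2 → ℕ
  /-- how many retrial times of each orbit have been used -/
  usedRetrial : Fin 2 → ℕ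
  /-- how many service times of each class have been used -/
  usedService : Fin 2 → ℕ

/-- A customer of class `k` enters the (idle) server. -/
def SysState.startService (u : Input) (s : SysState) (k : Fin 2) : SysState :=
  { s with
    busy := true
    residual := u.service k (s.usedService k)
    usedService := Function.update s.usedService k (s.usedService k + 1) }

/-- Zero initial state: the first customer arrives at time `0` in an empty system and
enters the server. -/
def initial (u : Input) : SysState :=
  SysState.startService u
    { time := 0
      busy := false
      orbit := fun _ => 0
      residual := 0
      arrivalClock := fun k => u.interarrival k 0
      retrialClock := fun k => u.retrial k 0
      usedInterarrival := fun _ => 1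
      usedRetrial := fun _ => 1
      usedService := fun _ => 0 } u.firstClass

/-- The clock of this event is running. -/
def SysState.IsActive (s : SysState) : Event → Prop
  | .departure => s.busy = true
  | .arrival _ => True
  | .retrial k => 0 < s.orbit k

/-- Remaining time until this event, if its clock is running. -/
def SysState.clock (s : SysState) : Event → ℝ
  | .departure => s.residual
  | .arrival k => s.arrivalClock k
  | .retrial k => s.retrialClock k

/-- The clock of `e` is running, and no running clock expires earlier. -/
def SysState.IsNext (s : SysState) (e : Event) : Prop :=
  s.IsActive e ∧ ∀ e', s.IsActive e' → s.clock e ≤ s.clock e'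

open Classical in
/-- The event whose clock expires first (an order is fixed for ties, which have
probability zero). -/
def SysState.nextEvent (s : SysState) : Event :=
  if s.IsNext .departure then .departure
  else if s.IsNext (.arrival 0) then .arrival 0
  else if s.IsNext (.arrival 1) then .arrival 1
  else if s.IsNext (.retrial 0) then .retrial 0
  else .retrial 1

/-- Let time `d` pass without an event: all running clocks decrease. -/
def SysState.elapse (s : SysState) (d : ℝ) : SysState :=
  { s with
    time := s.time + d
    residual := if s.busy then s.residual - d else s.residual
    arrivalClock := fun k => s.arrivalClock k - d
    retrialClock := fun k => if 0 < s.orbit k then s.retrialClock k - d else s.retrialClock k }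

/-- The effect of an event. An arrival who finds the server busy joins the orbit of his class;
an attempt is successful if the server is idle. After an arrival or an attempt a new
interarrival time or retrial time is taken. -/
def SysState.apply (u : Input) (s : SysState) : Event → SysState
  | .departure => { s with busy := false }
  | .arrival k =>
      let s' : SysState := { s with
        arrivalClock := Function.update s.arrivalClock k (u.interarrival k (s.usedInterarrival k))
        usedInterarrival := Function.update s.usedInterarrival k (s.usedInterarrival k + 1) }
      if s.busy then { s' with orbit := Function.update s.orbit k (s.orbit k + 1) }
      else s'.startService u k
  | .retrial k =>
      let s' : SysState := { s with
        retrialClock := Function.update s.retrialClock k (u.retrial k (s.usedRetrial k))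
        usedRetrial := Function.update s.usedRetrial k (s.usedRetrial k + 1) }
      if s.busy then s'
      else SysState.startService u
        { s' with orbit := Function.update s.orbit k (s.orbit k - 1) } k

/-- The state of the system after `m` events (after time `0`). -/
def state (u : Input) : ℕ → SysState
  | 0 => initial u
  | m + 1 =>
      let s := state u m
      (s.elapse (s.clock s.nextEvent)).apply u s.nextEvent

/-- The type of the `(m+1)`-st event. -/
def event (u : Input) (m : ℕ) : Event := (state u m).nextEvent

/-- The instant of the `(m+1)`-st event. -/
def eventTime (u : Input) (m : ℕ) : ℝ := (state u (m + 1)).time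

/-! ### The continuous-time process and its regenerations -/

/-- The process `(N(t), X⁽¹⁾(t), X⁽²⁾(t))`: the indicator of a busy server and the orbit sizes,
at the instant `t⁻`. For `t > 0` this is the state after the first `m` events, where `m` is the
number of events before `t`; just before time `0` the system is empty. -/
def process (u : Input) (t : ℝ) : ℕ × ℕ × ℕ :=
  if t ≤ 0 then (0, 0, 0)
  else
    let s := state u (sInf {m : ℕ | t ≤ eventTime u m})
    (if s.busy then 1 else 0, s.orbit 0, s.orbit 1)

/-- The instants of the external arrivals of both classes. -/
def arrivalInstants (u : Input) : Set ℝ :=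
  {0} ∪ {t | ∃ m k, event u m = .arrival k ∧ t = eventTime u m}

/-- The regeneration instants: `T₀ = 0`, and `Tₙ₊₁` is the first arrival instant after `Tₙ` at
which the arriving customer meets an empty system (`∞` if there is none). -/
def regenerationInstant (u : Input) : ℕ → ℝ≥0∞
  | 0 => 0
  | n + 1 => ⨅ t ∈ {t : ℝ | t ∈ arrivalInstants u ∧
      regenerationInstant u n < ENNReal.ofReal t ∧ process u t = (0, 0, 0)}, ENNReal.ofReal t

/-- The (zero-delayed) regeneration period `T = T₁ - T₀`. -/
def regenerationPeriod (u : Input) : ℝ≥0∞ :=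
  regenerationInstant u 1 - regenerationInstant u 0

/-! ### The embedded chain -/

/-- The orbit sizes just after the `(n+1)`-st departure. -/
def embedded (u : Input) (n : ℕ) : Fin 2 → ℕ :=
  (state u (Nat.nth (fun m => event u m = .departure) n + 1)).orbit

end

end RetrialQueue

open RetrialQueue

open MeasureTheory ProbabilityTheory
open scoped ENNReal

namespace RetrialQueue

noncomputable section

/-! ### Positive recurrence via taboo probabilities -/

section Chain

variable {E : Type*} (P : E → PMF E)

/-! Both properties are compared with the mean time `meanPassage M.transition 0 0` that the embedded
chain, started with empty orbits, takes to return to empty orbits.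

All clocks but the service are exponential. The state is recorded as a core (server status, orbit
sizes, residual service time) together with the streams of primitives not yet used, and an event
becomes a deterministic map `step` on such pairs. By memorylessness this map is `Refreshing`: the
streams it leaves have the original law and are independent of the new core (`refreshing_step`). The
property passes to return maps (`refreshing_returnMap`), in particular to `cycle`, which leads from
one departure to the next. A departure leaves nothing in the core but the orbit sizes (`cycle_fst`),
so these form a homogeneous Markov chain (`streams_path`). The customer of time zero is distributed
like the first arrival in an empty system at rest (`lintegral_view_initial`), so the chain behaves
as if it came from the state zero.

With positive probability a service time is positive and any prescribed numbers of customers arrive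
during it; hence zero leads to every state in one transition (`transition_zero_pos`). Therefore the
law of the chain determines all rows of its transition matrix (`eq_transition_of_isMarkovChain`),
and positive recurrence of all states reduces to a finite mean return time of zero
(`isPositiveRecurrent_iff_meanPassage`).

This mean return time is the mean number of departures until the system is empty. Pathwise it is
also the number of arrivals after time zero up to and including the one that ends the cycle
(`total_arrival_eq_visits`). For every core, the arrival rate of a class times the mean time to the
next event is the probability that this event is an arrival of the class (`lintegral_duration`).
Summed over the steps of a cycle, this gives that the mean number of arrivals is the total rate
times E T (`rate_mul_lintegral_regenerationPeriod`). The identity needs the system to empty almost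
surely, and finiteness of either side forces that. -/

open Classical in
/-- The probability that the chain started at `x` avoids `y` at the times `1, …, n`. -/
def avoid (y : E) : ℕ → E → ℝ≥0∞
  | 0, _ => 1
  | n + 1, x => ∑' z, if z = y then 0 else P x z * avoid y n z

/-- The expected time of the first visit to `y` after time `0`, for the chain started at `x`. -/
def meanPassage (y x : E) : ℝ≥0∞ := ∑' n, avoid P y n x

/-- A chain that has avoided `y` up to time `n` either hits it at time `n + 1`, which is what the
index `n` of `firstPassage` stands for, or goes on avoiding it. Both sides obey the same first-step
recursion, and the base case is the total mass of a row. -/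
lemma avoid_eq_add (y : E) (n : ℕ) (x : E) :
    avoid P y n x = firstPassage P y n x + avoid P y (n + 1) x := by
  classical
  induction n generalizing x with
  | zero =>
    simp only [avoid, firstPassage, mul_one]
    rw [← (P x).tsum_coe, ← tsum_ite_eq y (P x), ← ENNReal.tsum_add]
    refine tsum_congr fun z => ?_
    by_cases h : z = y <;> simp [h]
  | succ n ih =>
    rw [avoid, avoid, firstPassage, ← ENNReal.tsum_add]
    refine tsum_congr fun z => ?_
    by_cases h : z = y
    · simp [h]
    · simp only [h, if_false]
      rw [ih z, mul_add]

lemma sum_firstPassage_add_avoid (y x : E) (n : ℕ) :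
    ∑ i ∈ Finset.range n, firstPassage P y i x + avoid P y n x = 1 := by
  induction n with
  | zero => simp [avoid]
  | succ n ih => rw [Finset.sum_range_succ, add_assoc, ← avoid_eq_add, ih]

/-- Summation by parts: both sides are the mean of the passage time truncated at `n`. -/
lemma sum_mul_firstPassage_add (y x : E) (n : ℕ) :
    ∑ i ∈ Finset.range n, ((i : ℝ≥0∞) + 1) * firstPassage P y i x + n * avoid P y n x =
      ∑ i ∈ Finset.range n, avoid P y i x := by
  induction n with
  | zero => simp
  | succ n ih =>
    rw [Finset.sum_range_succ, Finset.sum_range_succ, ← ih, avoid_eq_add P y n x]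
    push_cast
    ring

lemma avoid_eq_tsum_of_recurrent {y x : E} (h : ∑' n, firstPassage P y n x = 1) (n : ℕ) :
    avoid P y n x = ∑' i, firstPassage P y (i + n) x := by
  have h1 := sum_firstPassage_add_avoid P y x n
  rw [← h, ← ENNReal.summable.sum_add_tsum_nat_add' (k := n)] at h1
  refine (ENNReal.add_right_inj ?_).1 h1
  refine ne_top_of_le_ne_top ENNReal.one_ne_top ?_
  rw [← h]
  exact ENNReal.sum_le_tsum _

/-- The tail-sum formula for the mean, in the limit of the truncated one. Forwards, the boundary
term `n * avoid P y n x` is dominated by the tail of the series of the mean; this uses that the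
passage is certain. Backwards, a summable sequence `avoid` tends to zero, which makes the passage
certain. -/
lemma recurrent_iff_meanPassage_lt_top (y x : E) :
    (∑' n, firstPassage P y n x = 1 ∧
      ∑' n : ℕ, ((n : ℝ≥0∞) + 1) * firstPassage P y n x < ⊤) ↔ meanPassage P y x < ⊤ := by
  constructor
  · rintro ⟨h1, h2⟩
    refine lt_of_le_of_lt ?_ (ENNReal.add_lt_top.2 ⟨h2, h2⟩)
    rw [meanPassage, ENNReal.tsum_eq_iSup_nat]
    refine iSup_le fun n => ?_
    rw [← sum_mul_firstPassage_add]
    gcongr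
    · exact ENNReal.sum_le_tsum _
    · rw [avoid_eq_tsum_of_recurrent P h1, ← ENNReal.tsum_mul_left]
      calc ∑' i, (n : ℝ≥0∞) * firstPassage P y (i + n) x
          ≤ ∑' i, (((i + n : ℕ) : ℝ≥0∞) + 1) * firstPassage P y (i + n) x := by
            refine ENNReal.tsum_le_tsum fun i => ?_
            gcongr
            push_cast
            exact le_add_right (le_add_left le_rfl)
        _ ≤ _ := ENNReal.tsum_comp_le_tsum_of_injective (add_left_injective n)
            (fun m : ℕ => ((m : ℝ≥0∞) + 1) * firstPassage P y m x)
  · intro h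
    have h0 := ENNReal.tendsto_atTop_zero_of_tsum_ne_top h.ne
    refine ⟨?_, ?_⟩
    · have h1 : Filter.Tendsto (fun n => ∑ i ∈ Finset.range n, firstPassage P y i x +
          avoid P y n x) Filter.atTop (nhds (∑' n, firstPassage P y n x + 0)) :=
        (ENNReal.tendsto_nat_tsum _).add h0
      simp only [sum_firstPassage_add_avoid, add_zero] at h1
      exact (tendsto_nhds_unique h1 tendsto_const_nhds)
    · refine lt_of_le_of_lt ?_ h
      rw [ENNReal.tsum_eq_iSup_nat]
      refine iSup_le fun n => ?_
      refine le_trans (le_add_right le_rfl) ((sum_mul_firstPassage_add P y x n).le.trans ?_)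
      exact ENNReal.sum_le_tsum _

lemma sum_avoid_succ [DecidableEq E] (y x : E) (n : ℕ) :
    ∑ i ∈ Finset.range (n + 1), avoid P y i x =
      1 + ∑' z, if z = y then 0 else P x z * ∑ i ∈ Finset.range n, avoid P y i z := by
  rw [Finset.sum_range_succ', add_comm]
  congr 1
  simp only [avoid]
  rw [← Summable.tsum_finsetSum (fun _ _ => ENNReal.summable)]
  refine tsum_congr fun z => ?_
  by_cases h : z = y
  · simp [h]
  · simp [h, Finset.mul_sum]

lemma meanPassage_eq [DecidableEq E] (y x : E) :
    meanPassage P y x = 1 + ∑' z, if z = y then 0 else P x z * meanPassage P y z := by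
  rw [meanPassage, tsum_eq_zero_add' ENNReal.summable]
  congr 1
  simp only [avoid]
  rw [ENNReal.tsum_comm]
  refine tsum_congr fun z => ?_
  by_cases h : z = y
  · simp [h]
  · simp [h, meanPassage, ENNReal.tsum_mul_left]

lemma avoid_le_one (y x : E) (n : ℕ) : avoid P y n x ≤ 1 := by
  rw [← sum_firstPassage_add_avoid P y x n]
  exact le_add_left le_rfl

/-- To reach `y` it is enough to wait for `o` and then for the passage from `o` to `y`; the second
wait is not needed if the first step already leads to `y`, whence the factor. Truncation at `n`
keeps all waits from `o` finite, so that for `x = o` the last term can be absorbed on the left. -/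
lemma sum_avoid_le [DecidableEq E] (o y x : E) (hy : y ≠ o) (n : ℕ) :
    ∑ i ∈ Finset.range n, avoid P y i x ≤
      meanPassage P o x + (1 - P x y) * ∑ i ∈ Finset.range n, avoid P y i o := by
  induction n generalizing x with
  | zero => simp
  | succ n ih =>
    have hmono : ∑ i ∈ Finset.range n, avoid P y i o ≤
        ∑ i ∈ Finset.range (n + 1), avoid P y i o :=
      Finset.sum_le_sum_of_subset (Finset.range_mono n.le_succ)
    set G := ∑ i ∈ Finset.range (n + 1), avoid P y i o with hG
    have hx : ∑' z, (if z = y then 0 else P x z) = 1 - P x y := by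
      have h1 : P x y + ∑' z, (if z = y then 0 else P x z) = 1 := by
        rw [← (P x).tsum_coe, ← tsum_ite_eq y (P x), ← ENNReal.tsum_add]
        refine tsum_congr fun z => ?_
        by_cases h : z = y <;> simp [h]
      rw [← h1, ENNReal.add_sub_cancel_left ((P x).apply_ne_top y)]
    rw [sum_avoid_succ, meanPassage_eq, add_assoc, ← hx, ← ENNReal.tsum_mul_right,
      ← ENNReal.tsum_add]
    gcongr 1 + ?_
    refine ENNReal.tsum_le_tsum fun z => ?_
    by_cases hz : z = y
    · simp [hz]
    by_cases hzo : z = o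
    · subst hzo
      simp only [hz, if_false, if_true, zero_add]
      gcongr
    · simp only [hz, hzo, if_false]
      rw [← mul_add]
      gcongr
      refine (ih z).trans ?_
      gcongr
      refine (mul_le_mul' tsub_le_self hmono).trans (one_mul _).le

/-- From `y` the chain reaches `o` in finite mean time, since the first step from `o` goes to `y`
with positive probability. From `o`, each excursion hits `y` in its first step with probability `P o
y`, so `y` is reached in mean time at most `meanPassage P o o / P o y`. The return to `y` is bounded
by the sum of the two. -/
lemma isPositiveRecurrent_iff_meanPassage (o : E) (h : ∀ y, 0 < P o y) :
    IsPositiveRecurrent P ↔ meanPassage P o o < ⊤ := by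
  classical
  simp only [IsPositiveRecurrent, recurrent_iff_meanPassage_lt_top]
  refine ⟨fun H => H o, fun H y => ?_⟩
  by_cases hy : y = o
  · rwa [hy]
  have hMy : meanPassage P o y < ⊤ := by
    have h1 : P o y * meanPassage P o y ≤ meanPassage P o o := by
      rw [meanPassage_eq P o o]
      refine le_add_left (le_trans ?_ (ENNReal.le_tsum y))
      simp [hy]
    by_contra hcon
    rw [not_lt, top_le_iff] at hcon
    rw [hcon, ENNReal.mul_top (h y).ne'] at h1
    exact absurd H (not_lt.2 h1)
  have hG : ∀ n, ∑ i ∈ Finset.range n, avoid P y i o ≤ meanPassage P o o / P o y := by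
    intro n
    set G := ∑ i ∈ Finset.range n, avoid P y i o with hG
    -- Finiteness of the truncated mean is what allows `(1 - P o y) * G` to be cancelled below.
    have hGt : G ≠ ⊤ := by
      refine ne_top_of_le_ne_top (b := ∑ i ∈ Finset.range n, (1 : ℝ≥0∞)) (by simp) ?_
      exact Finset.sum_le_sum fun i _ => avoid_le_one P y o i
    have h1 := sum_avoid_le P o y o hy n
    rw [← hG] at h1
    rw [ENNReal.le_div_iff_mul_le (Or.inl (h y).ne') (Or.inl ((P o).apply_ne_top y))]
    have h2 : G * P o y + (1 - P o y) * G = G := by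
      rw [mul_comm, ← add_mul, add_tsub_cancel_of_le ((P o).coe_le_one y), one_mul]
    have h3 : (1 - P o y) * G ≠ ⊤ :=
      ENNReal.mul_ne_top (ne_top_of_le_ne_top ENNReal.one_ne_top tsub_le_self) hGt
    rw [← ENNReal.add_le_add_iff_right h3, h2]
    exact h1
  refine lt_of_le_of_lt (b := meanPassage P o y + meanPassage P o o / P o y) ?_
    (ENNReal.add_lt_top.2 ⟨hMy, ENNReal.div_lt_top H.ne (h y).ne'⟩)
  rw [meanPassage, ENNReal.tsum_eq_iSup_nat]
  refine iSup_le fun n => (sum_avoid_le P o y y hy n).trans ?_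
  gcongr
  exact (mul_le_mul' tsub_le_self (hG n)).trans (one_mul _).le

end Chain

/-! ### The exponential distribution -/

section Exponential

lemma lintegral_expMeasure (r : ℝ) {f : ℝ → ℝ≥0∞} (hf : Measurable f) :
    ∫⁻ a, f a ∂expMeasure r = ∫⁻ a, exponentialPDF r a * f a := by
  have h : Measurable (exponentialPDF r) := (measurable_exponentialPDFReal r).ennreal_ofReal
  exact lintegral_withDensity_eq_lintegral_mul _ h hf

lemma exponentialPDF_add {r d a : ℝ} (hd : 0 ≤ d) (ha : 0 ≤ a) :
    exponentialPDF r (a + d) = ENNReal.ofReal (Real.exp (-(r * d))) * exponentialPDF r a := by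
  rw [exponentialPDF_of_nonneg ha, exponentialPDF_of_nonneg (add_nonneg ha hd),
    ← ENNReal.ofReal_mul (Real.exp_pos _).le]
  congr 1
  rw [show -(r * (a + d)) = -(r * d) + -(r * a) by ring, Real.exp_add]
  ring

instance nullSingletonClass_expMeasure (r : ℝ) : NullSingletonClass (expMeasure r) :=
  inferInstanceAs (NullSingletonClass (volume.withDensity _))

/-- The part of the real line above `d`, with or without `d`. -/
def above (closed : Prop) [Decidable closed] (d : ℝ) : Set ℝ :=
  if closed then Set.Ici d else Set.Ioi d

lemma mem_above {closed : Prop} [Decidable closed] {d a : ℝ} :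
    a ∈ above closed d ↔ if closed then d ≤ a else d < a := by
  unfold above
  split_ifs <;> rfl

lemma mem_above_of {closed : Prop} [Decidable closed] (h : closed) {d a : ℝ} :
    a ∈ above closed d ↔ d ≤ a := by
  rw [mem_above, if_pos h]

lemma mem_above_of_not {closed : Prop} [Decidable closed] (h : ¬closed) {d a : ℝ} :
    a ∈ above closed d ↔ d < a := by
  rw [mem_above, if_neg h]

lemma measurableSet_above (closed : Prop) [Decidable closed] (d : ℝ) :
    MeasurableSet (above closed d) := by
  unfold above
  split_ifs
  · exact measurableSet_Ici
  · exact measurableSet_Ioi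

/-- The convention for ties does not matter in integrals, because exponential laws have no atoms. -/
lemma above_ae_eq (closed : Prop) [Decidable closed] (r d : ℝ) :
    above closed d =ᵐ[expMeasure r] Set.Ici d := by
  unfold above
  split_ifs
  · rfl
  · exact Ioi_ae_eq_Ici

/-- The exponential distribution is memoryless. -/
lemma lintegral_above_expMeasure {r d : ℝ} (hd : 0 ≤ d)
    (closed : Prop) [Decidable closed] {f : ℝ → ℝ≥0∞} (hf : Measurable f) :
    ∫⁻ a in above closed d, f (a - d) ∂expMeasure r =
      ENNReal.ofReal (Real.exp (-(r * d))) * ∫⁻ a, f a ∂expMeasure r := by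
  have hm : Measurable (exponentialPDF r) := (measurable_exponentialPDFReal r).ennreal_ofReal
  rw [setLIntegral_congr (above_ae_eq closed r d), ← lintegral_indicator measurableSet_Ici,
    lintegral_expMeasure r (f := (Set.Ici d).indicator fun x => f (x - d))
      (Measurable.indicator (by fun_prop) measurableSet_Ici),
    lintegral_expMeasure r hf, ← lintegral_const_mul _ (by fun_prop),
    ← lintegral_add_right_eq_self _ d]
  refine lintegral_congr fun a => ?_
  by_cases ha : 0 ≤ a
  · rw [Set.indicator_of_mem (by simpa using ha), exponentialPDF_add hd ha]
    simp [mul_assoc]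
  · rw [Set.indicator_of_notMem (by simpa using ha), exponentialPDF_of_neg (not_le.1 ha)]
    simp

lemma expMeasure_above {r d : ℝ} (hr : 0 < r) (hd : 0 ≤ d) (closed : Prop) [Decidable closed] :
    expMeasure r (above closed d) = ENNReal.ofReal (Real.exp (-(r * d))) := by
  have := isProbabilityMeasure_expMeasure hr
  simpa using lintegral_above_expMeasure (r := r) hd closed (f := fun _ => 1) measurable_const

lemma expMeasure_Iio_zero {r : ℝ} : expMeasure r (Set.Iio 0) = 0 := by
  have h := lintegral_exponentialPDF_of_nonpos (r := r) (le_refl 0)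
  rw [expMeasure, gammaMeasure, withDensity_apply _ measurableSet_Iio]
  exact h

lemma expMeasure_Iic_zero {r : ℝ} : expMeasure r (Set.Iic 0) = 0 := by
  rw [← expMeasure_Iio_zero (r := r)]
  exact measure_congr Iio_ae_eq_Iic.symm

lemma expMeasure_Ioo_pos {r b : ℝ} (hr : 0 < r) (hb : 0 < b) :
    0 < expMeasure r (Set.Ioo 0 b) := by
  have hm : Measurable (exponentialPDF r) := (measurable_exponentialPDFReal r).ennreal_ofReal
  rw [expMeasure, gammaMeasure, withDensity_apply _ measurableSet_Ioo]
  rw [setLIntegral_pos_iff (f := gammaPDF 1 r) hm]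
  refine lt_of_lt_of_le (b := volume (Set.Ioo 0 b)) (by simpa using hb) (measure_mono ?_)
  intro x hx
  refine ⟨?_, hx⟩
  exact (ENNReal.ofReal_pos.2 (exponentialPDFReal_pos hr hx.1)).ne'

/-- The expected truncation of an exponential variable is proportional to the probability that
it is not truncated. -/
lemma lintegral_min_expMeasure {r M : ℝ} (hr : 0 < r) (hM : 0 ≤ M) :
    ENNReal.ofReal r * ∫⁻ a, ENNReal.ofReal (min a M) ∂expMeasure r =
      expMeasure r (Set.Iio M) := by
  have hm : Measurable (exponentialPDF r) := (measurable_exponentialPDFReal r).ennreal_ofReal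
  have hnn : 0 ≤ᵐ[expMeasure r] fun a => min a M := by
    have : ∀ᵐ a ∂expMeasure r, ¬ a < 0 := measure_eq_zero_iff_ae_notMem.1 expMeasure_Iio_zero
    filter_upwards [this] with a ha
    exact le_min (not_lt.1 ha) hM
  -- Layer cake: the tail of the truncated variable is `exp (-(r * t))` for `0 < t < M` and vanishes
  -- beyond `M`; multiplied by `r` it is the exponential density.
  rw [lintegral_eq_lintegral_meas_lt _ hnn (measurable_id.min measurable_const).aemeasurable]
  have h1 : ∀ t ∈ Set.Ioi (0 : ℝ), expMeasure r {a | t < min a M} =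
      (Set.Iio M).indicator (fun t => ENNReal.ofReal (Real.exp (-(r * t)))) t := by
    intro t ht
    by_cases htM : t < M
    · rw [Set.indicator_of_mem (by exact htM), ← expMeasure_above hr (le_of_lt ht) False]
      congr 1
      ext a
      simp [above, htM]
    · rw [Set.indicator_of_notMem (by exact htM)]
      simp [htM]
  rw [setLIntegral_congr_fun measurableSet_Ioi h1, setLIntegral_indicator measurableSet_Iio,
    ← lintegral_const_mul _ (by fun_prop)]
  have h2 : expMeasure r (Set.Iio M) = expMeasure r (Set.Iio M ∩ Set.Ioi 0) := by
    refine measure_congr ?_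
    have : ∀ᵐ a ∂expMeasure r, ¬ a ≤ 0 := measure_eq_zero_iff_ae_notMem.1 expMeasure_Iic_zero
    filter_upwards [this] with a ha
    have ha' : 0 < a := not_le.1 ha
    exact propext ⟨fun h => ⟨h, ha'⟩, fun h => h.1⟩
  rw [h2]
  conv_rhs => rw [expMeasure, gammaMeasure,
    withDensity_apply _ (measurableSet_Iio.inter measurableSet_Ioi)]
  refine setLIntegral_congr_fun (measurableSet_Iio.inter measurableSet_Ioi) fun t ht => ?_
  refine Eq.trans ?_ (exponentialPDF_of_nonneg (le_of_lt ht.2)).symm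
  rw [ENNReal.ofReal_mul hr.le]

end Exponential

/-! ### Streams of independent variables -/

section Streams

/-- The law of a sequence of independent variables with distribution `ν`. -/
def streamLaw (ν : Measure ℝ) [IsProbabilityMeasure ν] : Measure (ℕ → ℝ) :=
  Measure.infinitePi fun _ => ν

variable {ν : Measure ℝ} [IsProbabilityMeasure ν]

instance : IsProbabilityMeasure (streamLaw ν) := by
  unfold streamLaw
  infer_instance

/-- The sequence without its head. -/
def tail (s : ℕ → ℝ) : ℕ → ℝ := fun n => s (n + 1)

/-- The sequence with head `a` and tail `s`. -/
def cons (a : ℝ) (s : ℕ → ℝ) : ℕ → ℝ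
  | 0 => a
  | n + 1 => s n

/-- The sequence with its head diminished by `d`. -/
def shiftHead (d : ℝ) (s : ℕ → ℝ) : ℕ → ℝ := cons (s 0 - d) (tail s)

@[fun_prop]
lemma measurable_tail : Measurable tail := by
  unfold tail
  fun_prop

@[fun_prop]
lemma measurable_cons {α : Type*} [MeasurableSpace α] {f : α → ℝ} {g : α → ℕ → ℝ}
    (hf : Measurable f) (hg : Measurable g) : Measurable fun x => cons (f x) (g x) := by
  refine measurable_pi_lambda _ fun n => ?_
  cases n with
  | zero => exact hf
  | succ n => exact (measurable_pi_apply n).comp hg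

@[fun_prop]
lemma measurable_shiftHead {α : Type*} [MeasurableSpace α] {f : α → ℝ} {g : α → ℕ → ℝ}
    (hf : Measurable f) (hg : Measurable g) : Measurable fun x => shiftHead (f x) (g x) := by
  unfold shiftHead
  fun_prop

/-- A product measure is determined by finite boxes. Padding the finite index set to an initial
segment, with the whole line in the new places, lets a box split into a condition on the head and a
box for the tail. -/
lemma map_cons_streamLaw :
    (ν.prod (streamLaw ν)).map (fun p => cons p.1 p.2) = streamLaw ν := by
  refine Measure.eq_infinitePi _ fun s t ht => ?_
  classical
  obtain ⟨n, hn⟩ := s.exists_nat_subset_range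
  set t' : ℕ → Set ℝ := fun i => if i ∈ s then t i else Set.univ with ht'
  have hmt' : ∀ i, MeasurableSet (t' i) := fun i => by
    by_cases h : i ∈ s <;> simp [ht', h, ht]
  have hs : Set.pi (s : Set ℕ) t = Set.pi (Finset.range (n + 1) : Set ℕ) t' := by
    ext x
    simp only [Set.mem_pi, ht', Finset.mem_coe]
    refine ⟨fun h i _ => ?_, fun h i hi => ?_⟩
    · by_cases hi : i ∈ s
      · simpa [hi] using h i hi
      · simp [hi]
    · have := h i (Finset.range_mono n.le_succ (hn hi))
      simpa [hi] using this
  have hprod : ∏ i ∈ s, ν (t i) = ∏ i ∈ Finset.range (n + 1), ν (t' i) := by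
    rw [← Finset.prod_subset (hn.trans (Finset.range_mono n.le_succ))]
    · exact Finset.prod_congr rfl fun i hi => by simp [ht', hi]
    · intro i _ hi
      simp [ht', hi]
  rw [hs, hprod, Measure.map_apply (by fun_prop) (MeasurableSet.pi (Finset.countable_toSet _)
    fun i _ => hmt' i)]
  have hpre : (fun p : ℝ × (ℕ → ℝ) => cons p.1 p.2) ⁻¹' Set.pi (Finset.range (n + 1) : Set ℕ) t' =
      t' 0 ×ˢ Set.pi (Finset.range n : Set ℕ) fun i => t' (i + 1) := by
    ext p
    simp only [Set.mem_preimage, Set.mem_pi, Set.mem_prod, Finset.mem_coe, Finset.mem_range]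
    constructor
    · intro h
      exact ⟨h 0 n.succ_pos, fun i hi => h (i + 1) (by omega)⟩
    · rintro ⟨h0, h1⟩ i hi
      cases i with
      | zero => exact h0
      | succ i => exact h1 i (by omega)
  rw [hpre, Measure.prod_prod, streamLaw, Measure.infinitePi_pi _ fun i _ => hmt' (i + 1),
    Finset.prod_range_succ', mul_comm]

lemma lintegral_streamLaw {f : (ℕ → ℝ) → ℝ≥0∞} (hf : Measurable f) :
    ∫⁻ s, f s ∂streamLaw ν = ∫⁻ a, ∫⁻ s, f (cons a s) ∂streamLaw ν ∂ν := by
  conv_lhs => rw [← map_cons_streamLaw (ν := ν)]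
  rw [lintegral_map hf (by fun_prop)]
  exact lintegral_prod _ (hf.comp (by fun_prop)).aemeasurable

lemma lintegral_streamLaw_head {f : ℝ → ℝ≥0∞} (hf : Measurable f) :
    ∫⁻ s, f (s 0) ∂streamLaw ν = ∫⁻ a, f a ∂ν := by
  rw [lintegral_streamLaw (f := fun s => f (s 0)) (by fun_prop)]
  simp [cons]

lemma streamLaw_head (B : Set ℝ) (hB : MeasurableSet B) :
    streamLaw ν {s | s 0 ∈ B} = ν B := by
  have hms : MeasurableSet {s : ℕ → ℝ | s 0 ∈ B} := measurable_pi_apply 0 hB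
  rw [← lintegral_indicator_one hms, ← lintegral_indicator_one hB,
    ← lintegral_streamLaw_head (measurable_one.indicator hB)]
  rfl

/-- With the tail integrated out, this is memorylessness of the head. -/
lemma map_shiftHead_streamLaw {r d : ℝ} (hd : 0 ≤ d) (closed : Prop)
    [Decidable closed] [IsProbabilityMeasure (expMeasure r)] :
    ((streamLaw (expMeasure r)).restrict {s | s 0 ∈ above closed d}).map (shiftHead d) =
      ENNReal.ofReal (Real.exp (-(r * d))) • streamLaw (expMeasure r) := by
  have hms : MeasurableSet {s : ℕ → ℝ | s 0 ∈ above closed d} :=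
    measurable_pi_apply 0 (measurableSet_above closed d)
  refine Measure.ext_of_lintegral _ fun f hf => ?_
  rw [lintegral_map hf (by fun_prop), lintegral_smul_measure, lintegral_streamLaw hf,
    ← lintegral_indicator hms,
    lintegral_streamLaw (f := Set.indicator _ fun s => f (shiftHead d s))
      (Measurable.indicator (by fun_prop) hms)]
  have hg : Measurable fun a => ∫⁻ s, f (cons a s) ∂streamLaw (expMeasure r) :=
    Measurable.lintegral_prod_right' (f := fun p : ℝ × (ℕ → ℝ) => f (cons p.1 p.2))
      (hf.comp (by fun_prop))
  rw [smul_eq_mul, ← lintegral_above_expMeasure hd closed hg,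
    ← lintegral_indicator (measurableSet_above closed d)]
  refine lintegral_congr fun a => ?_
  by_cases ha : a ∈ above closed d
  · rw [Set.indicator_of_mem ha]
    refine lintegral_congr fun s => ?_
    rw [Set.indicator_of_mem (show cons a s ∈ {s : ℕ → ℝ | s 0 ∈ above closed d} from ha)]
    rfl
  · rw [Set.indicator_of_notMem ha, ← lintegral_zero (μ := streamLaw (expMeasure r))]
    refine lintegral_congr fun s => ?_
    rw [Set.indicator_of_notMem (show cons a s ∉ {s : ℕ → ℝ | s 0 ∈ above closed d} from ha)]

end Streams

/-! ### Finite products -/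

section FiniteProducts

variable {κ α : Type*} [Fintype κ] [MeasurableSpace α] {m : κ → Measure α}
  [∀ i, IsProbabilityMeasure (m i)]

lemma map_restrict_pi {Q : κ → Set α} {S : κ → α → α} (hS : ∀ i, Measurable (S i))
    {c : κ → ℝ≥0∞} (h : ∀ i, ((m i).restrict (Q i)).map (S i) = c i • m i) :
    ((Measure.pi m).restrict (Set.univ.pi Q)).map (fun s i => S i (s i)) =
      (∏ i, c i) • Measure.pi m := by
  have hfin : ∀ i, IsFiniteMeasure (((m i).restrict (Q i)).map (S i)) := fun i => inferInstance
  rw [Measure.restrict_pi_pi, Measure.pi_map_pi fun i => (hS i).aemeasurable]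
  refine Measure.pi_eq fun B hB => ?_
  simp only [h, Measure.smul_apply, Measure.pi_pi, smul_eq_mul, Finset.prod_mul_distrib]

variable [DecidableEq κ]

/-- Resampling one coordinate preserves the product law. This allows a coordinate to be frozen or
integrated out without splitting the index type. -/
lemma map_update_pi (i : κ) :
    ((Measure.pi m).prod (m i)).map (fun p => Function.update p.1 i p.2) = Measure.pi m := by
  refine (Measure.pi_eq fun B hB => ?_).symm
  have hmeas : Measurable fun p : (κ → α) × α => Function.update p.1 i p.2 := by
    fun_prop
  rw [Measure.map_apply hmeas (MeasurableSet.univ_pi hB)]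
  have hpre : (fun p : (κ → α) × α => Function.update p.1 i p.2) ⁻¹' Set.univ.pi B =
      (Set.univ.pi (Function.update B i Set.univ)) ×ˢ B i := by
    ext p
    simp only [Set.mem_preimage, Set.mem_univ_pi, Set.mem_prod]
    constructor
    · intro h
      refine ⟨fun j => ?_, by simpa using h i⟩
      by_cases hj : j = i
      · subst hj; simp
      · simpa [hj] using h j
    · rintro ⟨h1, h2⟩ j
      by_cases hj : j = i
      · subst hj; simpa using h2
      · simpa [hj] using h1 j
  rw [hpre, Measure.prod_prod, Measure.pi_pi, ← Finset.mul_prod_erase Finset.univ _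
    (Finset.mem_univ i), ← Finset.mul_prod_erase Finset.univ (fun j => m j (B j))
    (Finset.mem_univ i)]
  simp only [Function.update_self, measure_univ, one_mul]
  rw [mul_comm]
  congr 1
  exact Finset.prod_congr rfl fun j hj => by
    rw [Function.update_of_ne (Finset.ne_of_mem_erase hj)]

/-- A coordinate may be integrated out separately. -/
lemma lintegral_pi_update (i : κ) {f : (κ → α) → ℝ≥0∞} (hf : Measurable f) :
    ∫⁻ s, f s ∂Measure.pi m = ∫⁻ t, ∫⁻ s, f (Function.update s i t) ∂Measure.pi m ∂m i := by
  conv_lhs => rw [← map_update_pi (m := m) i]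
  rw [lintegral_map hf (by fun_prop)]
  exact lintegral_prod_symm _ (hf.comp (by fun_prop)).aemeasurable

lemma lintegral_pi_update' (i : κ) {f : (κ → α) → ℝ≥0∞} (hf : Measurable f) :
    ∫⁻ s, f s ∂Measure.pi m = ∫⁻ s, ∫⁻ t, f (Function.update s i t) ∂m i ∂Measure.pi m := by
  conv_lhs => rw [← map_update_pi (m := m) i]
  rw [lintegral_map hf (by fun_prop)]
  exact lintegral_prod _ (hf.comp (by fun_prop)).aemeasurable

end FiniteProducts

/-! ### Families of streams: races of exponential clocks -/

section Race

set_option linter.unusedSectionVars false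

variable {κ : Type*} [Fintype κ] [DecidableEq κ] (ν : κ → Measure ℝ)
  [∀ i, IsProbabilityMeasure (ν i)]

/-- The law of independent streams, the entries of the `i`-th one having distribution `ν i`. -/
def streamsLaw : Measure (κ → ℕ → ℝ) := Measure.pi fun i => streamLaw (ν i)

instance : IsProbabilityMeasure (streamsLaw ν) := by
  unfold streamsLaw
  infer_instance

/-- The heads of the streams in `J` are diminished by `d`. -/
def shiftHeads (J : Finset κ) (d : ℝ) (σ : κ → ℕ → ℝ) : κ → ℕ → ℝ :=
  fun j => if j ∈ J then shiftHead d (σ j) else σ j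

@[fun_prop]
lemma measurable_shiftHeads {α : Type*} [MeasurableSpace α] (J : Finset κ) {f : α → ℝ}
    {g : α → κ → ℕ → ℝ} (hf : Measurable f) (hg : Measurable g) :
    Measurable fun x => shiftHeads J (f x) (g x) := by
  refine measurable_pi_lambda _ fun j => ?_
  unfold shiftHeads
  split_ifs <;> fun_prop

variable {ν} (closed : κ → Prop) [DecidablePred closed]

/-- The heads of all streams in `J` are beyond `d`. -/
def outlast (J : Finset κ) (d : ℝ) : Set (κ → ℕ → ℝ) :=
  {σ | ∀ j ∈ J, σ j 0 ∈ above (closed j) d}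

lemma measurableSet_outlast_prod (J : Finset κ) :
    MeasurableSet {p : ℝ × (κ → ℕ → ℝ) | p.2 ∈ outlast closed J p.1} := by
  have : {p : ℝ × (κ → ℕ → ℝ) | p.2 ∈ outlast closed J p.1} =
      ⋂ j ∈ J, {p | p.2 j 0 ∈ above (closed j) p.1} := by
    ext p
    simp [outlast]
  rw [this]
  refine Finset.measurableSet_biInter _ fun j _ => ?_
  simp only [mem_above]
  by_cases h : closed j
  · simp only [h, if_true]
    exact measurableSet_le (by fun_prop) (by fun_prop)
  · simp only [h, if_false]
    exact measurableSet_lt (by fun_prop) (by fun_prop)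

lemma measurableSet_outlast (J : Finset κ) (d : ℝ) : MeasurableSet (outlast closed J d) :=
  (measurableSet_outlast_prod closed J).preimage (measurable_const.prodMk measurable_id)

/-- Given that the exponential clocks in `J` outlast `d`, the family of streams at time `d` is
as good as new. -/
lemma map_shiftHeads_streamsLaw {J : Finset κ} {θ : κ → ℝ}
    (hν : ∀ j ∈ J, ν j = expMeasure (θ j)) {d : ℝ} (hd : 0 ≤ d) :
    ((streamsLaw ν).restrict (outlast closed J d)).map (shiftHeads J d) =
      (∏ j ∈ J, ENNReal.ofReal (Real.exp (-(θ j * d)))) • streamsLaw ν := by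
  have hset : outlast closed J d =
      Set.univ.pi fun j => if j ∈ J then {s : ℕ → ℝ | s 0 ∈ above (closed j) d} else Set.univ := by
    ext σ
    simp only [outlast, Set.mem_univ_pi]
    refine ⟨fun h j => ?_, fun h j hj => ?_⟩
    · by_cases hj : j ∈ J
      · simpa [hj] using h j hj
      · simp [hj]
    · simpa [hj] using h j
  have hprod : ∏ j ∈ J, ENNReal.ofReal (Real.exp (-(θ j * d))) =
      ∏ j, if j ∈ J then ENNReal.ofReal (Real.exp (-(θ j * d))) else 1 := by
    simp [Finset.prod_ite_mem]
  have hmap : shiftHeads J d = fun (σ : κ → ℕ → ℝ) j =>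
      (if j ∈ J then shiftHead d else id) (σ j) := by
    funext σ j
    by_cases hj : j ∈ J <;> simp [shiftHeads, hj]
  rw [hset, hprod, streamsLaw, hmap]
  refine map_restrict_pi (S := fun j => if j ∈ J then shiftHead d else id) (fun j => ?_)
    fun j => ?_
  · by_cases hj : j ∈ J
    · simp only [hj, if_true]
      fun_prop
    · simp only [hj, if_false]
      fun_prop
  · by_cases hj : j ∈ J
    · simp only [hj, if_true]
      have := hν j hj
      have hp : IsProbabilityMeasure (expMeasure (θ j)) := this ▸ inferInstance
      have h1 : streamLaw (ν j) = streamLaw (expMeasure (θ j)) := by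
        congr
      rw [h1]
      exact map_shiftHead_streamLaw hd (closed j)
    · simp [hj]

lemma lintegral_outlast {J : Finset κ} {θ : κ → ℝ}
    (hν : ∀ j ∈ J, ν j = expMeasure (θ j)) {d : ℝ} (hd : 0 ≤ d)
    {f : (κ → ℕ → ℝ) → ℝ≥0∞} (hf : Measurable f) :
    ∫⁻ σ in outlast closed J d, f (shiftHeads J d σ) ∂streamsLaw ν =
      (∏ j ∈ J, ENNReal.ofReal (Real.exp (-(θ j * d)))) * ∫⁻ σ, f σ ∂streamsLaw ν := by
  rw [← smul_eq_mul, ← lintegral_smul_measure, ← map_shiftHeads_streamsLaw closed hν hd,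
    lintegral_map hf (by fun_prop)]

/-- The clock `i` expires before those in `J`, at an instant in `C`. -/
def wins (C : Set ℝ) (J : Finset κ) (i : κ) : Set (κ → ℕ → ℝ) :=
  {σ | σ i 0 ∈ C ∧ σ ∈ outlast closed J (σ i 0)}

lemma measurableSet_wins {C : Set ℝ} (hC : MeasurableSet C) (J : Finset κ) (i : κ) :
    MeasurableSet (wins closed C J i) := by
  refine MeasurableSet.inter (s₁ := {σ : κ → ℕ → ℝ | σ i 0 ∈ C}) ?_ ?_
  · have : Measurable fun σ : κ → ℕ → ℝ => σ i 0 := by fun_prop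
    exact this hC
  · exact (measurableSet_outlast_prod closed J).preimage
      (by fun_prop : Measurable fun σ : κ → ℕ → ℝ => (σ i 0, σ))

/-- The family of streams just after the expiration of the clock `i`, when the clocks in `J`
are running. -/
def afterWin (J : Finset κ) (i : κ) (σ : κ → ℕ → ℝ) : κ → ℕ → ℝ :=
  Function.update (shiftHeads J (σ i 0) σ) i (tail (σ i))

@[fun_prop]
lemma measurable_afterWin (J : Finset κ) (i : κ) : Measurable (afterWin J i) := by
  unfold afterWin
  fun_prop

/-- Freeze the stream `i`, whose head `d` is the instant of expiration. The clocks in `J` must then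
outlast `d`; by memorylessness this costs the product of exponentials and leaves fresh streams. The
tail of the stream `i` is independent of its head and joins the fresh streams at the end. -/
lemma lintegral_wins_eq {C : Set ℝ} (hC : MeasurableSet C) {J : Finset κ} {i : κ} (hi : i ∉ J)
    (hnn : ν i (Set.Iio 0) = 0) {θ : κ → ℝ}
    (hν : ∀ j ∈ J, ν j = expMeasure (θ j))
    {f : ℝ × (κ → ℕ → ℝ) → ℝ≥0∞} (hf : Measurable f) :
    ∫⁻ σ in wins closed C J i, f (σ i 0, afterWin J i σ) ∂streamsLaw ν =
      ∫⁻ d in C, (∏ j ∈ J, ENNReal.ofReal (Real.exp (-(θ j * d)))) *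
        ∫⁻ σ, f (d, σ) ∂streamsLaw ν ∂ν i := by
  have hmw := measurableSet_wins closed hC J i
  have hc : Measurable fun d : ℝ => ∏ j ∈ J, ENNReal.ofReal (Real.exp (-(θ j * d))) := by
    fun_prop
  have hfm : Measurable fun σ => f (σ i 0, afterWin J i σ) := by fun_prop
  rw [← lintegral_indicator hmw, streamsLaw, lintegral_pi_update i (hfm.indicator hmw),
    ← streamsLaw]
  have hpos : ∀ᵐ t ∂streamLaw (ν i), 0 ≤ t 0 := by
    have h0 : streamLaw (ν i) {s | s 0 ∈ Set.Iio 0} = 0 := by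
      rw [streamLaw_head _ measurableSet_Iio, hnn]
    filter_upwards [measure_eq_zero_iff_ae_notMem.1 h0] with t ht
    exact not_lt.1 ht
  -- `H d t` is the inner integral when the frozen stream `i` has head `d` and tail `t`.
  set H : ℝ → (ℕ → ℝ) → ℝ≥0∞ := fun d t => C.indicator (fun d =>
    (∏ j ∈ J, ENNReal.ofReal (Real.exp (-(θ j * d)))) *
      ∫⁻ σ, f (d, Function.update σ i t) ∂streamsLaw ν) d with hH
  have hHm : Measurable fun p : ℝ × (ℕ → ℝ) => H p.1 p.2 := by
    have : (fun p : ℝ × (ℕ → ℝ) => H p.1 p.2) = (Prod.fst ⁻¹' C).indicator fun p =>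
        (∏ j ∈ J, ENNReal.ofReal (Real.exp (-(θ j * p.1)))) *
          ∫⁻ σ, f (p.1, Function.update σ i p.2) ∂streamsLaw ν := by
      funext p
      simp only [hH, Set.indicator]
      rfl
    rw [this]
    refine Measurable.indicator ?_ (measurable_fst hC)
    refine (hc.comp measurable_fst).mul ?_
    refine Measurable.lintegral_prod_right' (f := fun q : (ℝ × (ℕ → ℝ)) × (κ → ℕ → ℝ) =>
      f (q.1.1, Function.update q.2 i q.1.2)) ?_
    fun_prop
  have hinner : ∀ᵐ t ∂streamLaw (ν i), (∫⁻ σ, (wins closed C J i).indicator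
      (fun σ => f (σ i 0, afterWin J i σ)) (Function.update σ i t) ∂streamsLaw ν) =
        H (t 0) (tail t) := by
    filter_upwards [hpos] with t ht
    by_cases htC : t 0 ∈ C
    · rw [hH]
      simp only [Set.indicator_of_mem htC]
      rw [← lintegral_outlast closed hν ht (f := fun σ =>
        f (t 0, Function.update σ i (tail t))) (by fun_prop),
        ← lintegral_indicator (measurableSet_outlast closed J _)]
      refine lintegral_congr fun σ => ?_
      have hiff : Function.update σ i t ∈ wins closed C J i ↔ σ ∈ outlast closed J (t 0) := by
        have hu : (Function.update σ i t) i = t := Function.update_self ..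
        refine ⟨fun h j hj => ?_, fun h => ⟨by rwa [hu], fun j hj => ?_⟩⟩
        · have := h.2 j hj
          rwa [hu, Function.update_of_ne (ne_of_mem_of_not_mem hj hi)] at this
        · rw [hu, Function.update_of_ne (ne_of_mem_of_not_mem hj hi)]
          exact h j hj
      have haft : afterWin J i (Function.update σ i t) =
          Function.update (shiftHeads J (t 0) σ) i (tail t) := by
        funext j
        by_cases hj : j = i
        · subst hj
          simp [afterWin]
        · simp [afterWin, hj, shiftHeads]
      by_cases hσ : σ ∈ outlast closed J (t 0)
      · rw [Set.indicator_of_mem hσ, Set.indicator_of_mem (hiff.2 hσ), haft, Function.update_self]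
      · rw [Set.indicator_of_notMem hσ, Set.indicator_of_notMem fun h => hσ (hiff.1 h)]
    · rw [hH]
      simp only [Set.indicator_of_notMem htC]
      rw [← lintegral_zero (μ := streamsLaw ν)]
      refine lintegral_congr fun σ => ?_
      rw [Set.indicator_of_notMem]
      intro h
      have := h.1
      rw [Function.update_self] at this
      exact htC this
  rw [lintegral_congr_ae hinner, lintegral_streamLaw (f := fun t => H (t 0) (tail t))
    (hHm.comp (by fun_prop : Measurable fun t : ℕ → ℝ => (t 0, tail t))),
    ← lintegral_indicator hC]
  refine lintegral_congr fun d => ?_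
  change ∫⁻ t, H d t ∂streamLaw (ν i) = _
  by_cases hd : d ∈ C
  · simp only [hH, Set.indicator_of_mem hd]
    have hin : Measurable fun t : ℕ → ℝ => ∫⁻ σ, f (d, Function.update σ i t) ∂streamsLaw ν := by
      refine Measurable.lintegral_prod_right' (f := fun q : (ℕ → ℝ) × (κ → ℕ → ℝ) =>
        f (d, Function.update q.2 i q.1)) ?_
      fun_prop
    rw [lintegral_const_mul _ hin]
    congr 1
    exact (lintegral_pi_update (m := fun j => streamLaw (ν j)) i (f := fun σ => f (d, σ))
      (by fun_prop)).symm
  · simp [hH, hd]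

/-- After the expiration of the clock `i`, the family of streams is as good as new. -/
lemma lintegral_wins {C : Set ℝ} (hC : MeasurableSet C) {J : Finset κ} {i : κ} (hi : i ∉ J)
    (hnn : ν i (Set.Iio 0) = 0) {θ : κ → ℝ}
    (hν : ∀ j ∈ J, ν j = expMeasure (θ j))
    {f : ℝ × (κ → ℕ → ℝ) → ℝ≥0∞} (hf : Measurable f) :
    ∫⁻ σ in wins closed C J i, f (σ i 0, afterWin J i σ) ∂streamsLaw ν =
      ∫⁻ σ in wins closed C J i, ∫⁻ τ, f (σ i 0, τ) ∂streamsLaw ν ∂streamsLaw ν := by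
  have hg : Measurable fun p : ℝ × (κ → ℕ → ℝ) => ∫⁻ τ, f (p.1, τ) ∂streamsLaw ν :=
    Measurable.lintegral_prod_right' (f := fun q : (ℝ × (κ → ℕ → ℝ)) × (κ → ℕ → ℝ) =>
      f (q.1.1, q.2)) (by fun_prop)
  -- The formula is used for `f` and for its average over the streams, which depends on the instant
  -- alone; the two results coincide.
  rw [lintegral_wins_eq closed hC hi hnn hν hf,
    lintegral_wins_eq closed hC hi hnn hν hg]
  simp

/-- Taking the head off a stream leaves a family that is as good as new and independent of
that head. -/
lemma lintegral_drop (i : κ) {f : ℝ × (κ → ℕ → ℝ) → ℝ≥0∞} (hf : Measurable f) :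
    ∫⁻ σ, f (σ i 0, Function.update σ i (tail (σ i))) ∂streamsLaw ν =
      ∫⁻ a, ∫⁻ σ, f (a, σ) ∂streamsLaw ν ∂ν i := by
  rw [streamsLaw, lintegral_pi_update i (by fun_prop), ← streamsLaw]
  simp only [Function.update_self, Function.update_idem]
  rw [lintegral_streamLaw (f := fun t => ∫⁻ σ, f (t 0, Function.update σ i (tail t)) ∂streamsLaw ν)]
  · refine lintegral_congr fun a => ?_
    exact (lintegral_pi_update (m := fun j => streamLaw (ν j)) i (f := fun σ => f (a, σ))
      (by fun_prop)).symm
  · refine Measurable.lintegral_prod_right' (f := fun q : (ℕ → ℝ) × (κ → ℕ → ℝ) =>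
      f (q.1 0, Function.update q.2 i (tail q.1))) ?_
    fun_prop

lemma lintegral_head (i : κ) {f : ℝ → ℝ≥0∞} (hf : Measurable f) :
    ∫⁻ σ, f (σ i 0) ∂streamsLaw ν = ∫⁻ a, f a ∂ν i := by
  simpa using lintegral_drop (ν := ν) i (f := fun p => f p.1) (by fun_prop)

lemma streamsLaw_heads (B : κ → Set ℝ) (hB : ∀ i, MeasurableSet (B i)) :
    streamsLaw ν {σ | ∀ i, σ i 0 ∈ B i} = ∏ i, ν i (B i) := by
  have : {σ : κ → ℕ → ℝ | ∀ i, σ i 0 ∈ B i} = Set.univ.pi fun i => {s : ℕ → ℝ | s 0 ∈ B i} := by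
    ext σ
    simp
  rw [this, streamsLaw, Measure.pi_pi]
  exact Finset.prod_congr rfl fun i _ => streamLaw_head _ (hB i)

end Race

/-! ### The next event -/

section NextEvent

/-- The position of an event in the order that is used for ties. -/
def Event.rank : Event → ℕ
  | .departure => 0
  | .arrival k => 1 + k
  | .retrial k => 3 + k

lemma Event.rank_injective : Function.Injective Event.rank := by
  rintro (_ | k | k) (_ | l | l) h <;> simp only [Event.rank] at h <;>
    first | rfl | (congr 1; omega)

lemma Event.rank_lt (e : Event) : e.rank < 5 := by
  rcases e with _ | k | k <;> simp only [Event.rank] <;> omega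

instance : Finite Event :=
  Finite.of_injective (fun e : Event => (⟨e.rank, e.rank_lt⟩ : Fin 5)) fun a b h =>
    Event.rank_injective (by simpa using h)

instance : MeasurableSpace Event := ⊤

instance : DiscreteMeasurableSpace Event := ⟨fun _ => trivial⟩

lemma SysState.exists_isNext (s : SysState) : ∃ e, s.IsNext e := by
  have hne : {e | s.IsActive e}.Nonempty := ⟨.arrival 0, trivial⟩
  obtain ⟨e, he, hmin⟩ := Set.exists_min_image _ s.clock (Set.toFinite _) hne
  exact ⟨e, he, hmin⟩

lemma SysState.isNext_nextEvent (s : SysState) : s.IsNext s.nextEvent := by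
  unfold SysState.nextEvent
  split_ifs with h1 h2 h3 h4
  · exact h1
  · exact h2
  · exact h3
  · exact h4
  · obtain ⟨e, he⟩ := s.exists_isNext
    rcases e with _ | k | k
    · exact absurd he h1
    · fin_cases k
      · exact absurd he h2
      · exact absurd he h3
    · fin_cases k
      · exact absurd he h4
      · exact he

lemma SysState.rank_nextEvent_le (s : SysState) {e : Event} (he : s.IsNext e) :
    s.nextEvent.rank ≤ e.rank := by
  unfold SysState.nextEvent
  rcases e with _ | k | k
  · simp [he]
  · fin_cases k
    · simp only [Fin.zero_eta] at he
      split_ifs <;> simp [Event.rank]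
    · simp only [Fin.mk_one] at he
      split_ifs <;> simp [Event.rank]
  · fin_cases k
    · simp only [Fin.zero_eta] at he
      split_ifs <;> simp [Event.rank]
    · split_ifs <;> simp [Event.rank]

/-- The cascade of cases becomes a race: events of higher rank may tie with `e`, those of lower rank
must come strictly later. In this form it matches `outlast` and `wins`. -/
lemma SysState.nextEvent_eq_iff (s : SysState) (e : Event) :
    s.nextEvent = e ↔ s.IsActive e ∧ ∀ e', e' ≠ e → s.IsActive e' →
      s.clock e' ∈ above (e.rank < e'.rank) (s.clock e) := by
  simp only [mem_above]
  constructor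
  · rintro rfl
    refine ⟨s.isNext_nextEvent.1, fun e' hne he' => ?_⟩
    have hle := s.isNext_nextEvent.2 e' he'
    split_ifs with h
    · exact hle
    · refine lt_of_le_of_ne hle fun heq => ?_
      have hnext : s.IsNext e' := ⟨he', fun a ha => heq ▸ s.isNext_nextEvent.2 a ha⟩
      have hr := s.rank_nextEvent_le hnext
      exact hne (Event.rank_injective (by omega))
  · rintro ⟨ha, h⟩
    by_contra hne
    have hn := s.isNext_nextEvent
    have h1 := hn.2 e ha
    have h2 := h _ hne hn.1
    split_ifs at h2 with hr
    · have hnext : s.IsNext e := by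
        refine ⟨ha, fun a haa => ?_⟩
        exact h2.trans (hn.2 a haa)
      have := s.rank_nextEvent_le hnext
      omega
    · exact absurd h1 (not_le.2 h2)

end NextEvent

/-! ### The dynamics in terms of residual streams -/

section Dynamics

/-- The six streams of primitives. -/
inductive Kind
  | interarrival (k : Fin 2)
  | retrial (k : Fin 2)
  | service (k : Fin 2)

instance : DecidableEq Kind := Classical.decEq _

instance : Finite Kind :=
  Finite.of_injective (β := Fin 2 ⊕ Fin 2 ⊕ Fin 2)
    (fun
      | .interarrival k => .inl k
      | .retrial k => .inr (.inl k)
      | .service k => .inr (.inr k))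
    (by rintro (_ | _ | _) (_ | _ | _) h <;> simp_all)

instance : Fintype Kind := Fintype.ofFinite _

/-- The streams of primitives that have not been used yet; the heads of the streams of interarrival
and retrial times are the current clocks. -/
abbrev Streams := Kind → ℕ → ℝ

/-- The indicator of a busy server, the orbit sizes and the residual service time. -/
abbrev Core := Bool × (Fin 2 → ℕ) × ℝ

/-- The system state with a given core and given clocks. -/
def frame (p : Core × Streams) : SysState where
  time := 0
  busy := p.1.1
  orbit := p.1.2.1
  residual := p.1.2.2
  arrivalClock := fun k => p.2 (.interarrival k) 0
  retrialClock := fun k => p.2 (.retrial k) 0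
  usedInterarrival := fun _ => 0
  usedRetrial := fun _ => 0
  usedService := fun _ => 0

/-- The next event. -/
def next (p : Core × Streams) : Event := (frame p).nextEvent

/-- The time until the next event. -/
def duration (p : Core × Streams) : ℝ := (frame p).clock (next p)

/-- The heads of the streams of this kind are running clocks if the orbit sizes are `x`. -/
def Kind.IsRunning (x : Fin 2 → ℕ) : Kind → Prop
  | .interarrival _ => True
  | .retrial k => 0 < x k
  | .service _ => False

open Classical in
/-- The streams whose heads are running clocks. -/
def running (x : Fin 2 → ℕ) : Finset Kind := Finset.univ.filter (Kind.IsRunning x)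

lemma mem_running {x : Fin 2 → ℕ} {i : Kind} : i ∈ running x ↔ i.IsRunning x := by
  simp [running]

/-- A customer of class `k` enters the server; the orbit sizes become `x`. -/
def enter (x : Fin 2 → ℕ) (k : Fin 2) (σ : Streams) : Core × Streams :=
  ((true, x, σ (.service k) 0), Function.update σ (.service k) (tail (σ (.service k))))

/-- The effect of an event after a time `d` on the core `v`; `σ` are the streams after
the expiration of a clock. -/
def effect (v : Core) (d : ℝ) : Event → Streams → Core × Streams
  -- The residual service time is exactly used up, hence `0`; this makes the core after a departure
  -- a function of the orbit sizes.
  | .departure, σ => ((false, v.2.1, 0), σ)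
  | .arrival k, σ =>
      if v.1 then ((true, Function.update v.2.1 k (v.2.1 k + 1), v.2.2 - d), σ)
      else enter v.2.1 k σ
  | .retrial k, σ =>
      if v.1 then ((true, v.2.1, v.2.2 - d), σ)
      else enter (Function.update v.2.1 k (v.2.1 k - 1)) k σ

/-- The streams after the expiration of the clock of an event. -/
def expire (v : Core) : Event → Streams → Streams
  -- Negative residuals do not occur on regular trajectories, but `Refreshing` quantifies over all
  -- cores; the truncation keeps the shift nonnegative, as memorylessness requires.
  | .departure, σ => shiftHeads (running v.2.1) (max v.2.2 0) σ
  | .arrival k, σ => afterWin ((running v.2.1).erase (.interarrival k)) (.interarrival k) σ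
  | .retrial k, σ => afterWin ((running v.2.1).erase (.retrial k)) (.retrial k) σ

/-- The transition of the system at the next event. -/
def step (p : Core × Streams) : Core × Streams :=
  effect p.1 (duration p) (next p) (expire p.1 (next p) p.2)

/-! ### Measurability of the transition map -/

@[fun_prop]
lemma measurable_clock (e : Event) : Measurable fun p => (frame p).clock e := by
  rcases e with _ | k | k
  · change Measurable fun p : Core × Streams => p.1.2.2
    fun_prop
  · change Measurable fun p : Core × Streams => p.2 (.interarrival k) 0
    fun_prop
  · change Measurable fun p : Core × Streams => p.2 (.retrial k) 0
    fun_prop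

lemma measurableSet_isActive (e : Event) : MeasurableSet {p | (frame p).IsActive e} := by
  rcases e with _ | k | k
  · have h : Measurable fun p : Core × Streams => p.1.1 := by fun_prop
    exact h (measurableSet_singleton true)
  · exact MeasurableSet.univ
  · have h : Measurable fun p : Core × Streams => p.1.2.1 k := by fun_prop
    exact h (measurableSet_Ioi (a := 0))

@[fun_prop]
lemma measurable_next : Measurable next := by
  refine measurable_to_countable' fun e => ?_
  have : next ⁻¹' {e} = {p | (frame p).IsActive e} ∩ ⋂ e', {p | e' ≠ e → (frame p).IsActive e' →
      (frame p).clock e' ∈ above (e.rank < e'.rank) ((frame p).clock e)} := by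
    ext p
    simp only [Set.mem_preimage, Set.mem_singleton_iff, Set.mem_inter_iff, Set.mem_iInter]
    exact (frame p).nextEvent_eq_iff e
  rw [this]
  refine (measurableSet_isActive e).inter (MeasurableSet.iInter fun e' => ?_)
  by_cases hne : e' ≠ e
  · have hset : MeasurableSet {p : Core × Streams |
        (frame p).clock e' ∈ above (e.rank < e'.rank) ((frame p).clock e)} := by
      by_cases hr : e.rank < e'.rank
      · simp only [above, if_pos hr]
        exact measurableSet_le (measurable_clock e) (measurable_clock e')
      · simp only [above, if_neg hr]
        exact measurableSet_lt (measurable_clock e) (measurable_clock e')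
    convert! (measurableSet_isActive e').compl.union hset using 1
    ext p
    simp only [Set.mem_union, Set.mem_compl_iff]
    exact ⟨fun h => imp_iff_not_or.1 (h hne), fun h _ => imp_iff_not_or.2 h⟩
  · simp [hne]

/-- A function is measurable if it is so for each value of a discrete argument. -/
lemma measurable_of_discrete {α β γ : Type*} [MeasurableSpace α] [MeasurableSpace β]
    [MeasurableSpace γ] [Countable β] [MeasurableSingletonClass β] {g : α → β} (hg : Measurable g)
    {f : β → α → γ} (hf : ∀ b, Measurable (f b)) : Measurable fun a => f (g a) a :=
  (measurable_from_prod_countable_right (f := fun q : β × α => f q.1 q.2) hf).comp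
    (hg.prodMk measurable_id)

@[fun_prop]
lemma measurable_duration : Measurable duration :=
  measurable_of_discrete measurable_next (f := fun e p => (frame p).clock e) measurable_clock

lemma measurable_enter (x : Fin 2 → ℕ) (k : Fin 2) : Measurable (enter x k) := by
  unfold enter
  fun_prop

lemma measurable_effect {α : Type*} [MeasurableSpace α] {r d : α → ℝ} {σ : α → Streams}
    (hr : Measurable r) (hd : Measurable d) (hσ : Measurable σ) (b : Bool) (x : Fin 2 → ℕ)
    (e : Event) : Measurable fun a => effect (b, x, r a) (d a) e (σ a) := by
  rcases e with _ | k | k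
  · simp only [effect]
    fun_prop
  · cases b
    · exact (measurable_enter x k).comp hσ
    · simp only [effect, if_true]
      fun_prop
  · cases b
    · exact (measurable_enter (Function.update x k (x k - 1)) k).comp hσ
    · simp only [effect, if_true]
      fun_prop

lemma measurable_expire {α : Type*} [MeasurableSpace α] {r : α → ℝ} {σ : α → Streams}
    (hr : Measurable r) (hσ : Measurable σ) (b : Bool) (x : Fin 2 → ℕ)
    (e : Event) : Measurable fun a => expire (b, x, r a) e (σ a) := by
  rcases e with _ | k | k <;> simp only [expire]
  · fun_prop
  · exact (measurable_afterWin _ _).comp hσ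
  · exact (measurable_afterWin _ _).comp hσ

@[fun_prop]
lemma measurable_step : Measurable step := by
  have h := measurable_of_discrete (g := fun p : Core × Streams => (next p, p.1.1, p.1.2.1))
    (f := fun c p => effect (c.2.1, c.2.2, p.1.2.2) (duration p) c.1
      (expire (c.2.1, c.2.2, p.1.2.2) c.1 p.2)) (by fun_prop) fun c =>
    measurable_effect (by fun_prop) (by fun_prop)
      (measurable_expire (by fun_prop) (by fun_prop) _ _ _) _ _ _
  exact h

end Dynamics

/-! ### The model and its one-step transitions -/

section OneStep

/-- The parameters of the two-class system. -/
structure Model where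
  lam : Fin 2 → ℝ
  alpha : Fin 2 → ℝ
  F : Fin 2 → Measure ℝ
  lam_pos : ∀ k, 0 < lam k
  alpha_pos : ∀ k, 0 < alpha k
  prob : ∀ k, IsProbabilityMeasure (F k)
  F_nonneg : ∀ k, F k (Set.Iio 0) = 0
  F_pos : ∀ k, 0 < F k (Set.Ioi 0)

variable (M : Model)

/-- The distribution of the primitives of a given kind. -/
def Model.law : Kind → Measure ℝ
  | .interarrival k => expMeasure (M.lam k)
  | .retrial k => expMeasure (M.alpha k)
  | .service k => M.F k

/-- The rates of the exponential clocks. -/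
def Model.rate : Kind → ℝ
  | .interarrival k => M.lam k
  | .retrial k => M.alpha k
  -- A dummy value: service streams are never running clocks.
  | .service _ => 1

instance (i : Kind) : IsProbabilityMeasure (M.law i) := by
  rcases i with k | k | k
  · exact isProbabilityMeasure_expMeasure (M.lam_pos k)
  · exact isProbabilityMeasure_expMeasure (M.alpha_pos k)
  · exact M.prob k

/-- The law of the streams of primitives. -/
def Model.streams : Measure Streams := streamsLaw M.law

instance : IsProbabilityMeasure M.streams := by
  unfold Model.streams
  infer_instance

lemma Model.law_eq_of_mem_running {x : Fin 2 → ℕ} {i : Kind} (hi : i ∈ running x) :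
    M.law i = expMeasure (M.rate i) := by
  rw [mem_running] at hi
  rcases i with k | k | k
  · rfl
  · rfl
  · exact hi.elim

lemma Model.law_Iio_zero (i : Kind) : M.law i (Set.Iio 0) = 0 := by
  rcases i with k | k | k
  · exact expMeasure_Iio_zero
  · exact expMeasure_Iio_zero
  · exact M.F_nonneg k

lemma Model.ae_head {i : Kind} {B : Set ℝ} (hB : MeasurableSet B) (h : M.law i Bᶜ = 0) :
    ∀ᵐ σ ∂M.streams, σ i 0 ∈ B := by
  have h0 : M.streams {σ | σ i 0 ∈ Bᶜ} = 0 := by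
    have hm : MeasurableSet {σ : Streams | σ i 0 ∈ Bᶜ} := by
      have : Measurable fun σ : Streams => σ i 0 := by fun_prop
      exact this hB.compl
    rw [← h, ← lintegral_indicator_one hm, ← lintegral_indicator_one hB.compl,
      ← lintegral_head (ν := M.law) i (measurable_one.indicator hB.compl)]
    rfl
  filter_upwards [measure_eq_zero_iff_ae_notMem.1 h0] with σ hσ
  exact not_not.1 hσ

/-- Running clocks are positive and service times are nonnegative. -/
def Regular (σ : Streams) : Prop :=
  (∀ k, 0 < σ (.interarrival k) 0) ∧ (∀ k, 0 < σ (.retrial k) 0) ∧ ∀ k, 0 ≤ σ (.service k) 0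

lemma Model.ae_regular : ∀ᵐ σ ∂M.streams, Regular σ := by
  have h1 : ∀ k, ∀ᵐ σ ∂M.streams, σ (.interarrival k) 0 ∈ Set.Ioi (0 : ℝ) := fun k =>
    M.ae_head measurableSet_Ioi (by rw [Set.compl_Ioi]; exact expMeasure_Iic_zero)
  have h2 : ∀ k, ∀ᵐ σ ∂M.streams, σ (.retrial k) 0 ∈ Set.Ioi (0 : ℝ) := fun k =>
    M.ae_head measurableSet_Ioi (by rw [Set.compl_Ioi]; exact expMeasure_Iic_zero)
  have h3 : ∀ k, ∀ᵐ σ ∂M.streams, σ (.service k) 0 ∈ Set.Ici (0 : ℝ) := fun k =>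
    M.ae_head measurableSet_Ici (by rw [Set.compl_Ici]; exact M.F_nonneg k)
  filter_upwards [ae_all_iff.2 h1, ae_all_iff.2 h2, ae_all_iff.2 h3] with σ a b c
  exact ⟨a, b, c⟩

lemma measurableSet_regular : MeasurableSet {σ | Regular σ} := by
  have h : ∀ i : Kind, Measurable fun σ : Streams => σ i 0 := fun i => by fun_prop
  simp only [Regular, Set.ofPred_and, Set.ofPred_forall]
  exact (MeasurableSet.iInter fun k => h _ measurableSet_Ioi).inter
    ((MeasurableSet.iInter fun k => h _ measurableSet_Ioi).inter
      (MeasurableSet.iInter fun k => h _ measurableSet_Ici))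

/-- The event at the expiration of a clock. -/
def Kind.event : Kind → Event
  | .interarrival k => .arrival k
  | .retrial k => .retrial k
  | .service _ => .departure

/-- The times before the end of the service. -/
def cap (v : Core) : Set ℝ := if v.1 then Set.Iio v.2.2 else Set.univ

lemma measurableSet_cap (v : Core) : MeasurableSet (cap v) := by
  unfold cap
  split_ifs
  · exact measurableSet_Iio
  · exact MeasurableSet.univ

/-- A departure has the lowest rank and wins all ties, so every comparison is weak. -/
lemma next_eq_departure_iff (v : Core) (σ : Streams) :
    next (v, σ) = .departure ↔
      v.1 = true ∧ σ ∈ outlast (fun _ => True) (running v.2.1) v.2.2 := by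
  rw [next, SysState.nextEvent_eq_iff]
  refine and_congr Iff.rfl ⟨fun h j hj => ?_, fun h e hne he => ?_⟩
  · rw [mem_running] at hj
    rw [mem_above_of trivial]
    rcases j with k | k | k
    · exact (mem_above_of (by simp only [Event.rank]; omega)).1 (h (.arrival k) (by simp) hj)
    · exact (mem_above_of (by simp only [Event.rank]; omega)).1 (h (.retrial k) (by simp) hj)
    · exact hj.elim
  · rcases e with _ | k | k
    · exact absurd rfl hne
    · exact (mem_above_of (by simp only [Event.rank]; omega)).2
        ((mem_above_of trivial).1 (h (.interarrival k) (mem_running.2 he)))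
    · exact (mem_above_of (by simp only [Event.rank]; omega)).2
        ((mem_above_of trivial).1 (h (.retrial k) (mem_running.2 he)))

lemma clock_event {v : Core} {i : Kind} (hi : i.IsRunning v.2.1) (σ : Streams) :
    (frame (v, σ)).clock i.event = σ i 0 := by
  rcases i with k | k | k
  · rfl
  · rfl
  · exact hi.elim

/-- The residual service time belongs to the core and not to a stream, so the departure enters the
race as the deterministic bound `cap v`; the bound is strict since the departure wins ties. -/
lemma next_eq_event_iff {v : Core} {i : Kind} (hi : i.IsRunning v.2.1) (σ : Streams) :
    next (v, σ) = i.event ↔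
      σ ∈ wins (fun j => i.event.rank < j.event.rank) (cap v) ((running v.2.1).erase i) i := by
  have hact : (frame (v, σ)).IsActive i.event := by
    rcases i with k | k | k
    · trivial
    · exact hi
    · exact hi.elim
  have hdep : i.event ≠ .departure := by
    rcases i with k | k | k <;> simp_all [Kind.event, Kind.IsRunning]
  rw [next, SysState.nextEvent_eq_iff, clock_event hi]
  constructor
  · rintro ⟨-, h⟩
    refine ⟨?_, fun j hj => ?_⟩
    · unfold cap
      split_ifs with hb
      · exact (mem_above_of_not (Nat.not_lt_zero _)).1 (h .departure hdep.symm hb)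
      · trivial
    · rw [Finset.mem_erase, mem_running] at hj
      have h1 := h j.event ?_ ?_
      · rwa [clock_event hj.2] at h1
      · rcases i with k | k | k <;> rcases j with l | l | l <;>
          simp_all [Kind.event, Kind.IsRunning]
      · rcases j with l | l | l
        · trivial
        · exact hj.2
        · exact hj.2.elim
  · rintro ⟨hc, h⟩
    refine ⟨hact, fun e hne he => ?_⟩
    have key : ∀ j : Kind, j.event = e → j.IsRunning v.2.1 →
        (frame (v, σ)).clock e ∈ above (i.event.rank < e.rank) (σ i 0) := by
      rintro j rfl hj
      rw [clock_event hj]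
      exact h j (Finset.mem_erase.2 ⟨fun hji => hne (by rw [hji]), mem_running.2 hj⟩)
    rcases e with _ | k | k
    · have hb : v.1 = true := he
      rw [cap, if_pos hb] at hc
      exact (mem_above_of_not (Nat.not_lt_zero _)).2 hc
    · exact key (.interarrival k) rfl trivial
    · exact key (.retrial k) rfl he

/-- A transition map is refreshing if it leaves a family of streams which is as good as new and
independent of the new core. -/
def Refreshing {W S : Type*} [MeasurableSpace W] [MeasurableSpace S] (m : Measure S)
    (Φ : W × S → W × S) : Prop :=
  ∀ (w : W) (f : W × S → ℝ≥0∞), Measurable f →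
    ∫⁻ σ, f (Φ (w, σ)) ∂m = ∫⁻ σ, ∫⁻ τ, f ((Φ (w, σ)).1, τ) ∂m ∂m

lemma measurable_lintegral_snd {W S A : Type*} [MeasurableSpace W] [MeasurableSpace S]
    [MeasurableSpace A] (m : Measure S) [SFinite m] {f : W × S → ℝ≥0∞} (hf : Measurable f)
    {g : A → W} (hg : Measurable g) : Measurable fun a => ∫⁻ τ, f (g a, τ) ∂m :=
  Measurable.lintegral_prod_right' (f := fun q : A × S => f (g q.1, q.2)) (by fun_prop)

/-- The only randomness consumed here is the head of a service stream, when a customer enters the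
server; `lintegral_drop` says that what remains is fresh and independent of it. -/
lemma lintegral_effect (v : Core) (d : ℝ) (e : Event) {f : Core × Streams → ℝ≥0∞}
    (hf : Measurable f) :
    ∫⁻ σ, f (effect v d e σ) ∂M.streams =
      ∫⁻ σ, ∫⁻ τ, f ((effect v d e σ).1, τ) ∂M.streams ∂M.streams := by
  have henter : ∀ (x : Fin 2 → ℕ) (k : Fin 2), ∫⁻ σ, f (enter x k σ) ∂M.streams =
      ∫⁻ σ, ∫⁻ τ, f ((enter x k σ).1, τ) ∂M.streams ∂M.streams := by
    intro x k
    have h1 := lintegral_drop (ν := M.law) (.service k)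
      (f := fun p => f ((true, x, p.1), p.2)) (by fun_prop)
    have h2 := lintegral_head (ν := M.law) (.service k)
      (f := fun a => ∫⁻ τ, f ((true, x, a), τ) ∂M.streams)
      (measurable_lintegral_snd M.streams hf (by fun_prop))
    exact h1.trans h2.symm
  rcases e with _ | k | k
  · simp [effect]
  · by_cases hb : v.1 = true
    · simp [effect, hb]
    · simp only [effect, hb]
      exact henter _ _
  · by_cases hb : v.1 = true
    · simp [effect, hb]
    · simp only [effect, hb]
      exact henter _ _

lemma lintegral_next (v : Core) {f : Streams → ℝ≥0∞} :
    ∫⁻ σ, f σ ∂M.streams = ∑' e, ∫⁻ σ in {σ | next (v, σ) = e}, f σ ∂M.streams := by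
  rw [← lintegral_iUnion]
  · have : ⋃ e, {σ | next (v, σ) = e} = Set.univ := by
      ext σ
      simp
    rw [this, Measure.restrict_univ]
  · intro e
    have : Measurable fun σ => next (v, σ) := by fun_prop
    exact this (measurableSet_singleton e)
  · intro a b hab
    refine Set.disjoint_left.2 fun σ ha hb => hab ?_
    exact Eq.trans (Eq.symm ha) hb

/-- Freshness comes in two layers: first the race won by the clock `i` (`lintegral_wins`), whose
only trace is the elapsed time, then a possible draw of a service time (`lintegral_effect`). -/
lemma lintegral_expire_clock {v : Core} {i : Kind} (hi : i.IsRunning v.2.1)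
    {f : Core × Streams → ℝ≥0∞} (hf : Measurable f) :
    ∫⁻ σ in {σ | next (v, σ) = i.event}, f (step (v, σ)) ∂M.streams =
      ∫⁻ σ in {σ | next (v, σ) = i.event}, ∫⁻ τ, f ((step (v, σ)).1, τ) ∂M.streams
        ∂M.streams := by
  have hset : {σ | next (v, σ) = i.event} =
      wins (fun j => i.event.rank < j.event.rank) (cap v) ((running v.2.1).erase i) i :=
    Set.ext fun σ => next_eq_event_iff hi σ
  have hmset : MeasurableSet {σ | next (v, σ) = i.event} := by
    rw [hset]
    exact measurableSet_wins _ (measurableSet_cap v) _ _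
  have hstep : ∀ σ ∈ {σ | next (v, σ) = i.event}, step (v, σ) =
      effect v (σ i 0) i.event (afterWin ((running v.2.1).erase i) i σ) := by
    intro σ hσ
    have hσ' : next (v, σ) = i.event := hσ
    rw [step, duration, hσ', clock_event hi]
    congr 1
    rcases i with k | k | k
    · rfl
    · rfl
    · exact hi.elim
  have hcl : ∀ {g : ℝ × Streams → ℝ≥0∞}, Measurable g →
      ∫⁻ σ in {σ | next (v, σ) = i.event},
        g (σ i 0, afterWin ((running v.2.1).erase i) i σ) ∂M.streams =
      ∫⁻ σ in {σ | next (v, σ) = i.event}, ∫⁻ τ, g (σ i 0, τ) ∂M.streams ∂M.streams := by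
    intro g hg
    rw [hset]
    exact lintegral_wins _ (measurableSet_cap v) (Finset.notMem_erase i _) (M.law_Iio_zero i)
      (θ := M.rate) (fun j hj => M.law_eq_of_mem_running (Finset.mem_of_mem_erase hj)) hg
  have hF : Measurable fun p : ℝ × Streams => effect v p.1 i.event p.2 :=
    measurable_effect (α := ℝ × Streams) (r := fun _ => v.2.2) (by fun_prop) (by fun_prop)
      (by fun_prop) v.1 v.2.1 i.event
  refine (setLIntegral_congr_fun hmset fun σ hσ => congrArg f (hstep σ hσ)).trans (Eq.trans ?_
    (setLIntegral_congr_fun hmset (g := fun σ => ∫⁻ τ, f ((effect v (σ i 0) i.event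
      (afterWin ((running v.2.1).erase i) i σ)).1, τ) ∂M.streams)
      fun σ hσ => by simp only [hstep σ hσ]).symm)
  rw [hcl (g := fun p => f (effect v p.1 i.event p.2)) (hf.comp hF),
    hcl (g := fun p => ∫⁻ τ, f ((effect v p.1 i.event p.2).1, τ) ∂M.streams)
      (measurable_lintegral_snd M.streams hf hF.fst)]
  exact lintegral_congr fun σ => lintegral_effect M v _ _ hf

lemma outlast_ae_univ (x : Fin 2 → ℕ) {r : ℝ} (hr : r ≤ 0) :
    ∀ᵐ σ ∂M.streams, σ ∈ outlast (fun _ => True) (running x) r := by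
  filter_upwards [M.ae_regular] with σ hσ j hj
  rw [mem_running] at hj
  rw [mem_above_of trivial]
  rcases j with k | k | k
  · exact hr.trans (hσ.1 k).le
  · exact hr.trans (hσ.2.1 k).le
  · exact hj.elim

/-- The new core and the elapsed time are fixed by the old core, so both sides are the probability
that the running clocks outlast the service, times the same integral over fresh streams. -/
lemma lintegral_expire_departure (v : Core) {f : Core × Streams → ℝ≥0∞} (hf : Measurable f) :
    ∫⁻ σ in {σ | next (v, σ) = .departure}, f (step (v, σ)) ∂M.streams =
      ∫⁻ σ in {σ | next (v, σ) = .departure}, ∫⁻ τ, f ((step (v, σ)).1, τ) ∂M.streams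
        ∂M.streams := by
  by_cases hb : v.1 = true
  swap
  · have : {σ | next (v, σ) = .departure} = ∅ := by
      ext σ
      exact ⟨fun h => hb ((next_eq_departure_iff v σ).1 h).1, fun h => h.elim⟩
    rw [this]
    simp
  have hset : {σ | next (v, σ) = .departure} =
      outlast (fun _ => True) (running v.2.1) v.2.2 := by
    ext σ
    exact (next_eq_departure_iff v σ).trans (and_iff_right hb)
  -- If the residual is negative, both sets have full measure, because running clocks are almost
  -- surely positive.
  have hae : outlast (fun _ => True) (running v.2.1) v.2.2 =ᵐ[M.streams]
      outlast (fun _ => True) (running v.2.1) (max v.2.2 0) := by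
    by_cases hr : 0 ≤ v.2.2
    · rw [max_eq_left hr]
      exact Filter.EventuallyEq.rfl
    · rw [max_eq_right (le_of_not_ge hr)]
      filter_upwards [outlast_ae_univ M v.2.1 (le_of_not_ge hr),
        outlast_ae_univ M v.2.1 le_rfl] with σ h1 h2
      exact propext ⟨fun _ => h2, fun _ => h1⟩
  have hmset : MeasurableSet {σ | next (v, σ) = .departure} := by
    rw [hset]
    exact measurableSet_outlast _ _ _
  have hstep : ∀ σ ∈ {σ | next (v, σ) = .departure}, step (v, σ) =
      ((false, v.2.1, 0), shiftHeads (running v.2.1) (max v.2.2 0) σ) := by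
    intro σ hσ
    have hσ' : next (v, σ) = .departure := hσ
    rw [step, hσ']
    rfl
  have hcl : ∀ {g : Streams → ℝ≥0∞}, Measurable g →
      ∫⁻ σ in {σ | next (v, σ) = .departure},
        g (shiftHeads (running v.2.1) (max v.2.2 0) σ) ∂M.streams =
      (∏ j ∈ running v.2.1, ENNReal.ofReal (Real.exp (-(M.rate j * max v.2.2 0)))) *
        ∫⁻ τ, g τ ∂M.streams := by
    intro g hg
    rw [hset, setLIntegral_congr hae]
    exact lintegral_outlast _ (fun j hj => M.law_eq_of_mem_running hj) (le_max_right _ _) hg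
  refine (setLIntegral_congr_fun hmset fun σ hσ => congrArg f (hstep σ hσ)).trans (Eq.trans ?_
    (setLIntegral_congr_fun hmset (g := fun σ => ∫⁻ τ, f ((false, v.2.1, 0), τ) ∂M.streams)
      fun σ hσ => by simp only [hstep σ hσ]).symm)
  rw [hcl (g := fun τ => f ((false, v.2.1, 0), τ)) (by fun_prop),
    hcl (g := fun _ => ∫⁻ τ, f ((false, v.2.1, 0), τ) ∂M.streams) measurable_const]
  simp

theorem refreshing_step : Refreshing M.streams step := by
  intro v f hf
  rw [lintegral_next M v, lintegral_next M v]
  refine tsum_congr fun e => ?_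
  rcases e with _ | k | k
  · exact lintegral_expire_departure M v hf
  · exact lintegral_expire_clock M (i := .interarrival k) trivial hf
  · by_cases hk : 0 < v.2.1 k
    · exact lintegral_expire_clock M (i := .retrial k) hk hf
    · have : {σ | next (v, σ) = .retrial k} = ∅ := by
        ext σ
        refine ⟨fun h => ?_, fun h => h.elim⟩
        exact hk (((frame (v, σ)).nextEvent_eq_iff _).1 h).1
      rw [this]
      simp

end OneStep

/-! ### Refreshing maps: killing, iteration and return maps -/

section Refresh

set_option linter.unusedSectionVars false

variable {W S : Type*} [MeasurableSpace W] [MeasurableSpace S] {m : Measure S}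
  [IsProbabilityMeasure m] {Φ : W × S → W × S} {O : Set W}

open Classical in
/-- The function `h` at the `n`-th iterate of `Φ`, killed by a previous visit to `O`. -/
def killed (Φ : W × S → W × S) (O : Set W) (h : W × S → ℝ≥0∞) : ℕ → W × S → ℝ≥0∞
  | 0, p => h p
  | n + 1, p => if p.1 ∈ O then 0 else killed Φ O h n (Φ p)

lemma killed_of_forall {h : W × S → ℝ≥0∞} {n : ℕ} {p : W × S}
    (hp : ∀ i < n, (Φ^[i] p).1 ∉ O) : killed Φ O h n p = h (Φ^[n] p) := by
  induction n generalizing p with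
  | zero => rfl
  | succ n ih =>
    rw [killed, if_neg (show p.1 ∉ O from hp 0 n.succ_pos), ih fun i hi => hp (i + 1) (by omega)]
    rfl

lemma killed_of_exists {h : W × S → ℝ≥0∞} {n : ℕ} {p : W × S}
    (hp : ∃ i < n, (Φ^[i] p).1 ∈ O) : killed Φ O h n p = 0 := by
  induction n generalizing p with
  | zero =>
    obtain ⟨i, hi, -⟩ := hp
    omega
  | succ n ih =>
    rw [killed]
    split_ifs with h0
    · rfl
    · obtain ⟨i, hi, hp⟩ := hp
      cases i with
      | zero => exact absurd hp h0
      | succ i => exact ih ⟨i, by omega, hp⟩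

lemma measurable_killed (hΦ : Measurable Φ) (hO : MeasurableSet O) {h : W × S → ℝ≥0∞}
    (hh : Measurable h) (n : ℕ) : Measurable (killed Φ O h n) := by
  induction n with
  | zero => exact hh
  | succ n ih =>
    exact Measurable.ite (measurable_fst hO) measurable_const (ih.comp hΦ)

lemma lintegral_killed_succ (hR : Refreshing m Φ) (hΦ : Measurable Φ) (hO : MeasurableSet O)
    {h : W × S → ℝ≥0∞} (hh : Measurable h) (n : ℕ) {w : W} (hw : w ∉ O) :
    ∫⁻ σ, killed Φ O h (n + 1) (w, σ) ∂m =
      ∫⁻ σ, ∫⁻ τ, killed Φ O h n ((Φ (w, σ)).1, τ) ∂m ∂m := by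
  simp only [killed, hw, if_false]
  exact hR w _ (measurable_killed hΦ hO hh n)

/-- Functions with the same means for each core have the same means at later times. -/
lemma lintegral_killed_congr (hR : Refreshing m Φ) (hΦ : Measurable Φ) (hO : MeasurableSet O)
    {f g : W × S → ℝ≥0∞} (hf : Measurable f) (hg : Measurable g)
    (h : ∀ w, ∫⁻ σ, f (w, σ) ∂m = ∫⁻ σ, g (w, σ) ∂m) (n : ℕ) (w : W) :
    ∫⁻ σ, killed Φ O f n (w, σ) ∂m = ∫⁻ σ, killed Φ O g n (w, σ) ∂m := by
  induction n generalizing w with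
  | zero => exact h w
  | succ n ih =>
    by_cases hw : w ∈ O
    · simp [killed, hw]
    · rw [lintegral_killed_succ hR hΦ hO hf n hw, lintegral_killed_succ hR hΦ hO hg n hw]
      exact lintegral_congr fun σ => ih _

/-- At each iterate the streams are fresh given the core, so the exceptional set is null again.
Formally, the indicator of `Aᶜ` and the zero function have the same mean for each core, and nothing
is killed since `O = ∅`. -/
lemma ae_iterate (hR : Refreshing m Φ) (hΦ : Measurable Φ) {A : Set (W × S)}
    (hA : MeasurableSet A) (h : ∀ w, ∀ᵐ σ ∂m, (w, σ) ∈ A) (w : W) :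
    ∀ᵐ σ ∂m, ∀ n, Φ^[n] (w, σ) ∈ A := by
  rw [ae_all_iff]
  intro n
  have h0 := lintegral_killed_congr hR hΦ (O := ∅) MeasurableSet.empty
    (f := Aᶜ.indicator 1) (g := 0) (measurable_one.indicator hA.compl) measurable_const
    (fun w => by
      simp only [Pi.zero_apply, lintegral_zero]
      refine (lintegral_congr_ae ?_).trans lintegral_zero
      filter_upwards [h w] with σ hσ
      simp [hσ]) n w
  simp only [killed_of_forall (O := (∅ : Set W)) fun _ _ => Set.notMem_empty _, Pi.zero_apply,
    lintegral_zero] at h0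
  rw [lintegral_eq_zero_iff] at h0
  · filter_upwards [h0] with σ hσ
    by_contra hc
    simp [Set.indicator_of_mem (show Φ^[n] (w, σ) ∈ Aᶜ from hc)] at hσ
  · exact (measurable_one.indicator hA.compl).comp ((hΦ.iterate n).comp measurable_prodMk_left)

open Classical in
/-- The number of steps after the first one until a visit to `O` (`0` if there is none). -/
def returnIndex (Φ : W × S → W × S) (O : Set W) (p : W × S) : ℕ :=
  if h : ∃ j, (Φ^[j + 1] p).1 ∈ O then Nat.find h else 0

/-- The state at the first visit to `O` after time `0`. -/
def returnMap (Φ : W × S → W × S) (O : Set W) (p : W × S) : W × S :=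
  Φ^[returnIndex Φ O p + 1] p

lemma returnIndex_eq_iff {p : W × S} (h : ∃ j, (Φ^[j + 1] p).1 ∈ O) (n : ℕ) :
    returnIndex Φ O p = n ↔ (Φ^[n + 1] p).1 ∈ O ∧ ∀ i < n, (Φ^[i + 1] p).1 ∉ O := by
  classical
  rw [returnIndex, dif_pos h, Nat.find_eq_iff]

lemma measurable_returnIndex (hΦ : Measurable Φ) (hO : MeasurableSet O) :
    Measurable (returnIndex Φ O) := by
  have hm : ∀ j, MeasurableSet {p | (Φ^[j + 1] p).1 ∈ O} := fun j =>
    (hΦ.iterate (j + 1)).fst hO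
  refine measurable_to_countable' fun n => ?_
  have hset : returnIndex Φ O ⁻¹' {n} =
      ({p | (Φ^[n + 1] p).1 ∈ O} ∩ ⋂ i ∈ Finset.range n, {p | (Φ^[i + 1] p).1 ∈ O}ᶜ) ∪
        ((⋂ j, {p | (Φ^[j + 1] p).1 ∈ O}ᶜ) ∩ {_p | n = 0}) := by
    ext p
    simp only [Set.mem_preimage, Set.mem_singleton_iff, Set.mem_union, Set.mem_inter_iff,
      Set.mem_iInter, Finset.mem_range, Set.mem_compl_iff]
    by_cases h : ∃ j, (Φ^[j + 1] p).1 ∈ O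
    · rw [returnIndex_eq_iff h]
      obtain ⟨j, hj⟩ := h
      refine ⟨fun H => Or.inl H, fun H => H.elim id fun H' => absurd hj (H'.1 j)⟩
    · have h' := not_exists.1 h
      rw [returnIndex, dif_neg h]
      exact ⟨fun H => Or.inr ⟨h', H.symm⟩, fun H => H.elim (fun H' => absurd H'.1 (h' n))
        fun H' => H'.2.symm⟩
  rw [hset]
  exact ((hm n).inter (Finset.measurableSet_biInter _ fun i _ => (hm i).compl)).union
    ((MeasurableSet.iInter fun j => (hm j).compl).inter (MeasurableSet.const _))

lemma measurable_returnMap (hΦ : Measurable Φ) (hO : MeasurableSet O) :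
    Measurable (returnMap Φ O) :=
  measurable_of_discrete (measurable_returnIndex hΦ hO) (f := fun n p => Φ^[n + 1] p)
    fun n => hΦ.iterate (n + 1)

lemma returnMap_mem {p : W × S} (h : ∃ j, (Φ^[j + 1] p).1 ∈ O) : (returnMap Φ O p).1 ∈ O :=
  ((returnIndex_eq_iff h _).1 rfl).1

open Classical in
lemma killed_indicator_eq {p : W × S} (h : ∃ j, (Φ^[j + 1] p).1 ∈ O) (f : W × S → ℝ≥0∞) (n : ℕ) :
    killed Φ O ((Prod.fst ⁻¹' O).indicator f) n (Φ p) =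
      if n = returnIndex Φ O p then f (returnMap Φ O p) else 0 := by
  by_cases hn : n = returnIndex Φ O p
  · have h1 := (returnIndex_eq_iff h n).1 hn.symm
    rw [if_pos hn, killed_of_forall h1.2, Set.indicator_of_mem (by exact h1.1), returnMap, ← hn]
    rfl
  · rw [if_neg hn]
    by_cases h2 : ∀ i < n, (Φ^[i] (Φ p)).1 ∉ O
    · rw [killed_of_forall h2]
      refine Set.indicator_of_notMem (fun h3 => hn ?_) _
      exact ((returnIndex_eq_iff h n).2 ⟨h3, h2⟩).symm
    · push Not at h2
      exact killed_of_exists h2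

/-- Killing leaves just the term of the first return. The sum starts at `Φ p`, so that `p` itself
does not count as a visit. -/
lemma tsum_killed_eq {p : W × S} (h : ∃ j, (Φ^[j + 1] p).1 ∈ O) (f : W × S → ℝ≥0∞) :
    ∑' n, killed Φ O ((Prod.fst ⁻¹' O).indicator f) n (Φ p) = f (returnMap Φ O p) := by
  classical
  simp only [killed_indicator_eq h]
  exact tsum_ite_eq _ _

/-- The return map of a refreshing map is refreshing. -/
theorem refreshing_returnMap (hR : Refreshing m Φ) (hΦ : Measurable Φ) (hO : MeasurableSet O)
    (hret : ∀ w, ∀ᵐ σ ∂m, ∃ j, (Φ^[j + 1] (w, σ)).1 ∈ O) : Refreshing m (returnMap Φ O) := by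
  intro w f hf
  have hOm : MeasurableSet (Prod.fst ⁻¹' O : Set (W × S)) := measurable_fst hO
  set g : W × S → ℝ≥0∞ := fun p => ∫⁻ τ, f (p.1, τ) ∂m with hg
  have hgm : Measurable g := measurable_lintegral_snd m hf measurable_fst
  have key : ∀ h : W × S → ℝ≥0∞, Measurable h → ∫⁻ σ, h (returnMap Φ O (w, σ)) ∂m =
      ∑' n, ∫⁻ σ, ∫⁻ τ, killed Φ O ((Prod.fst ⁻¹' O).indicator h) n ((Φ (w, σ)).1, τ) ∂m ∂m := by
    intro h hh
    have hk := measurable_killed hΦ hO (hh.indicator hOm)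
    have h1 : ∫⁻ σ, h (returnMap Φ O (w, σ)) ∂m =
        ∫⁻ σ, ∑' n, killed Φ O ((Prod.fst ⁻¹' O).indicator h) n (Φ (w, σ)) ∂m := by
      refine lintegral_congr_ae ?_
      filter_upwards [hret w] with σ hσ
      exact (tsum_killed_eq hσ h).symm
    rw [h1, lintegral_tsum (f := fun n σ => killed Φ O ((Prod.fst ⁻¹' O).indicator h) n (Φ (w, σ)))
      fun n => ((hk n).comp (hΦ.comp measurable_prodMk_left)).aemeasurable]
    exact tsum_congr fun n => hR w _ (hk n)
  rw [key f hf]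
  refine Eq.trans (tsum_congr fun n => lintegral_congr fun σ => ?_) (key g hgm).symm
  -- For each value of the return index, `f` and its average over the streams have equal means for
  -- each core, hence also at the later time.
  refine lintegral_killed_congr hR hΦ hO (hf.indicator hOm) (hgm.indicator hOm) (fun v => ?_) n _
  by_cases hv : v ∈ O
  · have h1 : ∀ (h : W × S → ℝ≥0∞) (σ : S), (Prod.fst ⁻¹' O).indicator h (v, σ) = h (v, σ) :=
      fun h σ => Set.indicator_of_mem (by exact hv) h
    simp [h1, hg]
  · have h1 : ∀ (h : W × S → ℝ≥0∞) (σ : S), (Prod.fst ⁻¹' O).indicator h (v, σ) = 0 :=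
      fun h σ => Set.indicator_of_notMem (by exact hv) h
    simp [h1]

end Refresh

/-! ### Properties of the transitions of the system -/

section Transitions

variable (M : Model)

lemma next_ne_departure_of_idle {v : Core} (hv : v.1 = false) (σ : Streams) :
    next (v, σ) ≠ .departure := by
  intro h
  have := ((next_eq_departure_iff v σ).1 h).1
  simp [hv] at this

lemma step_fst_of_departure {p : Core × Streams} (h : next p = .departure) :
    (step p).1 = (false, p.1.2.1, 0) := by
  rw [step, h]
  rfl

lemma step_busy {p : Core × Streams} (h : next p ≠ .departure) : (step p).1.1 = true := by
  rw [step]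
  rcases hn : next p with _ | k | k
  · exact absurd hn h
  · simp only [effect]
    split_ifs <;> rfl
  · simp only [effect]
    split_ifs <;> rfl

lemma step_residual_of_busy {p : Core × Streams} (h : next p ≠ .departure) (hb : p.1.1 = true) :
    (step p).1.2.2 = p.1.2.2 - duration p := by
  rw [step]
  rcases hn : next p with _ | k | k
  · exact absurd hn h
  · simp [effect, hb]
  · simp [effect, hb]

lemma duration_pos {p : Core × Streams} (hσ : Regular p.2) (h : next p ≠ .departure) :
    0 < duration p := by
  rw [duration]
  rcases hn : next p with _ | k | k
  · exact absurd hn h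
  · exact hσ.1 k
  · exact hσ.2.1 k

/-- The cores with an idle server. -/
def idle : Set Core := {v | v.1 = false}

lemma measurableSet_idle : MeasurableSet idle := by
  have : Measurable fun v : Core => v.1 := by fun_prop
  exact this (measurableSet_singleton false)

/-- All four clocks are beyond `R`. -/
def clocksBeyond (R : ℝ) : Set Streams :=
  {σ | (∀ k, R < σ (.interarrival k) 0) ∧ ∀ k, R < σ (.retrial k) 0}

lemma measurableSet_clocksBeyond (R : ℝ) : MeasurableSet (clocksBeyond R) := by
  have h : ∀ i : Kind, Measurable fun σ : Streams => σ i 0 := fun i => by fun_prop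
  simp only [clocksBeyond, Set.ofPred_and, Set.ofPred_forall]
  exact (MeasurableSet.iInter fun k => h _ measurableSet_Ioi).inter
    (MeasurableSet.iInter fun k => h _ measurableSet_Ioi)

lemma expMeasure_Ioi_pos {r d : ℝ} (hr : 0 < r) (hd : 0 ≤ d) :
    0 < expMeasure r (Set.Ioi d) := by
  have h := expMeasure_above hr hd False
  rw [above, if_neg not_false] at h
  rw [h]
  exact ENNReal.ofReal_pos.2 (Real.exp_pos _)

lemma streams_heads_pos (B : Kind → Set ℝ) (hB : ∀ i, MeasurableSet (B i))
    (h : ∀ i, 0 < M.law i (B i)) : 0 < M.streams {σ | ∀ i, σ i 0 ∈ B i} := by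
  rw [Model.streams, streamsLaw_heads B hB]
  exact pos_iff_ne_zero.2 (Finset.prod_ne_zero_iff.2 fun i _ => (h i).ne')

lemma clocksBeyond_pos {R : ℝ} (hR : 0 ≤ R) : 0 < M.streams (clocksBeyond R) := by
  refine lt_of_lt_of_le (streams_heads_pos M (fun
    | .interarrival _ => Set.Ioi R
    | .retrial _ => Set.Ioi R
    | .service _ => Set.univ) ?_ ?_) (measure_mono ?_)
  · rintro (k | k | k)
    · exact measurableSet_Ioi
    · exact measurableSet_Ioi
    · exact MeasurableSet.univ
  · rintro (k | k | k)
    · exact expMeasure_Ioi_pos (M.lam_pos k) hR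
    · exact expMeasure_Ioi_pos (M.alpha_pos k) hR
    · simp
  · intro σ hσ
    exact ⟨fun k => hσ (.interarrival k), fun k => hσ (.retrial k)⟩

lemma next_eq_departure_of_mem {v : Core} {R : ℝ} (hb : v.1 = true) (hr : v.2.2 ≤ R)
    {σ : Streams} (hσ : σ ∈ clocksBeyond R) : next (v, σ) = .departure := by
  refine (next_eq_departure_iff v σ).2 ⟨hb, fun j hj => ?_⟩
  rw [mem_running] at hj
  rw [mem_above_of trivial]
  rcases j with k | k | k
  · exact hr.trans (hσ.1 k).le
  · exact hr.trans (hσ.2 k).le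
  · exact hj.elim

/-- During a service the residual time only decreases, so it stays below `R`. At each step the fresh
clocks all exceed `R` with the same probability, and then the next event is the departure. Hence the
service survives with geometrically decaying probability; the index `n + 1` against the exponent `n`
makes the base case the trivial bound. -/
lemma lintegral_killed_idle_le {R : ℝ} (n : ℕ) :
    ∀ v : Core, v.2.2 ≤ R → ∫⁻ σ, killed step idle 1 (n + 1) (v, σ) ∂M.streams ≤
      (1 - M.streams (clocksBeyond R)) ^ n := by
  set ε := M.streams (clocksBeyond R) with hε
  have h1 : ∀ n p, killed step idle (1 : Core × Streams → ℝ≥0∞) n p ≤ 1 := by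
    intro n p
    by_cases h : ∀ i < n, (step^[i] p).1 ∉ idle
    · rw [killed_of_forall h]
      rfl
    · push Not at h
      rw [killed_of_exists h]
      exact zero_le
  induction n with
  | zero =>
    intro v _
    refine (lintegral_mono fun σ => h1 _ _).trans ?_
    simp
  | succ n ih =>
    intro v hv
    by_cases hi : v ∈ idle
    · simp [killed, hi]
    have hb : v.1 = true := by
      have : v.1 ≠ false := hi
      simpa using this
    rw [lintegral_killed_succ (refreshing_step M) measurable_step measurableSet_idle
      measurable_one (n + 1) hi]
    have hbound : ∀ᵐ σ ∂M.streams,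
        ∫⁻ τ, killed step idle 1 (n + 1) ((step (v, σ)).1, τ) ∂M.streams ≤
          (clocksBeyond R)ᶜ.indicator (fun _ => (1 - ε) ^ n) σ := by
      filter_upwards [M.ae_regular] with σ hσ
      by_cases hd : next (v, σ) = .departure
      · have : (step (v, σ)).1 ∈ idle := by
          rw [step_fst_of_departure hd]
          rfl
        simp [killed, this]
      · rw [Set.indicator_of_mem (show σ ∈ (clocksBeyond R)ᶜ from
          fun hm => hd (next_eq_departure_of_mem hb hv hm))]
        refine ih _ ?_
        rw [step_residual_of_busy hd hb]
        exact (sub_le_self _ (duration_pos (p := (v, σ)) hσ hd).le).trans hv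
    refine (lintegral_mono_ae hbound).trans ?_
    rw [lintegral_indicator_const (measurableSet_clocksBeyond R).compl,
      prob_compl_eq_one_sub (measurableSet_clocksBeyond R), pow_succ]

lemma ae_exists_idle (v : Core) : ∀ᵐ σ ∂M.streams, ∃ j, (step^[j] (v, σ)).1 ∈ idle := by
  set R := max v.2.2 0 with hR
  have hε := clocksBeyond_pos M (R := R) (le_max_right _ _)
  set N : Set Streams := {σ | ∃ j, (step^[j] (v, σ)).1 ∈ idle}ᶜ with hN
  have hle : ∀ n, M.streams N ≤ (1 - M.streams (clocksBeyond R)) ^ n := by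
    intro n
    refine le_trans ?_ (lintegral_killed_idle_le M (R := R) n v (le_max_left _ _))
    have hm : MeasurableSet N := by
      have : {σ | ∃ j, (step^[j] (v, σ)).1 ∈ idle} =
          ⋃ j, {σ | (step^[j] (v, σ)).1 ∈ idle} := by
        ext σ
        simp
      rw [hN, this]
      refine (MeasurableSet.iUnion fun j => ?_).compl
      have : Measurable fun σ => (step^[j] (v, σ)).1 :=
        ((measurable_step.iterate j).comp measurable_prodMk_left).fst
      exact this measurableSet_idle
    rw [← lintegral_indicator_one hm]
    refine lintegral_mono fun σ => ?_
    by_cases hσ : σ ∈ N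
    · rw [Set.indicator_of_mem hσ, killed_of_forall fun i _ h => hσ ⟨i, h⟩]
      rfl
    · simp [hσ]
  have hlim := ENNReal.tendsto_pow_atTop_nhds_zero_of_lt_one (r := 1 - M.streams (clocksBeyond R))
    (ENNReal.sub_lt_self ENNReal.one_ne_top one_ne_zero hε.ne')
  have h0 : M.streams N = 0 := le_antisymm (ge_of_tendsto' hlim hle) (zero_le)
  exact h0

lemma ae_exists_return_idle (v : Core) :
    ∀ᵐ σ ∂M.streams, ∃ j, (step^[j + 1] (v, σ)).1 ∈ idle := by
  set A : Set (Core × Streams) := {p | ∃ j, (step^[j] p).1 ∈ idle} with hA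
  have hAm : MeasurableSet A := by
    have : A = ⋃ j, {p | (step^[j] p).1 ∈ idle} := by
      ext p
      simp [hA]
    rw [this]
    exact MeasurableSet.iUnion fun j => (measurable_step.iterate j).fst measurableSet_idle
  filter_upwards [ae_iterate (refreshing_step M) measurable_step hAm (ae_exists_idle M) v]
    with σ hσ
  -- The hitting property of the state after one step excludes the visit at time zero.
  exact hσ 1

/-- The transition of the system from a departure to the next one. -/
def cycle : Core × Streams → Core × Streams := returnMap step idle

@[fun_prop]
lemma measurable_cycle : Measurable cycle :=
  measurable_returnMap measurable_step measurableSet_idle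

theorem refreshing_cycle : Refreshing M.streams cycle :=
  refreshing_returnMap (refreshing_step M) measurable_step measurableSet_idle
    (ae_exists_return_idle M)

/-- The expected time until the next event is proportional to the probability that this event
is an arrival of class `k`. -/
lemma lintegral_duration (v : Core) (k : Fin 2) :
    ENNReal.ofReal (M.lam k) * ∫⁻ σ, ENNReal.ofReal (duration (v, σ)) ∂M.streams =
      M.streams {σ | next (v, σ) = .arrival k} := by
  have hm : MeasurableSet {σ | next (v, σ) = .arrival k} := by
    have : Measurable fun σ => next (v, σ) := by fun_prop
    exact this (measurableSet_singleton _)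
  have hp : IsProbabilityMeasure (expMeasure (M.lam k)) :=
    isProbabilityMeasure_expMeasure (M.lam_pos k)
  rw [← lintegral_indicator_one hm, Model.streams, streamsLaw,
    lintegral_pi_update' (.interarrival k) (f := fun σ => ENNReal.ofReal (duration (v, σ)))
      (by fun_prop),
    lintegral_pi_update' (.interarrival k) (measurable_one.indicator hm),
    ← lintegral_const_mul' _ _ ENNReal.ofReal_ne_top]
  refine lintegral_congr fun σ => ?_
  set s := frame (v, σ) with hs
  -- Everything except the interarrival stream `k` is frozen. The earliest other running clock shows
  -- a constant `c` (the other class always has a running clock), so the duration is `min (t 0) c`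
  -- and, up to a tie, the next event is the arrival exactly if `t 0 < c`.
  obtain ⟨e₀, ⟨he₀, hne₀⟩, hmin⟩ := Set.exists_min_image {e | s.IsActive e ∧ e ≠ .arrival k} s.clock
    (Set.toFinite _) ⟨.arrival (1 - k), trivial, by
      intro h
      simp only [Event.arrival.injEq] at h
      omega⟩
  set c := s.clock e₀ with hc
  set u : (ℕ → ℝ) → Core × Streams := fun t => (v, Function.update σ (.interarrival k) t) with hu
  have hclock : ∀ t e, e ≠ .arrival k → (frame (u t)).clock e = s.clock e := by
    rintro t (_ | l | l) hne
    · rfl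
    · have : l ≠ k := fun h => hne (by rw [h])
      simp [SysState.clock, frame, hs, hu, this]
    · simp [SysState.clock, frame, hs, hu]
  have hclk : ∀ t, (frame (u t)).clock (.arrival k) = t 0 := by
    intro t
    simp [SysState.clock, frame, hu]
  have hact : ∀ t e, (frame (u t)).IsActive e ↔ s.IsActive e := by
    rintro t (_ | l | l) <;> exact Iff.rfl
  have hnextof : ∀ t, t 0 < c → next (u t) = .arrival k := by
    intro t ht
    refine ((frame (u t)).nextEvent_eq_iff _).2 ⟨trivial, fun e hne he => ?_⟩
    have hlt : (frame (u t)).clock (.arrival k) < (frame (u t)).clock e := by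
      rw [hclk, hclock t e hne]
      exact ht.trans_le (hmin e ⟨(hact t e).1 he, hne⟩)
    rw [mem_above]
    split_ifs
    · exact hlt.le
    · exact hlt
  have hmin' : ∀ t, duration (u t) = min (t 0) c := by
    intro t
    have hn := (frame (u t)).isNext_nextEvent
    refine le_antisymm (le_min ?_ ?_) ?_
    · rw [← hclk t]
      exact hn.2 _ trivial
    · rw [hc, ← hclock t e₀ hne₀]
      exact hn.2 _ ((hact t e₀).2 he₀)
    · by_cases hk : next (u t) = .arrival k
      · rw [duration, hk, hclk]
        exact min_le_left _ _
      · rw [duration, hclock t _ hk]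
        exact (min_le_right _ _).trans (hmin _ ⟨(hact t _).1 hn.1, hk⟩)
  have hnext : ∀ t, next (u t) = .arrival k → t 0 ≤ c := by
    intro t ht
    have := hmin' t
    rw [duration, ht, hclk] at this
    rw [this]
    exact min_le_right _ _
  change ENNReal.ofReal (M.lam k) * ∫⁻ t, ENNReal.ofReal (duration (u t))
    ∂streamLaw (expMeasure (M.lam k)) = ∫⁻ t, Set.indicator _ 1 (Function.update σ _ t)
    ∂streamLaw (expMeasure (M.lam k))
  simp only [hmin']
  rw [lintegral_streamLaw_head (f := fun a => ENNReal.ofReal (min a c)) (by fun_prop)]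
  have hR : ∫⁻ t, Set.indicator {σ | next (v, σ) = .arrival k} 1
      (Function.update σ (.interarrival k) t) ∂streamLaw (expMeasure (M.lam k)) =
        expMeasure (M.lam k) (Set.Iio c) := by
    have hne : ∀ᵐ t ∂streamLaw (expMeasure (M.lam k)), t 0 ≠ c := by
      have h0 : streamLaw (expMeasure (M.lam k)) {s | s 0 ∈ ({c} : Set ℝ)} = 0 := by
        rw [streamLaw_head _ (measurableSet_singleton c), measure_singleton]
      filter_upwards [measure_eq_zero_iff_ae_notMem.1 h0] with t ht
      exact ht
    rw [← lintegral_indicator_one measurableSet_Iio,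
      ← lintegral_streamLaw_head (measurable_one.indicator measurableSet_Iio)]
    refine lintegral_congr_ae ?_
    filter_upwards [hne] with t ht
    by_cases htc : t 0 < c
    · rw [Set.indicator_of_mem (by exact hnextof t htc), Set.indicator_of_mem (by exact htc)]
      rfl
    · rw [Set.indicator_of_notMem (show t 0 ∉ Set.Iio c from htc), Set.indicator_of_notMem]
      intro h
      exact htc (lt_of_le_of_ne (hnext t h) ht)
  rw [hR]
  by_cases hc0 : 0 ≤ c
  · exact lintegral_min_expMeasure (M.lam_pos k) hc0
  -- A core with negative residual can make `c` negative; then both sides vanish.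
  · have hc1 : c < 0 := not_le.1 hc0
    have h0 : expMeasure (M.lam k) (Set.Iio c) = 0 :=
      measure_mono_null (Set.Iio_subset_Iio hc1.le) expMeasure_Iio_zero
    have h1 : ∀ a, ENNReal.ofReal (min a c) = 0 := fun a =>
      ENNReal.ofReal_of_nonpos ((min_le_right _ _).trans hc1.le)
    simp [h0, h1]

end Transitions

/-! ### The chain of orbit sizes at departures -/

section DepartureChain

variable (M : Model)

lemma indicator_eq_indicator {α β : Type*} {s : Set α} {t : Set β} {f : α → ℝ≥0∞} {g : β → ℝ≥0∞}
    {a : α} {b : β} (h : a ∈ s ↔ b ∈ t) (hfg : f a = g b) : s.indicator f a = t.indicator g b := by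
  by_cases hb : b ∈ t
  · rw [Set.indicator_of_mem hb, Set.indicator_of_mem (h.2 hb), hfg]
  · rw [Set.indicator_of_notMem hb, Set.indicator_of_notMem fun ha => hb (h.1 ha)]

/-- The core just after a departure which leaves the orbit sizes `x`. -/
def rest (x : Fin 2 → ℕ) : Core := (false, x, 0)

instance (x : Fin 2 → ℕ) : IsProbabilityMeasure
    (M.streams.map fun σ => (cycle (rest x, σ)).1.2.1) :=
  Measure.isProbabilityMeasure_map (by fun_prop)

/-- The transition probabilities of the orbit sizes at departures. -/
def Model.transition (x : Fin 2 → ℕ) : PMF (Fin 2 → ℕ) :=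
  (M.streams.map fun σ => (cycle (rest x, σ)).1.2.1).toPMF

/-- Only a departure produces an idle server, and it resets the residual to `0`. -/
lemma cycle_fst {p : Core × Streams} (h : ∃ j, (step^[j + 1] p).1 ∈ idle) :
    (cycle p).1 = rest (cycle p).1.2.1 := by
  have hi : (cycle p).1 ∈ idle := returnMap_mem h
  have hc : cycle p = step (step^[returnIndex step idle p] p) := by
    rw [cycle, returnMap, Function.iterate_succ_apply']
  rw [hc] at hi ⊢
  have hd : next (step^[returnIndex step idle p] p) = .departure := by
    by_contra hne
    have h1 := step_busy hne
    have h2 : (step (step^[returnIndex step idle p] p)).1.1 = false := hi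
    rw [h1] at h2
    cases h2
  rw [step_fst_of_departure hd]
  rfl

/-- The Markov property at a departure: the next core is determined by the orbit sizes, and the
streams are fresh given it. -/
lemma lintegral_cycle (x : Fin 2 → ℕ) {f : Core × Streams → ℝ≥0∞} (hf : Measurable f) :
    ∫⁻ σ, f (cycle (rest x, σ)) ∂M.streams =
      ∑' z, M.transition x z * ∫⁻ τ, f (rest z, τ) ∂M.streams := by
  rw [refreshing_cycle M _ _ hf]
  set H : (Fin 2 → ℕ) → ℝ≥0∞ := fun z => ∫⁻ τ, f (rest z, τ) ∂M.streams with hH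
  have h1 : ∫⁻ σ, ∫⁻ τ, f ((cycle (rest x, σ)).1, τ) ∂M.streams ∂M.streams =
      ∫⁻ σ, H (cycle (rest x, σ)).1.2.1 ∂M.streams := by
    refine lintegral_congr_ae ?_
    filter_upwards [ae_exists_return_idle M (rest x)] with σ hσ
    simp only [hH]
    rw [← cycle_fst hσ]
  have h2 : ∫⁻ σ, H (cycle (rest x, σ)).1.2.1 ∂M.streams =
      ∫⁻ z, H z ∂M.streams.map fun σ => (cycle (rest x, σ)).1.2.1 :=
    (lintegral_map (measurable_of_countable H) (by fun_prop)).symm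
  rw [h1, h2, lintegral_countable']
  refine tsum_congr fun z => ?_
  rw [mul_comm, Model.transition, Measure.toPMF_apply]

/-- The orbit sizes at the successive departures. -/
def orbits (n : ℕ) (p : Core × Streams) : Fin 2 → ℕ := (cycle^[n + 1] p).1.2.1

@[fun_prop]
lemma measurable_orbits (n : ℕ) : Measurable (orbits n) :=
  (measurable_cycle.iterate (n + 1)).fst.snd.fst

lemma orbits_succ (n : ℕ) (p : Core × Streams) : orbits (n + 1) p = orbits n (cycle p) := rfl

lemma measurableSet_orbits_eq (x : ℕ → Fin 2 → ℕ) (n : ℕ) :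
    MeasurableSet {p : Core × Streams | ∀ i < n, orbits i p = x i} := by
  have : {p : Core × Streams | ∀ i < n, orbits i p = x i} =
      ⋂ i ∈ Finset.range n, {p | orbits i p = x i} := by
    ext p
    simp
  rw [this]
  exact Finset.measurableSet_biInter _ fun i _ =>
    measurable_orbits i (measurableSet_singleton (x i))

lemma measurableSet_orbits_ne (y : Fin 2 → ℕ) (n : ℕ) :
    MeasurableSet {p : Core × Streams | ∀ i < n, orbits i p ≠ y} := by
  have : {p : Core × Streams | ∀ i < n, orbits i p ≠ y} =
      ⋂ i ∈ Finset.range n, {p | orbits i p = y}ᶜ := by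
    ext p
    simp
  rw [this]
  exact Finset.measurableSet_biInter _ fun i _ =>
    (measurable_orbits i (measurableSet_singleton y)).compl

/-- Conditioning on the first cycle; of the sum over its outcomes only `x 0` survives, and the rest
of the path is the shifted sequence. -/
lemma streams_path (n : ℕ) : ∀ (x₀ : Fin 2 → ℕ) (x : ℕ → Fin 2 → ℕ),
    M.streams {σ | ∀ i < n + 1, orbits i (rest x₀, σ) = x i} =
      M.transition x₀ (x 0) * ∏ i ∈ Finset.range n, M.transition (x i) (x (i + 1)) := by
  induction n with
  | zero =>
    intro x₀ x
    have hm : Measurable fun σ : Streams => (cycle (rest x₀, σ)).1.2.1 := by fun_prop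
    rw [Finset.range_zero, Finset.prod_empty, mul_one, Model.transition, Measure.toPMF_apply,
      Measure.map_apply hm (measurableSet_singleton _)]
    congr 1
    ext σ
    simp [orbits]
  | succ n ih =>
    intro x₀ x
    have hA : MeasurableSet {p : Core × Streams | p.1.2.1 = x 0 ∧
        ∀ i < n + 1, orbits i p = x (i + 1)} := by
      refine MeasurableSet.inter (s₁ := {p : Core × Streams | p.1.2.1 = x 0}) ?_
        (measurableSet_orbits_eq (fun i => x (i + 1)) (n + 1))
      have : Measurable fun p : Core × Streams => p.1.2.1 := by fun_prop
      exact this (measurableSet_singleton _)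
    have h1 : {σ : Streams | ∀ i < n + 1 + 1, orbits i (rest x₀, σ) = x i} =
        {σ | cycle (rest x₀, σ) ∈ {p : Core × Streams | p.1.2.1 = x 0 ∧
          ∀ i < n + 1, orbits i p = x (i + 1)}} := by
      ext σ
      refine ⟨fun h => ⟨h 0 (by omega), fun i hi => h (i + 1) (by omega)⟩, fun h i hi => ?_⟩
      cases i with
      | zero => exact h.1
      | succ i => exact h.2 i (by omega)
    have hm1 : MeasurableSet {σ : Streams | ∀ i < n + 1 + 1, orbits i (rest x₀, σ) = x i} :=
      (measurableSet_orbits_eq x (n + 2)).preimage measurable_prodMk_left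
    rw [← lintegral_indicator_one hm1, h1]
    refine (lintegral_cycle M x₀ (measurable_one.indicator hA)).trans ?_
    rw [tsum_eq_single (x 0)]
    · rw [Finset.prod_range_succ', mul_comm (∏ i ∈ _, _), ← ih (x 0) fun i => x (i + 1)]
      congr 1
      have hm2 : MeasurableSet {σ : Streams | ∀ i < n + 1, orbits i (rest (x 0), σ) = x (i + 1)} :=
        (measurableSet_orbits_eq (fun i => x (i + 1)) (n + 1)).preimage measurable_prodMk_left
      rw [← lintegral_indicator_one hm2]
      refine lintegral_congr fun τ => ?_
      exact indicator_eq_indicator ⟨fun h => h.2, fun h => ⟨rfl, h⟩⟩ rfl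
    · intro z hz
      have : ∀ τ : Streams, ({p : Core × Streams | p.1.2.1 = x 0 ∧
          ∀ i < n + 1, orbits i p = x (i + 1)}.indicator 1 (rest z, τ) : ℝ≥0∞) = 0 :=
        fun τ => Set.indicator_of_notMem (fun h => hz h.1) _
      rw [lintegral_congr this, lintegral_zero, mul_zero]

lemma streams_avoid (y : Fin 2 → ℕ) (n : ℕ) : ∀ x : Fin 2 → ℕ,
    M.streams {σ | ∀ i < n, orbits i (rest x, σ) ≠ y} = avoid M.transition y n x := by
  induction n with
  | zero =>
    intro x
    simp [avoid]
  | succ n ih =>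
    intro x
    have hA : MeasurableSet {p : Core × Streams | p.1.2.1 ≠ y ∧ ∀ i < n, orbits i p ≠ y} := by
      refine MeasurableSet.inter (s₁ := {p : Core × Streams | p.1.2.1 ≠ y}) ?_
        (measurableSet_orbits_ne y n)
      have : Measurable fun p : Core × Streams => p.1.2.1 := by fun_prop
      exact (this (measurableSet_singleton y)).compl
    have h1 : {σ : Streams | ∀ i < n + 1, orbits i (rest x, σ) ≠ y} =
        {σ | cycle (rest x, σ) ∈ {p : Core × Streams | p.1.2.1 ≠ y ∧
          ∀ i < n, orbits i p ≠ y}} := by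
      ext σ
      refine ⟨fun h => ⟨h 0 (by omega), fun i hi => h (i + 1) (by omega)⟩, fun h i hi => ?_⟩
      cases i with
      | zero => exact h.1
      | succ i => exact h.2 i (by omega)
    have hm1 : MeasurableSet {σ : Streams | ∀ i < n + 1, orbits i (rest x, σ) ≠ y} :=
      (measurableSet_orbits_ne y (n + 1)).preimage measurable_prodMk_left
    rw [← lintegral_indicator_one hm1, h1]
    refine (lintegral_cycle M x (measurable_one.indicator hA)).trans ?_
    rw [avoid]
    refine tsum_congr fun z => ?_
    by_cases hz : z = y
    · rw [if_pos hz]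
      have : ∀ τ : Streams, ({p : Core × Streams | p.1.2.1 ≠ y ∧
          ∀ i < n, orbits i p ≠ y}.indicator 1 (rest z, τ) : ℝ≥0∞) = 0 :=
        fun τ => Set.indicator_of_notMem (fun h => h.1 hz) _
      simp [this]
    · rw [if_neg hz, ← ih z]
      congr 1
      have hm2 : MeasurableSet {σ : Streams | ∀ i < n, orbits i (rest z, σ) ≠ y} :=
        (measurableSet_orbits_ne y n).preimage measurable_prodMk_left
      rw [← lintegral_indicator_one hm2]
      refine lintegral_congr fun τ => ?_
      exact indicator_eq_indicator ⟨fun h => h.2, fun h => ⟨hz, h⟩⟩ rfl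

/-! ### Leaving the empty state -/

/-- The cores of an empty system. -/
def emptyCore : Set Core := {v | v.1 = false ∧ v.2.1 = 0}

lemma measurableSet_emptyCore : MeasurableSet emptyCore := by
  have h1 : Measurable fun v : Core => v.1 := by fun_prop
  have h2 : Measurable fun v : Core => v.2.1 := by fun_prop
  exact (h1 (measurableSet_singleton false)).inter (h2 (measurableSet_singleton 0))

lemma next_of_mem_emptyCore {p : Core × Streams} (hp : p.1 ∈ emptyCore) :
    ∃ k, next p = .arrival k := by
  have h := (frame p).isNext_nextEvent.1
  rcases hn : next p with _ | k | k
  · exact absurd hn (next_ne_departure_of_idle hp.1 p.2)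
  · exact ⟨k, rfl⟩
  · have h2 : (frame p).IsActive (.retrial k) := hn ▸ h
    have h3 : 0 < p.1.2.1 k := h2
    rw [hp.2] at h3
    exact absurd h3 (lt_irrefl 0)

lemma next_rest_zero (σ : Streams) : ∃ k, next (rest 0, σ) = .arrival k :=
  next_of_mem_emptyCore ⟨rfl, rfl⟩

lemma expire_service (v : Core) (e : Event) (σ : Streams) (k : Fin 2) :
    expire v e σ (.service k) = σ (.service k) := by
  rcases e with _ | l | l <;>
    simp [expire, afterWin, shiftHeads, mem_running, Kind.IsRunning]

lemma step_rest_zero_fst {σ : Streams} {k : Fin 2} (h : next (rest 0, σ) = .arrival k) :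
    (step (rest 0, σ)).1 = (true, 0, σ (.service k) 0) := by
  rw [step, h]
  simp [effect, rest, enter, expire_service]

/-- From the empty system only arrivals are possible. Their probabilities are the rates times the
same mean duration and add up to one, which determines that duration. -/
lemma streams_next_rest_zero (k : Fin 2) :
    M.streams {σ | next (rest 0, σ) = .arrival k} =
      ENNReal.ofReal (M.lam k / (M.lam 0 + M.lam 1)) := by
  have h0 := lintegral_duration M (rest 0) 0
  have h1 := lintegral_duration M (rest 0) 1
  have hk := lintegral_duration M (rest 0) k
  set D := ∫⁻ σ, ENNReal.ofReal (duration (rest 0, σ)) ∂M.streams with hD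
  have hm : ∀ k, MeasurableSet {σ | next (rest 0, σ) = .arrival k} := fun k => by
    have : Measurable fun σ => next (rest 0, σ) := by fun_prop
    exact this (measurableSet_singleton _)
  have hsum : M.streams {σ | next (rest 0, σ) = .arrival 0} +
      M.streams {σ | next (rest 0, σ) = .arrival 1} = 1 := by
    rw [← measure_union _ (hm 1)]
    · rw [← measure_univ (μ := M.streams)]
      congr 1
      ext σ
      simp only [Set.mem_union, Set.mem_univ, iff_true]
      obtain ⟨k, hk⟩ := next_rest_zero σ
      fin_cases k
      · exact Or.inl hk
      · exact Or.inr hk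
    · refine Set.disjoint_left.2 fun σ h0 h1 => ?_
      have h0' : next (rest 0, σ) = .arrival 0 := h0
      have h1' : next (rest 0, σ) = .arrival 1 := h1
      rw [h0'] at h1'
      simp at h1'
  have hpos : 0 < M.lam 0 + M.lam 1 := add_pos (M.lam_pos 0) (M.lam_pos 1)
  rw [← h0, ← h1, ← add_mul, ← ENNReal.ofReal_add (M.lam_pos 0).le (M.lam_pos 1).le] at hsum
  have hDinv : D = (ENNReal.ofReal (M.lam 0 + M.lam 1))⁻¹ :=
    ENNReal.eq_inv_of_mul_eq_one_left (by rwa [mul_comm])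
  rw [← hk, hDinv, ← ENNReal.ofReal_inv_of_pos hpos, ← ENNReal.ofReal_mul (M.lam_pos k).le,
    div_eq_mul_inv]

/-- The class of the next arrival depends on the clocks alone, so it is independent of the service
streams, from which the new residual is drawn. -/
lemma lintegral_step_rest_zero {f : Core → ℝ≥0∞} (hf : Measurable f) :
    ∫⁻ σ, f (step (rest 0, σ)).1 ∂M.streams =
      ∑ k, ENNReal.ofReal (M.lam k / (M.lam 0 + M.lam 1)) * ∫⁻ a, f (true, 0, a) ∂M.F k := by
  have hm : ∀ e, MeasurableSet {σ | next (rest 0, σ) = e} := fun e => by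
    have : Measurable fun σ => next (rest 0, σ) := by fun_prop
    exact this (measurableSet_singleton _)
  have harr : ∀ k, ∫⁻ σ in {σ | next (rest 0, σ) = .arrival k},
      f (step (rest 0, σ)).1 ∂M.streams =
        ENNReal.ofReal (M.lam k / (M.lam 0 + M.lam 1)) * ∫⁻ a, f (true, 0, a) ∂M.F k := by
    intro k
    have := M.prob k
    rw [setLIntegral_congr_fun (hm _) (g := fun σ => f (true, 0, σ (.service k) 0))
      fun σ hσ => by simp only [step_rest_zero_fst hσ], ← lintegral_indicator (hm _),
      Model.streams, streamsLaw, lintegral_pi_update (.service k)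
        (Measurable.indicator (by fun_prop) (hm _)), ← streamsLaw]
    have hin : ∀ t, ∫⁻ σ, {σ | next (rest 0, σ) = .arrival k}.indicator
        (fun σ => f (true, 0, σ (.service k) 0)) (Function.update σ (.service k) t)
          ∂streamsLaw M.law =
        ENNReal.ofReal (M.lam k / (M.lam 0 + M.lam 1)) * f (true, 0, t 0) := by
      intro t
      rw [← streams_next_rest_zero M k, mul_comm, ← lintegral_indicator_const (hm _)]
      refine lintegral_congr fun σ => ?_
      have hfr : next (rest 0, Function.update σ (.service k) t) = next (rest 0, σ) := by
        have : frame (rest 0, Function.update σ (.service k) t) = frame (rest 0, σ) := by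
          simp [frame]
        rw [next, this, next]
      refine indicator_eq_indicator ?_ (by simp)
      change next (rest 0, Function.update σ (.service k) t) = _ ↔ next (rest 0, σ) = _
      rw [hfr]
    simp only [hin]
    rw [lintegral_const_mul _ (by fun_prop)]
    congr 1
    exact lintegral_streamLaw_head (ν := M.F k) (f := fun a => f (true, 0, a)) (by fun_prop)
  classical
  rw [lintegral_next M (rest 0), tsum_eq_sum (s := {.arrival 0, .arrival 1}),
    Finset.sum_pair (by simp), harr, harr, Fin.sum_univ_two]
  intro e he
  have : {σ | next (rest 0, σ) = e} = ∅ := by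
    ext σ
    refine ⟨fun h => he ?_, fun h => h.elim⟩
    obtain ⟨k, hk⟩ := next_rest_zero σ
    have h' : next (rest 0, σ) = e := h
    rw [← h', hk]
    fin_cases k <;> simp
  rw [this]
  simp

/-! ### All states are reached from the empty one -/

/-- The `n` missing customers can arrive one by one during the current service: an arrival of a
missing class falls into `(0, r)` while all other clocks exceed `r`, which leaves a positive
residual and fresh streams. When none is missing, all clocks may outlast the service, and the extra
step is the departure. -/
lemma lintegral_killed_pos_of_le (y : Fin 2 → ℕ) (n : ℕ) : ∀ (x : Fin 2 → ℕ) (r : ℝ), 0 < r →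
    x ≤ y → y 0 + y 1 = x 0 + x 1 + n →
    0 < ∫⁻ σ, killed step idle ((Prod.fst ⁻¹' idle).indicator
      ({p : Core × Streams | p.1.2.1 = y}.indicator 1)) (n + 1) ((true, x, r), σ) ∂M.streams := by
  have hy : MeasurableSet {p : Core × Streams | p.1.2.1 = y} := by
    have : Measurable fun p : Core × Streams => p.1.2.1 := by fun_prop
    exact this (measurableSet_singleton _)
  have hh : Measurable ((Prod.fst ⁻¹' idle).indicator
      ({p : Core × Streams | p.1.2.1 = y}.indicator (1 : Core × Streams → ℝ≥0∞))) :=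
    (measurable_one.indicator hy).indicator (measurable_fst measurableSet_idle)
  have hbusy : ∀ x r, ((true, x, r) : Core) ∉ idle := fun x r h => by cases h
  induction n with
  | zero =>
    intro x r hr hxy hsum
    have hx : x = y := by
      have h0 : x 0 ≤ y 0 := hxy 0
      have h1 : x 1 ≤ y 1 := hxy 1
      funext k
      fin_cases k
      · change x 0 = y 0
        omega
      · change x 1 = y 1
        omega
    subst hx
    refine lt_of_lt_of_le (clocksBeyond_pos M hr.le) ?_
    rw [← lintegral_indicator_one (measurableSet_clocksBeyond r)]
    refine lintegral_mono fun σ => ?_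
    by_cases hσ : σ ∈ clocksBeyond r
    · have hd := next_eq_departure_of_mem (v := (true, x, r)) rfl le_rfl hσ
      have hs := step_fst_of_departure hd
      rw [Set.indicator_of_mem hσ, killed, if_neg (hbusy x r), killed,
        Set.indicator_of_mem (show step ((true, x, r), σ) ∈ Prod.fst ⁻¹' idle by
          change (step ((true, x, r), σ)).1.1 = false
          rw [hs]),
        Set.indicator_of_mem (show step ((true, x, r), σ) ∈ {p | p.1.2.1 = x} by
          change (step ((true, x, r), σ)).1.2.1 = x
          rw [hs])]
      rfl
    · simp [hσ]
  | succ n ih =>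
    intro x r hr hxy hsum
    obtain ⟨k, hk⟩ : ∃ k, x k < y k := by
      by_contra hc
      push Not at hc
      have h0 := hc 0
      have h1 := hc 1
      omega
    rw [lintegral_killed_succ (refreshing_step M) measurable_step measurableSet_idle hh (n + 1)
      (hbusy x r)]
    have hmeas : Measurable fun σ => ∫⁻ τ, killed step idle ((Prod.fst ⁻¹' idle).indicator
      ({p : Core × Streams | p.1.2.1 = y}.indicator 1)) (n + 1)
        ((step ((true, x, r), σ)).1, τ) ∂M.streams :=
      measurable_lintegral_snd M.streams
        (measurable_killed measurable_step measurableSet_idle hh (n + 1)) (by fun_prop)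
    rw [lintegral_pos_iff_support hmeas]
    refine lt_of_lt_of_le (streams_heads_pos M (fun
      | .interarrival l => if l = k then Set.Ioo 0 r else Set.Ioi r
      | .retrial _ => Set.Ioi r
      | .service _ => Set.univ) ?_ ?_) (measure_mono ?_)
    · rintro (l | l | l)
      · by_cases hl : l = k
        · simp [hl, measurableSet_Ioo]
        · simp [hl, measurableSet_Ioi]
      · exact measurableSet_Ioi
      · exact MeasurableSet.univ
    · rintro (l | l | l)
      · by_cases hl : l = k
        · simp only [hl, if_true]
          exact expMeasure_Ioo_pos (M.lam_pos k) hr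
        · simp only [hl, if_false]
          exact expMeasure_Ioi_pos (M.lam_pos l) hr.le
      · exact expMeasure_Ioi_pos (M.alpha_pos l) hr.le
      · simp
    · intro σ hσ
      have hk0 : σ (.interarrival k) 0 ∈ Set.Ioo 0 r := by
        have := hσ (.interarrival k)
        simpa using this
      have hnext : next ((true, x, r), σ) = .arrival k := by
        refine ((frame _).nextEvent_eq_iff _).2 ⟨trivial, fun e hne he => ?_⟩
        have hlt : σ (.interarrival k) 0 < (frame ((true, x, r), σ)).clock e := by
          rcases e with _ | l | l
          · exact hk0.2
          · have hl : l ≠ k := fun h => hne (by rw [h])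
            have := hσ (.interarrival l)
            simp only [hl, if_false] at this
            exact hk0.2.trans this
          · exact hk0.2.trans (hσ (.retrial l))
        rw [mem_above]
        split_ifs
        · exact hlt.le
        · exact hlt
      have hs : (step ((true, x, r), σ)).1 =
          (true, Function.update x k (x k + 1), r - σ (.interarrival k) 0) := by
        rw [step, duration, hnext]
        rfl
      refine ne_of_gt ?_
      change 0 < ∫⁻ τ, _ ∂M.streams
      rw [hs]
      refine ih _ _ (sub_pos.2 hk0.2) ?_ ?_
      · intro l
        by_cases hl : l = k
        · subst hl
          simpa using hk
        · simpa [hl] using hxy l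
      · fin_cases k <;> simp <;> omega

theorem transition_zero_pos (y : Fin 2 → ℕ) : 0 < M.transition 0 y := by
  set h : Core × Streams → ℝ≥0∞ := (Prod.fst ⁻¹' idle).indicator
    ({p : Core × Streams | p.1.2.1 = y}.indicator 1) with hh
  have hy : MeasurableSet {p : Core × Streams | p.1.2.1 = y} := by
    have : Measurable fun p : Core × Streams => p.1.2.1 := by fun_prop
    exact this (measurableSet_singleton _)
  have hhm : Measurable h :=
    (measurable_one.indicator hy).indicator (measurable_fst measurableSet_idle)
  have hk := measurable_killed measurable_step measurableSet_idle hhm (y 0 + y 1 + 1)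
  have h1 : 0 < ∫⁻ σ, killed step idle h (y 0 + y 1 + 1) (step (rest 0, σ)) ∂M.streams := by
    rw [refreshing_step M _ _ hk,
      lintegral_step_rest_zero M (f := fun v => ∫⁻ τ, killed step idle h (y 0 + y 1 + 1) (v, τ)
        ∂M.streams) (measurable_lintegral_snd M.streams hk measurable_id)]
    refine pos_iff_ne_zero.2 fun h0 => ?_
    rw [Finset.sum_eq_zero_iff] at h0
    have h00 := h0 0 (Finset.mem_univ _)
    refine (ENNReal.mul_pos (ne_of_gt ?_) (ne_of_gt ?_)).ne' h00
    · exact ENNReal.ofReal_pos.2 (div_pos (M.lam_pos 0) (add_pos (M.lam_pos 0) (M.lam_pos 1)))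
    · rw [lintegral_pos_iff_support (measurable_lintegral_snd M.streams hk
        (g := fun a : ℝ => ((true, 0, a) : Core)) (by fun_prop))]
      -- Nondegeneracy of the service law enters here: a positive service time leaves room for
      -- arrivals.
      refine lt_of_lt_of_le (M.F_pos 0) (measure_mono fun a ha => ?_)
      exact (lintegral_killed_pos_of_le M y _ 0 a ha (fun _ => Nat.zero_le _) (by simp)).ne'
  have h2 : ∫⁻ σ, killed step idle h (y 0 + y 1 + 1) (step (rest 0, σ)) ∂M.streams ≤
      ∫⁻ σ, {p : Core × Streams | p.1.2.1 = y}.indicator 1 (cycle (rest 0, σ)) ∂M.streams := by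
    refine lintegral_mono_ae ?_
    filter_upwards [ae_exists_return_idle M (rest 0)] with σ hσ
    rw [cycle, ← tsum_killed_eq hσ ({p : Core × Streams | p.1.2.1 = y}.indicator 1)]
    exact ENNReal.le_tsum _
  have h3 : ∫⁻ σ, {p : Core × Streams | p.1.2.1 = y}.indicator 1 (cycle (rest 0, σ)) ∂M.streams =
      M.transition 0 y := by
    have hm : Measurable fun σ : Streams => (cycle (rest 0, σ)).1.2.1 := by fun_prop
    rw [Model.transition, Measure.toPMF_apply, Measure.map_apply hm (measurableSet_singleton _),
      ← lintegral_indicator_one (hm (measurableSet_singleton _))]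
    rfl
  rw [← h3]
  exact h1.trans_le h2

end DepartureChain

/-! ### The system in terms of residual streams -/

section View

/-- The core and the unused primitives in a given state. -/
def view (u : Input) (s : SysState) : Core × Streams :=
  ((s.busy, s.orbit, s.residual), fun
    | .interarrival k => cons (s.arrivalClock k) fun n => u.interarrival k (s.usedInterarrival k + n)
    | .retrial k => cons (s.retrialClock k) fun n => u.retrial k (s.usedRetrial k + n)
    | .service k => fun n => u.service k (s.usedService k + n))

lemma clock_frame_view (u : Input) (s : SysState) (e : Event) :
    (frame (view u s)).clock e = s.clock e := by
  rcases e with _ | k | k <;> rfl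

lemma isActive_frame_view (u : Input) (s : SysState) (e : Event) :
    (frame (view u s)).IsActive e ↔ s.IsActive e := by
  rcases e with _ | k | k <;> exact Iff.rfl

lemma next_view (u : Input) (s : SysState) : next (view u s) = s.nextEvent := by
  refine ((frame (view u s)).nextEvent_eq_iff _).2 ?_
  simp only [clock_frame_view, isActive_frame_view]
  exact (s.nextEvent_eq_iff _).1 rfl

lemma duration_view (u : Input) (s : SysState) : duration (view u s) = s.clock s.nextEvent := by
  rw [duration, next_view, clock_frame_view]

lemma cons_add (f : ℕ → ℝ) (n : ℕ) :
    cons (f n) (fun i => f (n + 1 + i)) = fun i => f (n + i) := by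
  funext i
  cases i with
  | zero => rfl
  | succ i => simp [cons, add_assoc, add_comm 1 i]

lemma tail_cons (a : ℝ) (s : ℕ → ℝ) : tail (cons a s) = s := rfl

lemma shiftHead_cons (d a : ℝ) (s : ℕ → ℝ) : shiftHead d (cons a s) = cons (a - d) s := rfl

lemma tail_add (f : ℕ → ℝ) (n : ℕ) : tail (fun i => f (n + i)) = fun i => f (n + 1 + i) := by
  funext i
  simp [tail, add_assoc, add_comm 1 i]

/-- A check for each event, server status and stream. The hypothesis makes the truncation in
`expire` harmless at a departure. -/
lemma view_apply_elapse {u : Input} {s : SysState} (hs : s.busy = true → 0 ≤ s.residual) :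
    view u ((s.elapse (s.clock s.nextEvent)).apply u s.nextEvent) = step (view u s) := by
  rw [step, next_view, duration_view]
  have hact := s.isNext_nextEvent.1
  rcases hn : s.nextEvent with _ | k | k
  · rw [hn] at hact
    have hb : s.busy = true := hact
    refine Prod.ext ?_ ?_
    · simp [effect, view, SysState.apply, SysState.elapse, SysState.clock, hb]
    · funext i
      rcases i with l | l | l
      · simp [effect, expire, view, SysState.apply, SysState.elapse, SysState.clock,
          shiftHeads, mem_running, Kind.IsRunning, shiftHead_cons, hs hb]
      · by_cases hl : 0 < s.orbit l
        · simp [effect, expire, view, SysState.apply, SysState.elapse, SysState.clock,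
            shiftHeads, mem_running, Kind.IsRunning, shiftHead_cons, hs hb, hl]
        · simp [effect, expire, view, SysState.apply, SysState.elapse, SysState.clock,
            shiftHeads, mem_running, Kind.IsRunning, hl]
      · simp [effect, expire, view, SysState.apply, SysState.elapse, SysState.clock,
          shiftHeads, mem_running, Kind.IsRunning]
  · have hstr : ∀ i, expire (view u s).1 (.arrival k) (view u s).2 i =
        (match i with
          | .interarrival l => if l = k then fun n => u.interarrival k (s.usedInterarrival k + n)
              else cons (s.arrivalClock l - s.arrivalClock k)
                fun n => u.interarrival l (s.usedInterarrival l + n)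
          | .retrial l => cons (if 0 < s.orbit l then s.retrialClock l - s.arrivalClock k
              else s.retrialClock l) fun n => u.retrial l (s.usedRetrial l + n)
          | .service l => fun n => u.service l (s.usedService l + n)) := by
      rintro (l | l | l)
      · by_cases hl : l = k
        · subst hl
          simp [expire, afterWin, view, tail_cons]
        · simp [expire, afterWin, view, hl, shiftHeads, mem_running, Kind.IsRunning,
            shiftHead_cons, cons]
      · by_cases hl : 0 < s.orbit l
        · simp [expire, afterWin, view, shiftHeads, mem_running, Kind.IsRunning,
            shiftHead_cons, cons, hl]
        · simp [expire, afterWin, view, shiftHeads, mem_running, Kind.IsRunning, hl]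
      · simp [expire, afterWin, view, shiftHeads, mem_running, Kind.IsRunning]
    by_cases hb : s.busy = true
    · refine Prod.ext ?_ ?_
      · simp [effect, view, SysState.apply, SysState.elapse, SysState.clock, hb]
      · have he : (effect (view u s).1 (s.clock (.arrival k)) (.arrival k)
            (expire (view u s).1 (.arrival k) (view u s).2)).2 =
            expire (view u s).1 (.arrival k) (view u s).2 := by
          simp only [effect]
          rw [if_pos (by exact hb)]
        rw [he]
        funext i
        rw [hstr]
        rcases i with l | l | l
        · by_cases hl : l = k
          · subst hl
            simp [view, SysState.apply, SysState.elapse, SysState.clock, hb, cons_add]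
          · simp [view, SysState.apply, SysState.elapse, SysState.clock, hb, hl]
        · simp [view, SysState.apply, SysState.elapse, SysState.clock, hb]
        · simp [view, SysState.apply, SysState.elapse, SysState.clock, hb]
    · have hb' : s.busy = false := by simpa using hb
      have he : effect (view u s).1 (s.clock (.arrival k)) (.arrival k)
          (expire (view u s).1 (.arrival k) (view u s).2) =
          enter s.orbit k (expire (view u s).1 (.arrival k) (view u s).2) := by
        simp only [effect]
        rw [if_neg (by exact hb)]
        rfl
      rw [he]
      generalize expire (view u s).1 (.arrival k) (view u s).2 = τ at hstr ⊢
      refine Prod.ext ?_ ?_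
      · simp [enter, hstr, view, SysState.apply, SysState.elapse, SysState.clock, hb',
          SysState.startService]
      · funext i
        rcases i with l | l | l
        · by_cases hl : l = k
          · subst hl
            simp [enter, hstr, view, SysState.apply, SysState.elapse, SysState.clock, hb',
              SysState.startService, cons_add]
          · simp [enter, hstr, view, SysState.apply, SysState.elapse, SysState.clock, hb',
              SysState.startService, hl]
        · simp [enter, hstr, view, SysState.apply, SysState.elapse, SysState.clock, hb',
            SysState.startService]
        · by_cases hl : l = k
          · subst hl
            simp [enter, hstr, view, SysState.apply, SysState.elapse, SysState.clock, hb',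
              SysState.startService, tail_add]
          · simp [enter, hstr, view, SysState.apply, SysState.elapse, SysState.clock, hb',
              SysState.startService, hl]
  · rw [hn] at hact
    have hk : 0 < s.orbit k := hact
    have hstr : ∀ i, expire (view u s).1 (.retrial k) (view u s).2 i =
        (match i with
          | .interarrival l => cons (s.arrivalClock l - s.retrialClock k)
              fun n => u.interarrival l (s.usedInterarrival l + n)
          | .retrial l => if l = k then fun n => u.retrial k (s.usedRetrial k + n)
              else cons (if 0 < s.orbit l then s.retrialClock l - s.retrialClock k
                else s.retrialClock l) fun n => u.retrial l (s.usedRetrial l + n)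
          | .service l => fun n => u.service l (s.usedService l + n)) := by
      rintro (l | l | l)
      · simp [expire, afterWin, view, shiftHeads, mem_running, Kind.IsRunning,
          shiftHead_cons, cons]
      · by_cases hl : l = k
        · subst hl
          simp [expire, afterWin, view, tail_cons]
        · by_cases hl' : 0 < s.orbit l
          · simp [expire, afterWin, view, shiftHeads, mem_running, Kind.IsRunning,
              shiftHead_cons, cons, hl, hl']
          · simp [expire, afterWin, view, shiftHeads, mem_running, Kind.IsRunning, hl, hl']
      · simp [expire, afterWin, view, shiftHeads, mem_running, Kind.IsRunning]
    by_cases hb : s.busy = true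
    · refine Prod.ext ?_ ?_
      · simp [effect, view, SysState.apply, SysState.elapse, SysState.clock, hb]
      · have he : (effect (view u s).1 (s.clock (.retrial k)) (.retrial k)
            (expire (view u s).1 (.retrial k) (view u s).2)).2 =
            expire (view u s).1 (.retrial k) (view u s).2 := by
          simp only [effect]
          rw [if_pos (by exact hb)]
        rw [he]
        funext i
        rw [hstr]
        rcases i with l | l | l
        · simp [view, SysState.apply, SysState.elapse, SysState.clock, hb]
        · by_cases hl : l = k
          · subst hl
            simp [view, SysState.apply, SysState.elapse, SysState.clock, hb, cons_add]
          · simp [view, SysState.apply, SysState.elapse, SysState.clock, hb, hl]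
        · simp [view, SysState.apply, SysState.elapse, SysState.clock, hb]
    · have hb' : s.busy = false := by simpa using hb
      have he : effect (view u s).1 (s.clock (.retrial k)) (.retrial k)
          (expire (view u s).1 (.retrial k) (view u s).2) =
          enter (Function.update s.orbit k (s.orbit k - 1)) k
            (expire (view u s).1 (.retrial k) (view u s).2) := by
        simp only [effect]
        rw [if_neg (by exact hb)]
        rfl
      rw [he]
      generalize expire (view u s).1 (.retrial k) (view u s).2 = τ at hstr ⊢
      refine Prod.ext ?_ ?_
      · simp [enter, hstr, view, SysState.apply, SysState.elapse, SysState.clock, hb',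
          SysState.startService]
      · funext i
        rcases i with l | l | l
        · simp [enter, hstr, view, SysState.apply, SysState.elapse, SysState.clock, hb',
            SysState.startService]
        · by_cases hl : l = k
          · subst hl
            simp [enter, hstr, view, SysState.apply, SysState.elapse, SysState.clock, hb',
              SysState.startService, cons_add]
          · simp [enter, hstr, view, SysState.apply, SysState.elapse, SysState.clock, hb',
              SysState.startService, hl]
        · by_cases hl : l = k
          · subst hl
            simp [enter, hstr, view, SysState.apply, SysState.elapse, SysState.clock, hb',
              SysState.startService, tail_add]
          · simp [enter, hstr, view, SysState.apply, SysState.elapse, SysState.clock, hb',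
              SysState.startService, hl]

end View

/-! ### Counting arrivals and departures in a regeneration cycle -/

section Counting

/-- The total of `h` along the trajectory up to and including the first visit to `emptyCore`. -/
def total (h : Core × Streams → ℝ≥0∞) (p : Core × Streams) : ℝ≥0∞ :=
  ∑' i, killed step emptyCore h i p

lemma total_of_mem {h : Core × Streams → ℝ≥0∞} {p : Core × Streams} (hp : p.1 ∈ emptyCore) :
    total h p = h p := by
  rw [total, tsum_eq_zero_add' ENNReal.summable]
  simp [killed, hp]

lemma total_of_notMem {h : Core × Streams → ℝ≥0∞} {p : Core × Streams} (hp : p.1 ∉ emptyCore) :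
    total h p = h p + total h (step p) := by
  rw [total, tsum_eq_zero_add' ENNReal.summable]
  simp [killed, hp, total]

/-- The states in which the next event is an arrival. -/
def arrivalNext : Set (Core × Streams) := {p | ∃ k, next p = .arrival k}

/-- The states in which the next event is a departure. -/
def departureNext : Set (Core × Streams) := {p | next p = .departure}

/-- The number of customers in the system. -/
def customers (v : Core) : ℕ := (if v.1 then 1 else 0) + v.2.1 0 + v.2.1 1

/-- Arrivals add a customer and departures remove one, while an attempt at most moves a customer
from orbit to server. The additive form avoids subtraction. -/
lemma customers_step (p : Core × Streams) :
    arrivalNext.indicator (1 : Core × Streams → ℝ≥0∞) p + customers p.1 =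
      departureNext.indicator 1 p + customers (step p).1 := by
  have hact := (frame p).isNext_nextEvent.1
  have hupd : ∀ (x : Fin 2 → ℕ) (k : Fin 2) (n : ℕ),
      Function.update x k n 0 + Function.update x k n 1 + x k = x 0 + x 1 + n := by
    intro x k n
    fin_cases k <;> simp <;> ring
  rcases hn : next p with _ | k | k
  · have ha : p ∉ arrivalNext := by
      rintro ⟨k, hk⟩
      rw [hn] at hk
      cases hk
    have hb : p.1.1 = true := ((next_eq_departure_iff p.1 p.2).1 hn).1
    rw [Set.indicator_of_notMem ha, Set.indicator_of_mem (show p ∈ departureNext from hn),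
      step_fst_of_departure hn]
    simp only [customers, hb, if_true, Pi.one_apply, zero_add]
    push_cast
    simp [add_assoc]
  · have hd : p ∉ departureNext := fun h => by
      rw [show next p = .departure from h] at hn
      cases hn
    rw [Set.indicator_of_mem (show p ∈ arrivalNext from ⟨k, hn⟩), Set.indicator_of_notMem hd,
      step, hn, zero_add, Pi.one_apply]
    have hN : 1 + customers p.1 =
        customers (effect p.1 (duration p) (.arrival k) (expire p.1 (.arrival k) p.2)).1 := by
      by_cases hb : p.1.1 = true
      · have := hupd p.1.2.1 k (p.1.2.1 k + 1)
        simp only [effect, hb, customers, if_true]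
        omega
      · simp only [effect, hb, customers, enter]
        simp
        ring
    rw [← hN]
    push_cast
    rfl
  · have hd : p ∉ departureNext := fun h => by
      rw [show next p = .departure from h] at hn
      cases hn
    have ha : p ∉ arrivalNext := by
      rintro ⟨k, hk⟩
      rw [hn] at hk
      cases hk
    have hk : 0 < p.1.2.1 k := by
      have h2 : (frame p).IsActive (.retrial k) := hn ▸ hact
      exact h2
    rw [Set.indicator_of_notMem ha, Set.indicator_of_notMem hd, step, hn, zero_add, zero_add]
    congr 1
    by_cases hb : p.1.1 = true
    · simp only [effect, hb, customers, if_true]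
    · have := hupd p.1.2.1 k (p.1.2.1 k - 1)
      simp only [effect, hb, customers, enter]
      simp
      omega

/-- The balance of arrivals and departures. -/
lemma total_arrival_add_customers (n : ℕ) : ∀ p : Core × Streams,
    (step^[n] p).1 ∈ emptyCore →
      total (arrivalNext.indicator 1) p + customers p.1 =
        total (departureNext.indicator 1) p + 1 := by
  -- The total includes the empty state itself, whose next event is an arrival; this is the `1` on
  -- the right.
  have hempty : ∀ p : Core × Streams, p.1 ∈ emptyCore →
      total (arrivalNext.indicator 1) p + customers p.1 =
        total (departureNext.indicator 1) p + 1 := by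
    intro p hp
    obtain ⟨k, hk⟩ := next_of_mem_emptyCore hp
    have hd : p ∉ departureNext := fun h => by
      rw [show next p = .departure from h] at hk
      cases hk
    rw [total_of_mem hp, total_of_mem hp, Set.indicator_of_mem (show p ∈ arrivalNext from ⟨k, hk⟩),
      Set.indicator_of_notMem hd]
    simp [customers, hp.1, hp.2]
  induction n with
  | zero => exact hempty
  | succ n ih =>
    intro p hp
    by_cases he : p.1 ∈ emptyCore
    · exact hempty p he
    · rw [total_of_notMem he, total_of_notMem he, add_right_comm, customers_step, add_assoc,
        add_comm (customers _ : ℝ≥0∞), ih (step p) hp, add_assoc]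

lemma cycle_of_step_mem {p : Core × Streams} (h : (step p).1 ∈ idle) : cycle p = step p := by
  have h0 : returnIndex step idle p = 0 :=
    (returnIndex_eq_iff ⟨0, h⟩ 0).2 ⟨h, fun i hi => absurd hi (Nat.not_lt_zero i)⟩
  rw [cycle, returnMap, h0]
  rfl

lemma cycle_of_step_notMem {p : Core × Streams} (h : (step p).1 ∉ idle)
    (hret : ∃ j, (step^[j + 1] p).1 ∈ idle) : cycle p = cycle (step p) := by
  have hret' : ∃ j, (step^[j + 1] (step p)).1 ∈ idle := by
    obtain ⟨j, hj⟩ := hret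
    cases j with
    | zero => exact absurd hj h
    | succ j => exact ⟨j, hj⟩
  have h0 : returnIndex step idle p = returnIndex step idle (step p) + 1 := by
    have h1 := (returnIndex_eq_iff hret' _).1 rfl
    refine (returnIndex_eq_iff hret _).2 ⟨h1.1, fun i hi => ?_⟩
    cases i with
    | zero => exact h
    | succ i => exact h1.2 i (by omega)
  rw [cycle, returnMap, returnMap, h0]
  rfl

/-- The number of departures until the system is empty. -/
def visits (p : Core × Streams) : ℝ≥0∞ :=
  ∑' n, {p : Core × Streams | ∀ i < n, orbits i p ≠ 0}.indicator 1 p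

lemma visits_of_step_mem {p : Core × Streams} (h : (step p).1 ∈ idle) :
    visits p = 1 + if (step p).1.2.1 = 0 then 0 else visits (step p) := by
  have hc := cycle_of_step_mem h
  rw [visits, tsum_eq_zero_add' ENNReal.summable]
  congr 1
  · simp
  · split_ifs with h0
    · rw [← tsum_zero (α := ℝ≥0∞) (β := ℕ)]
      refine tsum_congr fun n => Set.indicator_of_notMem (fun hn => ?_) _
      have h1 : (cycle p).1.2.1 ≠ 0 := hn 0 n.succ_pos
      rw [hc] at h1
      exact h1 h0
    · refine tsum_congr fun n => indicator_eq_indicator ⟨fun hn i hi => ?_, fun hn i hi => ?_⟩ rfl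
      · have h1 : orbits i (cycle p) ≠ 0 := hn (i + 1) (by omega)
        rwa [hc] at h1
      · cases i with
        | zero =>
          change (cycle p).1.2.1 ≠ 0
          rwa [hc]
        | succ i =>
          rw [orbits_succ, hc]
          exact hn i (by omega)

lemma visits_of_step_notMem {p : Core × Streams} (h : (step p).1 ∉ idle)
    (hret : ∃ j, (step^[j + 1] p).1 ∈ idle) : visits p = visits (step p) := by
  have hc := cycle_of_step_notMem h hret
  have ho : ∀ i, orbits i p = orbits i (step p) := fun i => by
    rw [orbits, orbits, Function.iterate_succ_apply, hc, ← Function.iterate_succ_apply]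
  refine tsum_congr fun n => indicator_eq_indicator ?_ rfl
  exact ⟨fun hn i hi => ho i ▸ hn i hi, fun hn i hi => (ho i).symm ▸ hn i hi⟩

/-- Along the trajectory both quantities increase by one at each departure and stop at the one that
empties the system. The `n`-th term of `visits` is `1` as long as the first `n` departures all leave
customers behind, so the emptying departure is counted. -/
lemma total_departure_eq_visits (n : ℕ) : ∀ p : Core × Streams,
    (step^[n] p).1 ∈ emptyCore → p.1 ∉ emptyCore →
      total (departureNext.indicator 1) p = visits p := by
  induction n with
  | zero => exact fun p hp hne => absurd hp hne
  | succ n ih =>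
    intro p hp hne
    have hret : ∃ j, (step^[j + 1] p).1 ∈ idle := ⟨n, hp.1⟩
    rw [total_of_notMem hne]
    by_cases hi : (step p).1 ∈ idle
    · have hd : next p = .departure := by
        by_contra hnd
        have h1 : (step p).1.1 = false := hi
        rw [step_busy hnd] at h1
        cases h1
      rw [visits_of_step_mem hi, Set.indicator_of_mem (show p ∈ departureNext from hd)]
      congr 1
      split_ifs with h0
      · have he : (step p).1 ∈ emptyCore := ⟨hi, h0⟩
        obtain ⟨k, hk⟩ := next_of_mem_emptyCore he
        rw [total_of_mem he, Set.indicator_of_notMem]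
        intro h
        rw [show next (step p) = .departure from h] at hk
        cases hk
      · exact ih _ hp fun he => h0 he.2
    · have hd : p ∉ departureNext := fun h => hi (by
        rw [step_fst_of_departure h]
        rfl)
      rw [visits_of_step_notMem hi hret, Set.indicator_of_notMem hd, zero_add]
      exact ih _ hp fun he => hi he.1

/-- The number of arrivals in a regeneration cycle is the number of departures. -/
lemma total_arrival_eq_visits {p : Core × Streams} (hp : customers p.1 = 1)
    (hne : p.1 ∉ emptyCore) (h : ∃ n, (step^[n] p).1 ∈ emptyCore) :
    total (arrivalNext.indicator 1) p = visits p := by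
  obtain ⟨n, hn⟩ := h
  have h1 := total_arrival_add_customers n p hn
  rw [hp, Nat.cast_one, total_departure_eq_visits n p hn hne] at h1
  exact (ENNReal.add_left_inj ENNReal.one_ne_top).1 h1

lemma exists_emptyCore_of_orbits {p : Core × Streams}
    (hret : ∀ m, ∃ j, (step^[j + 1] (step^[m] p)).1 ∈ idle) {n : ℕ} (h : orbits n p = 0) :
    ∃ m, (step^[m] p).1 ∈ emptyCore := by
  have hit : ∀ n, ∃ m, cycle^[n] p = step^[m] p := by
    intro n
    induction n with
    | zero => exact ⟨0, rfl⟩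
    | succ n ih =>
      obtain ⟨m, hm⟩ := ih
      refine ⟨returnIndex step idle (step^[m] p) + 1 + m, ?_⟩
      rw [Function.iterate_succ_apply', hm, Function.iterate_add_apply]
      rfl
  obtain ⟨m, hm⟩ := hit n
  obtain ⟨m', hm'⟩ := hit (n + 1)
  refine ⟨m', ?_⟩
  have h1 : (cycle (step^[m] p)).1 ∈ idle := returnMap_mem (hret m)
  have h2 : cycle (step^[m] p) = step^[m'] p := by
    rw [← hm, ← hm', Function.iterate_succ_apply']
  rw [← h2]
  refine ⟨h1, ?_⟩
  rw [h2, ← hm']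
  exact h

end Counting

/-! ### Trajectories of the system -/

section Trajectory

lemma duration_nonneg {p : Core × Streams} (hσ : Regular p.2) (hp : p.1.1 = true → 0 ≤ p.1.2.2) :
    0 ≤ duration p := by
  by_cases h : next p = .departure
  · rw [duration, h]
    exact hp ((next_eq_departure_iff p.1 p.2).1 h).1
  · exact (duration_pos hσ h).le

lemma step_residual_nonneg {p : Core × Streams} (hσ : Regular p.2) :
    (step p).1.1 = true → 0 ≤ (step p).1.2.2 := by
  intro hb
  by_cases hd : next p = .departure
  · rw [step_fst_of_departure hd] at hb
    cases hb
  by_cases hb0 : p.1.1 = true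
  · rw [step_residual_of_busy hd hb0, sub_nonneg]
    exact (frame p).isNext_nextEvent.2 .departure hb0
  · rw [step]
    rcases hn : next p with _ | k | k
    · exact absurd hn hd
    · simp only [effect, hb0, enter]
      simp only [Bool.false_eq_true, if_false, expire_service]
      exact hσ.2.2 k
    · simp only [effect, hb0, enter]
      simp only [Bool.false_eq_true, if_false, expire_service]
      exact hσ.2.2 k

/-- The streams are regular along the whole trajectory and the initial residual service time is
nonnegative. -/
structure RegularInput (u : Input) : Prop where
  regular : ∀ m, Regular (step^[m] (view u (initial u))).2
  residual_nonneg : 0 ≤ (initial u).residual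
  recurs : ∀ m, ∃ j, (step^[j + 1] (step^[m] (view u (initial u)))).1 ∈ idle

lemma RegularInput.view_state {u : Input} (hu : RegularInput u) (m : ℕ) :
    view u (state u m) = step^[m] (view u (initial u)) ∧
      ((state u m).busy = true → 0 ≤ (state u m).residual) := by
  induction m with
  | zero => exact ⟨rfl, fun _ => hu.residual_nonneg⟩
  | succ m ih =>
    have h1 : view u (state u (m + 1)) = step^[m + 1] (view u (initial u)) := by
      rw [Function.iterate_succ_apply', ← ih.1]
      exact view_apply_elapse ih.2
    refine ⟨h1, ?_⟩
    have h2 := step_residual_nonneg (hu.regular m)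
    rw [← Function.iterate_succ_apply' step, ← h1] at h2
    exact h2

lemma RegularInput.event_eq {u : Input} (hu : RegularInput u) (m : ℕ) :
    event u m = next (step^[m] (view u (initial u))) := by
  rw [← (hu.view_state m).1, next_view]
  rfl

lemma RegularInput.duration_nonneg {u : Input} (hu : RegularInput u) (m : ℕ) :
    0 ≤ duration (step^[m] (view u (initial u))) := by
  refine RetrialQueue.duration_nonneg (hu.regular m) ?_
  rw [← (hu.view_state m).1]
  exact (hu.view_state m).2

lemma RegularInput.eventTime_succ {u : Input} (hu : RegularInput u) (m : ℕ) :
    eventTime u (m + 1) = eventTime u m + duration (step^[m + 1] (view u (initial u))) := by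
  rw [← (hu.view_state (m + 1)).1, duration_view]
  have happ : ∀ (s : SysState) (e : Event), (s.apply u e).time = s.time := by
    rintro s (_ | k | k) <;> simp only [SysState.apply, SysState.startService] <;>
      first | rfl | (split_ifs <;> rfl)
  exact happ _ _

lemma RegularInput.eventTime_eq {u : Input} (hu : RegularInput u) (m : ℕ) :
    eventTime u m = ∑ i ∈ Finset.range (m + 1), duration (step^[i] (view u (initial u))) := by
  induction m with
  | zero =>
    have happ : ∀ (s : SysState) (e : Event), (s.apply u e).time = s.time := by
      rintro s (_ | k | k) <;> simp only [SysState.apply, SysState.startService] <;>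
        first | rfl | (split_ifs <;> rfl)
    rw [Finset.sum_range_one, Function.iterate_zero_apply, duration_view]
    refine (happ _ _).trans ?_
    exact zero_add _
  | succ m ih => rw [hu.eventTime_succ, ih, ← Finset.sum_range_succ]

lemma RegularInput.eventTime_mono {u : Input} (hu : RegularInput u) : Monotone (eventTime u) :=
  monotone_nat_of_le_succ fun m => by
    rw [hu.eventTime_succ]
    exact le_add_of_nonneg_right (hu.duration_nonneg (m + 1))

lemma RegularInput.core_state {u : Input} (hu : RegularInput u) (m : ℕ) :
    (step^[m] (view u (initial u))).1 =
      ((state u m).busy, (state u m).orbit, (state u m).residual) := by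
  rw [← (hu.view_state m).1]
  rfl

lemma RegularInput.exists_empty_of_process {u : Input} (hu : RegularInput u) {t : ℝ} (ht : 0 < t) {m : ℕ} (hm : t = eventTime u m)
    (hp : process u t = (0, 0, 0)) :
    ∃ m' ≤ m, (step^[m'] (view u (initial u))).1 ∈ emptyCore := by
  refine ⟨sInf {m : ℕ | t ≤ eventTime u m}, Nat.sInf_le hm.le, ?_⟩
  rw [process, if_neg (not_le.2 ht)] at hp
  rw [hu.core_state]
  simp only [Prod.mk.injEq, ite_eq_right_iff, one_ne_zero, imp_false, Bool.not_eq_true] at hp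
  refine ⟨hp.1, funext fun k => ?_⟩
  fin_cases k
  · exact hp.2.1
  · exact hp.2.2

lemma RegularInput.regenerationPeriod_eq_top {u : Input} (hu : RegularInput u)
    (h : ∀ m, (step^[m] (view u (initial u))).1 ∉ emptyCore) : regenerationPeriod u = ⊤ := by
  have h1 : regenerationInstant u 1 = ⊤ := by
    rw [regenerationInstant, iInf_eq_top]
    intro t
    rw [iInf_eq_top]
    rintro ⟨ha, hpos, hp⟩
    have ht : 0 < t := ENNReal.ofReal_pos.1 hpos
    rcases ha with ha | ⟨m, k, -, hm⟩
    · exact absurd ha ht.ne'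
    · obtain ⟨m', -, hm'⟩ := hu.exists_empty_of_process ht hm hp
      exact absurd hm' (h m')
  rw [regenerationPeriod, h1, regenerationInstant, tsub_zero]

/-- Let `j` be the first index with an empty system. The next event is an arrival, and its instant
`eventTime u j` is the sum of the durations up to `j`. Simultaneous events are the delicate point:
`process` looks at the first index whose event time reaches `t`, and the positive time spent in the
empty state ensures that this index is `j`. -/
lemma RegularInput.regenerationPeriod_eq_total {u : Input} (hu : RegularInput u)
    (h : ∃ m, (step^[m] (view u (initial u))).1 ∈ emptyCore) :
    regenerationPeriod u =
      total (fun p => ENNReal.ofReal (duration p)) (view u (initial u)) := by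
  classical
  obtain ⟨j, hj, hmin⟩ : ∃ j, (step^[j] (view u (initial u))).1 ∈ emptyCore ∧
      ∀ i < j, (step^[i] (view u (initial u))).1 ∉ emptyCore :=
    ⟨Nat.find h, Nat.find_spec h, fun i hi => Nat.find_min h hi⟩
  have htotal : total (fun p => ENNReal.ofReal (duration p)) (view u (initial u)) =
      ENNReal.ofReal (eventTime u j) := by
    rw [total, tsum_eq_sum (s := Finset.range (j + 1)), hu.eventTime_eq,
      ENNReal.ofReal_sum_of_nonneg fun i _ => hu.duration_nonneg i]
    · refine Finset.sum_congr rfl fun i hi => ?_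
      rw [Finset.mem_range] at hi
      exact killed_of_forall fun m hm => hmin m (by omega)
    · intro i hi
      rw [Finset.mem_range] at hi
      exact killed_of_exists ⟨j, by omega, hj⟩
  have hlt : ∀ i < j, eventTime u i < eventTime u j := by
    intro i hi
    obtain ⟨j', rfl⟩ : ∃ j', j = j' + 1 := ⟨j - 1, by omega⟩
    obtain ⟨k, hk⟩ := next_of_mem_emptyCore hj
    refine (hu.eventTime_mono (show i ≤ j' by omega)).trans_lt ?_
    rw [hu.eventTime_succ]
    exact lt_add_of_pos_right _ (duration_pos (hu.regular (j' + 1)) (by rw [hk]; simp))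
  have hpos : 0 < eventTime u j := by
    obtain ⟨k, hk⟩ := next_of_mem_emptyCore hj
    have h1 := duration_pos (hu.regular j) (by rw [hk]; simp)
    rw [hu.eventTime_eq, Finset.sum_range_succ]
    exact add_pos_of_nonneg_of_pos (Finset.sum_nonneg fun i _ => hu.duration_nonneg i) h1
  have hsInf : sInf {m : ℕ | eventTime u j ≤ eventTime u m} = j := by
    refine le_antisymm (Nat.sInf_le (show eventTime u j ≤ eventTime u j from le_rfl)) ?_
    by_contra hc
    have hmem : eventTime u j ≤ eventTime u (sInf {m : ℕ | eventTime u j ≤ eventTime u m}) :=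
      Nat.sInf_mem (s := {m : ℕ | eventTime u j ≤ eventTime u m}) ⟨j, show eventTime u j ≤ eventTime u j from le_rfl⟩
    exact absurd (hlt _ (not_le.1 hc)) (not_lt.2 hmem)
  have hproc : process u (eventTime u j) = (0, 0, 0) := by
    rw [hu.core_state] at hj
    have hb : (state u j).busy = false := hj.1
    have ho : (state u j).orbit = 0 := hj.2
    rw [process, if_neg (not_le.2 hpos), hsInf]
    simp [hb, ho]
  have h1 : regenerationInstant u 1 = ENNReal.ofReal (eventTime u j) := by
    rw [regenerationInstant]
    refine le_antisymm ?_ ?_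
    · refine iInf₂_le (eventTime u j) ⟨?_, ?_, hproc⟩
      · obtain ⟨k, hk⟩ := next_of_mem_emptyCore hj
        exact Or.inr ⟨j, k, (hu.event_eq j).trans hk, rfl⟩
      · exact ENNReal.ofReal_pos.2 hpos
    · refine le_iInf₂ fun t ht => ENNReal.ofReal_le_ofReal ?_
      obtain ⟨ha, htpos, hp⟩ := ht
      have ht : 0 < t := ENNReal.ofReal_pos.1 htpos
      rcases ha with ha | ⟨m, k, -, hm⟩
      · exact absurd ha ht.ne'
      · obtain ⟨m', hm'm, hm'⟩ := hu.exists_empty_of_process ht hm hp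
        have hjm : j ≤ m' := not_lt.1 fun hlt' => hmin m' hlt' hm'
        rw [hm]
        exact hu.eventTime_mono (hjm.trans hm'm)
  rw [htotal, regenerationPeriod, h1, regenerationInstant, tsub_zero]

/-- Departures are exactly the steps that end with an idle server. So each application of `cycle`
ends just after the next departure, and counting the earlier ones identifies its index with
`Nat.nth`. -/
lemma RegularInput.embedded_eq {u : Input} (hu : RegularInput u) (n : ℕ) : embedded u n = orbits n (view u (initial u)) := by
  classical
  set p := view u (initial u) with hp
  have hdep : ∀ m, event u m = .departure ↔ (step^[m + 1] p).1 ∈ idle := by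
    intro m
    rw [hu.event_eq, Function.iterate_succ_apply']
    refine ⟨fun h => by rw [step_fst_of_departure h]; rfl, fun h => ?_⟩
    by_contra hne
    have h1 : (step (step^[m] p)).1.1 = false := h
    rw [step_busy hne] at h1
    cases h1
  have key : ∀ n, ∃ e, cycle^[n + 1] p = step^[e + 1] p ∧ event u e = .departure ∧
      Nat.count (fun m => event u m = .departure) e = n := by
    have hnext : ∀ m, ∃ i, cycle (step^[m] p) = step^[m + i + 1] p ∧
        event u (m + i) = .departure ∧ ∀ l < i, event u (m + l) ≠ .departure := by
      intro m
      have h1 := (returnIndex_eq_iff (hu.recurs m) _).1 rfl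
      have hadd : ∀ i, step^[i + 1] (step^[m] p) = step^[m + i + 1] p := fun i => by
        rw [← Function.iterate_add_apply, show i + 1 + m = m + i + 1 by omega]
      refine ⟨returnIndex step idle (step^[m] p), ?_, ?_, fun l hl => ?_⟩
      · rw [cycle, returnMap, hadd]
      · rw [hdep, ← hadd]
        exact h1.1
      · rw [Ne, hdep, ← hadd]
        exact h1.2 l hl
    have hcount : ∀ (m i : ℕ), (∀ l < i, event u (m + l) ≠ .departure) →
        Nat.count (fun m => event u m = .departure) (m + i) =
          Nat.count (fun m => event u m = .departure) m := by
      intro m i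
      induction i with
      | zero => simp
      | succ i ih =>
        intro h
        rw [← add_assoc, Nat.count_succ, if_neg (h i (by omega)), add_zero,
          ih fun l hl => h l (by omega)]
    intro n
    induction n with
    | zero =>
      obtain ⟨i, h1, h2, h3⟩ := hnext 0
      refine ⟨0 + i, h1, h2, ?_⟩
      rw [hcount 0 i h3, Nat.count_zero]
    | succ n ih =>
      obtain ⟨e, he1, he2, he3⟩ := ih
      obtain ⟨i, h1, h2, h3⟩ := hnext (e + 1)
      refine ⟨e + 1 + i, ?_, h2, ?_⟩
      · rw [Function.iterate_succ_apply', he1, h1]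
      · rw [hcount _ i h3, Nat.count_succ, if_pos he2, he3]
  obtain ⟨e, he1, he2, he3⟩ := key n
  have hnth : Nat.nth (fun m => event u m = .departure) n = e := by
    rw [← he3]
    exact Nat.nth_count he2
  rw [embedded, hnth, orbits, he1, hu.core_state]

end Trajectory

/-! ### The law of the initial state -/

section InitialLaw

/-- The label of the `n`-th primitive of a given kind. -/
def Kind.source : Kind → ℕ → Source
  | .interarrival k, n => .interarrival k n
  | .retrial k, n => .retrial k n
  | .service k, n => .service k n

lemma Kind.source_injective : Function.Injective fun q : Kind × ℕ => q.1.source q.2 := by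
  rintro ⟨_ | _ | _, n⟩ ⟨_ | _ | _, m⟩ h <;> simp_all [Kind.source]

/-- The streams of all primitives. -/
def Input.streams (u : Input) : Streams := fun i n => u.value (i.source n)

lemma view_initial (u : Input) : view u (initial u) = enter 0 u.firstClass u.streams := by
  refine Prod.ext rfl (funext ?_)
  rintro (k | k | k)
  · have h := cons_add (u.interarrival k) 0
    simp only [zero_add] at h
    simp only [view, initial, SysState.startService, enter, Function.update_of_ne
      (show Kind.interarrival k ≠ .service u.firstClass by simp)]
    exact h
  · have h := cons_add (u.retrial k) 0
    simp only [zero_add] at h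
    simp only [view, initial, SysState.startService, enter, Function.update_of_ne
      (show Kind.retrial k ≠ .service u.firstClass by simp)]
    exact h
  · have h := tail_add (u.service k) 0
    simp only [zero_add] at h
    by_cases hk : k = u.firstClass
    · subst hk
      simp only [view, initial, SysState.startService, enter, Function.update_self]
      exact h.symm
    · simp only [view, initial, SysState.startService, enter, Function.update_of_ne hk,
        Function.update_of_ne (show Kind.service k ≠ .service u.firstClass by simpa using hk),
        zero_add]
      rfl

variable {Ω : Type*} [MeasurableSpace Ω] {μ : Measure Ω} {M : Model} {U : Ω → Input}

lemma hasLaw_streams (hU : IsRetrialInput μ M.lam M.alpha M.F U) :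
    HasLaw (fun ω => (U ω).streams) M.streams μ := by
  have hlaw : ∀ q : Kind × ℕ, HasLaw (fun ω => (U ω).value (q.1.source q.2)) (M.law q.1) μ := by
    rintro ⟨k | k | k, n⟩
    · exact hU.interarrival_law k n
    · exact hU.retrial_law k n
    · exact hU.service_law k n
  have hind : iIndepFun (fun (q : Kind × ℕ) ω => (U ω).value (q.1.source q.2)) μ :=
    hU.indep.precomp Kind.source_injective
  have h1 := hind.hasLaw_infinitePi hlaw (aemeasurable_pi_iff.2 fun q => (hlaw q).aemeasurable)
  refine ⟨(MeasurableEquiv.curry Kind ℕ ℝ).measurable.comp_aemeasurable h1.aemeasurable, ?_⟩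
  have h2 := Measure.infinitePi_map_curry (ι := Kind) (κ := ℕ) fun i _ => M.law i
  rw [← h1.map_eq, AEMeasurable.map_map_of_aemeasurable
    (MeasurableEquiv.curry Kind ℕ ℝ).measurable.aemeasurable h1.aemeasurable] at h2
  rw [Model.streams, streamsLaw, ← Measure.infinitePi_eq_pi]
  exact h2

lemma aemeasurable_view_initial (hU : IsRetrialInput μ M.lam M.alpha M.F U) :
    AEMeasurable (fun ω => view (U ω) (initial (U ω))) μ := by
  simp only [view_initial]
  have hm : Measurable fun q : Fin 2 × Streams => enter 0 q.1 q.2 :=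
    measurable_from_prod_countable_right fun k => measurable_enter 0 k
  exact hm.comp_aemeasurable
    (hU.measurable_firstClass.aemeasurable.prodMk (hasLaw_streams hU).aemeasurable)

/-- The customer of time zero has the class probabilities of the first arrival in an empty system, a
fresh service time and fresh streams. Hence results on trajectories from `rest 0` apply to the given
input. -/
lemma lintegral_view_initial (hU : IsRetrialInput μ M.lam M.alpha M.F U)
    {f : Core × Streams → ℝ≥0∞} (hf : Measurable f) :
    ∫⁻ ω, f (view (U ω) (initial (U ω))) ∂μ = ∫⁻ σ, f (step (rest 0, σ)) ∂M.streams := by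
  have := hU.indep.isProbabilityMeasure
  have hS := hasLaw_streams hU
  have hind : IndepFun (fun ω => (U ω).firstClass) (fun ω => (U ω).streams) μ :=
    hU.indep_firstClass.comp (ψ := fun (g : Source → ℝ) (i : Kind) (n : ℕ) => g (i.source n))
      measurable_id (by fun_prop)
  have hprod := (indepFun_iff_map_prod_eq_prod_map_map
    hU.measurable_firstClass.aemeasurable hS.aemeasurable).1 hind
  have hm : Measurable fun q : Fin 2 × Streams => enter 0 q.1 q.2 :=
    measurable_from_prod_countable_right fun k => measurable_enter 0 k
  have hp := hU.measurable_firstClass.aemeasurable.prodMk hS.aemeasurable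
  simp only [view_initial]
  rw [← lintegral_map' (f := fun q : Fin 2 × Streams => f (enter 0 q.1 q.2))
    (hf.comp hm).aemeasurable hp, hprod, hS.map_eq, lintegral_prod (fun q : Fin 2 × Streams => f (enter 0 q.1 q.2)) (hf.comp hm).aemeasurable,
    refreshing_step M (rest 0) f hf,
    lintegral_step_rest_zero M (f := fun v => ∫⁻ τ, f (v, τ) ∂M.streams)
      (measurable_lintegral_snd M.streams hf measurable_id),
    lintegral_fintype]
  refine Finset.sum_congr rfl fun k _ => ?_
  rw [Measure.map_apply hU.measurable_firstClass (measurableSet_singleton k),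
    show (fun ω => (U ω).firstClass) ⁻¹' {k} = {ω | (U ω).firstClass = k} from rfl,
    hU.firstClass_law, mul_comm]
  congr 1
  exact lintegral_drop (ν := M.law) (.service k) (f := fun q => f ((true, 0, q.1), q.2))
    (by fun_prop)

lemma map_view_initial (hU : IsRetrialInput μ M.lam M.alpha M.F U) :
    μ.map (fun ω => view (U ω) (initial (U ω))) = M.streams.map fun σ => step (rest 0, σ) := by
  refine Measure.ext_of_lintegral _ fun f hf => ?_
  rw [lintegral_map' hf.aemeasurable (aemeasurable_view_initial hU),
    lintegral_map hf (by fun_prop), lintegral_view_initial hU hf]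

lemma ae_view_initial (hU : IsRetrialInput μ M.lam M.alpha M.F U) {A : Set (Core × Streams)}
    (hA : MeasurableSet A) :
    (∀ᵐ ω ∂μ, view (U ω) (initial (U ω)) ∈ A) ↔ ∀ᵐ σ ∂M.streams, step (rest 0, σ) ∈ A := by
  have h1 := ae_map_iff (p := (· ∈ A)) (aemeasurable_view_initial hU) hA
  have hs : Measurable fun σ : Streams => step (rest 0, σ) := by fun_prop
  rw [map_view_initial hU] at h1
  exact h1.symm.trans (ae_map_iff (p := (· ∈ A)) hs.aemeasurable hA)

lemma measure_view_initial (hU : IsRetrialInput μ M.lam M.alpha M.F U) {A : Set (Core × Streams)}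
    (hA : MeasurableSet A) :
    μ {ω | view (U ω) (initial (U ω)) ∈ A} = M.streams {σ | step (rest 0, σ) ∈ A} := by
  have h1 := Measure.map_apply_of_aemeasurable (aemeasurable_view_initial hU) hA
  have hs : Measurable fun σ : Streams => step (rest 0, σ) := by fun_prop
  rw [map_view_initial hU, Measure.map_apply hs hA] at h1
  exact h1.symm

lemma measurableSet_exists_return : MeasurableSet {p | ∃ j, (step^[j + 1] p).1 ∈ idle} := by
  simp only [Set.ofPred_exists]
  exact MeasurableSet.iUnion fun j => (measurable_step.iterate (j + 1)).fst measurableSet_idle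

lemma measurableSet_exists_emptyCore : MeasurableSet {p | ∃ j, (step^[j] p).1 ∈ emptyCore} := by
  simp only [Set.ofPred_exists]
  exact MeasurableSet.iUnion fun j => (measurable_step.iterate j).fst measurableSet_emptyCore

lemma ae_regularInput (hU : IsRetrialInput μ M.lam M.alpha M.F U) :
    ∀ᵐ ω ∂μ, RegularInput (U ω) := by
  have hR : MeasurableSet {p : Core × Streams | Regular p.2} := measurable_snd measurableSet_regular
  have h1 : ∀ᵐ ω ∂μ, ∀ m, step^[m] (view (U ω) (initial (U ω))) ∈
      {p : Core × Streams | Regular p.2} := by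
    rw [ae_all_iff]
    intro m
    refine (ae_view_initial hU ((measurable_step.iterate m) hR)).2 ?_
    filter_upwards [ae_iterate (refreshing_step M) measurable_step hR (fun _ => M.ae_regular)
      (rest 0)] with σ hσ
    -- The index is shifted because the initial state has the law of the state one step after `rest
    -- 0`.
    exact hσ (m + 1)
  have h2 : ∀ᵐ ω ∂μ, ∀ m, step^[m] (view (U ω) (initial (U ω))) ∈
      {p | ∃ j, (step^[j + 1] p).1 ∈ idle} := by
    rw [ae_all_iff]
    intro m
    refine (ae_view_initial hU ((measurable_step.iterate m) measurableSet_exists_return)).2 ?_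
    filter_upwards [ae_iterate (refreshing_step M) measurable_step measurableSet_exists_return
      (ae_exists_return_idle M) (rest 0)] with σ hσ
    exact hσ (m + 1)
  have h3 : ∀ᵐ ω ∂μ, view (U ω) (initial (U ω)) ∈ {p : Core × Streams | 0 ≤ p.1.2.2} := by
    refine (ae_view_initial hU (measurableSet_le (by fun_prop) (by fun_prop))).2 ?_
    filter_upwards [M.ae_regular] with σ hσ
    refine step_residual_nonneg (p := (rest 0, σ)) hσ (step_busy fun hd => ?_)
    obtain ⟨k, hk⟩ := next_of_mem_emptyCore (p := (rest 0, σ)) ⟨rfl, rfl⟩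
    rw [hd] at hk
    cases hk
  filter_upwards [h1, h2, h3] with ω a b c
  exact ⟨a, c, b⟩

/-- The first step from rest is an arrival that starts a service, so it stays within the first
cycle. -/
lemma orbits_step_rest_zero {σ : Streams} (h : ∃ j, (step^[j + 1] (rest 0, σ)).1 ∈ idle) (n : ℕ) :
    orbits n (step (rest 0, σ)) = orbits n (rest 0, σ) := by
  obtain ⟨k, hk⟩ := next_of_mem_emptyCore (p := (rest 0, σ)) ⟨rfl, rfl⟩
  have hi : (step (rest 0, σ)).1 ∉ idle := fun hi => by
    have h1 : (step (rest 0, σ)).1.1 = false := hi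
    rw [step_rest_zero_fst hk] at h1
    cases h1
  rw [orbits, orbits, Function.iterate_succ_apply, Function.iterate_succ_apply,
    cycle_of_step_notMem hi h]

lemma measure_embedded_path (hU : IsRetrialInput μ M.lam M.alpha M.F U) (n : ℕ)
    (x : ℕ → Fin 2 → ℕ) :
    μ {ω | ∀ i ≤ n, embedded (U ω) i = x i} =
      M.transition 0 (x 0) * ∏ i ∈ Finset.range n, M.transition (x i) (x (i + 1)) := by
  rw [← streams_path M n 0 x]
  have h1 : μ {ω | ∀ i ≤ n, embedded (U ω) i = x i} = μ {ω | view (U ω) (initial (U ω)) ∈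
      {p : Core × Streams | ∀ i < n + 1, orbits i p = x i}} := by
    refine measure_congr ?_
    filter_upwards [ae_regularInput hU] with ω hω
    refine propext (forall_congr' fun i => ?_)
    rw [hω.embedded_eq, Nat.lt_succ_iff]
  rw [h1, measure_view_initial hU (measurableSet_orbits_eq x (n + 1))]
  refine measure_congr ?_
  filter_upwards [ae_exists_return_idle M (rest 0)] with σ hσ
  refine propext (forall_congr' fun i => ?_)
  rw [orbits_step_rest_zero hσ]

lemma isMarkovChain_embedded (hU : IsRetrialInput μ M.lam M.alpha M.F U) :
    IsMarkovChain μ (fun n ω => embedded (U ω) n) M.transition := by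
  intro n x
  rw [measure_embedded_path hU, measure_embedded_path hU, Finset.prod_range_succ, mul_assoc]

/-- The first term of the chain charges every state, so the joint law of the first two terms fixes
each row. -/
lemma eq_transition_of_isMarkovChain (hU : IsRetrialInput μ M.lam M.alpha M.F U)
    {P : (Fin 2 → ℕ) → PMF (Fin 2 → ℕ)}
    (hP : IsMarkovChain μ (fun n ω => embedded (U ω) n) P) : P = M.transition := by
  funext x
  ext y
  have h1 := hP 0 fun i => if i = 0 then x else y
  rw [isMarkovChain_embedded hU 0, measure_embedded_path hU] at h1
  simp only [Finset.range_zero, Finset.prod_empty, mul_one, if_true, zero_add, one_ne_zero,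
    if_false] at h1
  exact ((ENNReal.mul_right_inj (transition_zero_pos M x).ne' (PMF.apply_ne_top _ _)).1 h1).symm

end InitialLaw

/-! ### The mean regeneration period -/

section MeanPeriod

variable {Ω : Type*} [MeasurableSpace Ω] {μ : Measure Ω} {M : Model} {U : Ω → Input}

lemma measurableSet_arrivalNext : MeasurableSet arrivalNext :=
  measurable_next (Set.toFinite {e | ∃ k, e = Event.arrival k}).measurableSet

lemma measurable_total {h : Core × Streams → ℝ≥0∞} (hh : Measurable h) : Measurable (total h) :=
  Measurable.tsum fun i => measurable_killed measurable_step measurableSet_emptyCore hh i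

/-- A Wald-type identity. By `lintegral_duration`, summed over the classes, the scaled duration and
the indicator of an arrival have equal means for every core; `lintegral_killed_congr` carries this
to each step of the cycle. -/
lemma lintegral_total_duration (M : Model) (v : Core) :
    (ENNReal.ofReal (M.lam 0) + ENNReal.ofReal (M.lam 1)) *
        ∫⁻ σ, total (fun p => ENNReal.ofReal (duration p)) (v, σ) ∂M.streams =
      ∫⁻ σ, total (arrivalNext.indicator 1) (v, σ) ∂M.streams := by
  set c := ENNReal.ofReal (M.lam 0) + ENNReal.ofReal (M.lam 1) with hc
  have hd : Measurable fun p : Core × Streams => ENNReal.ofReal (duration p) := by fun_prop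
  have hcd : Measurable fun p : Core × Streams => c * ENNReal.ofReal (duration p) := by fun_prop
  have hg : Measurable (arrivalNext.indicator (1 : Core × Streams → ℝ≥0∞)) :=
    measurable_one.indicator measurableSet_arrivalNext
  have hone : ∀ w, ∫⁻ σ, c * ENNReal.ofReal (duration (w, σ)) ∂M.streams =
      ∫⁻ σ, arrivalNext.indicator 1 (w, σ) ∂M.streams := by
    intro w
    have hn : Measurable fun σ => next (w, σ) := by fun_prop
    have hm : ∀ k, MeasurableSet {σ | next (w, σ) = .arrival k} := fun k =>
      hn (measurableSet_singleton _)
    rw [lintegral_const_mul _ (by fun_prop), hc, add_mul, lintegral_duration, lintegral_duration,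
      ← measure_union _ (hm 1), ← lintegral_indicator_one ((hm 0).union (hm 1))]
    · refine lintegral_congr fun σ => indicator_eq_indicator ⟨?_, ?_⟩ rfl
      · rintro (h | h)
        exacts [⟨0, h⟩, ⟨1, h⟩]
      · rintro ⟨k, hk⟩
        fin_cases k
        exacts [Or.inl hk, Or.inr hk]
    · rw [Set.disjoint_left]
      intro σ h0 h1
      have h2 : Event.arrival 0 = .arrival 1 :=
        (show next (w, σ) = .arrival 0 from h0).symm.trans h1
      simp at h2
  have hmul : ∀ i p, killed step emptyCore (fun p => c * ENNReal.ofReal (duration p)) i p =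
      c * killed step emptyCore (fun p => ENNReal.ofReal (duration p)) i p := by
    intro i
    induction i with
    | zero => exact fun p => rfl
    | succ i ih =>
      intro p
      rw [killed, killed, ih]
      split_ifs <;> simp
  have hk : ∀ {h : Core × Streams → ℝ≥0∞}, Measurable h → ∀ i, Measurable fun σ : Streams =>
      killed step emptyCore h i (v, σ) := fun hh i =>
    (measurable_killed measurable_step measurableSet_emptyCore hh i).comp measurable_prodMk_left
  simp only [total]
  rw [lintegral_tsum fun i => (hk hd i).aemeasurable, lintegral_tsum fun i => (hk hg i).aemeasurable,
    ← ENNReal.tsum_mul_left]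
  refine tsum_congr fun i => ?_
  rw [← lintegral_killed_congr (refreshing_step M) measurable_step measurableSet_emptyCore hcd hg
    hone i v, ← lintegral_const_mul _ (hk hd i)]
  exact lintegral_congr fun σ => (hmul i _).symm

lemma lintegral_total_duration_initial (hU : IsRetrialInput μ M.lam M.alpha M.F U) :
    (ENNReal.ofReal (M.lam 0) + ENNReal.ofReal (M.lam 1)) *
        ∫⁻ ω, total (fun p => ENNReal.ofReal (duration p)) (view (U ω) (initial (U ω))) ∂μ =
      ∫⁻ ω, total (arrivalNext.indicator 1) (view (U ω) (initial (U ω))) ∂μ := by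
  have hd : Measurable (total fun p => ENNReal.ofReal (duration p)) :=
    measurable_total (by fun_prop)
  have hg : Measurable (total (arrivalNext.indicator 1)) :=
    measurable_total (measurable_one.indicator measurableSet_arrivalNext)
  have hs : Measurable fun σ : Streams => (step (rest 0, σ)).1 := by fun_prop
  rw [lintegral_view_initial hU hd, lintegral_view_initial hU hg, refreshing_step M (rest 0) _ hd,
    refreshing_step M (rest 0) _ hg,
    ← lintegral_const_mul _ (measurable_lintegral_snd M.streams hd hs)]
  exact lintegral_congr fun σ => lintegral_total_duration M _

lemma lintegral_visits_initial (hU : IsRetrialInput μ M.lam M.alpha M.F U) :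
    ∫⁻ ω, visits (view (U ω) (initial (U ω))) ∂μ = meanPassage M.transition 0 0 := by
  have hm : ∀ n, Measurable ({p : Core × Streams | ∀ i < n, orbits i p ≠ 0}.indicator
      (1 : Core × Streams → ℝ≥0∞)) := fun n => measurable_one.indicator (measurableSet_orbits_ne 0 n)
  have hv : Measurable visits := Measurable.tsum hm
  have hs : Measurable fun σ : Streams => step (rest 0, σ) := by fun_prop
  rw [lintegral_view_initial hU hv]
  simp only [visits]
  have hms : ∀ n, Measurable fun σ : Streams =>
      {p : Core × Streams | ∀ i < n, orbits i p ≠ 0}.indicator (1 : Core × Streams → ℝ≥0∞)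
        (step (rest 0, σ)) := fun n => (hm n).comp hs
  rw [lintegral_tsum fun n => (hms n).aemeasurable, meanPassage]
  refine tsum_congr fun n => ?_
  have hset : MeasurableSet {σ : Streams | ∀ i < n, orbits i (rest 0, σ) ≠ 0} :=
    (measurableSet_orbits_ne 0 n).preimage measurable_prodMk_left
  rw [← streams_avoid M 0 n 0, ← lintegral_indicator_one hset]
  refine lintegral_congr_ae ?_
  filter_upwards [ae_exists_return_idle M (rest 0)] with σ hσ
  refine indicator_eq_indicator (forall_congr' fun i => ?_) rfl
  rw [orbits_step_rest_zero hσ]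

/-- The mean number of customers served in a regeneration cycle is the total arrival rate times
the mean length of the cycle. -/
lemma rate_mul_lintegral_regenerationPeriod (hU : IsRetrialInput μ M.lam M.alpha M.F U)
    (h : ∀ᵐ ω ∂μ, ∃ m, (step^[m] (view (U ω) (initial (U ω)))).1 ∈ emptyCore) :
    (ENNReal.ofReal (M.lam 0) + ENNReal.ofReal (M.lam 1)) *
      ∫⁻ ω, regenerationPeriod (U ω) ∂μ = meanPassage M.transition 0 0 := by
  have h1 : ∫⁻ ω, regenerationPeriod (U ω) ∂μ =
      ∫⁻ ω, total (fun p => ENNReal.ofReal (duration p)) (view (U ω) (initial (U ω))) ∂μ := by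
    refine lintegral_congr_ae ?_
    filter_upwards [h, ae_regularInput hU] with ω hω hr
    exact hr.regenerationPeriod_eq_total hω
  rw [h1, lintegral_total_duration_initial hU, ← lintegral_visits_initial hU]
  refine lintegral_congr_ae ?_
  filter_upwards [h] with ω hω
  refine total_arrival_eq_visits ?_ ?_ hω
  · rw [view_initial]
    simp [enter, customers]
  · rw [view_initial]
    rintro ⟨hb, -⟩
    cases hb

/-- If the system never empties, all terms of `visits` are `1` and the sum is infinite, which a
finite mean excludes almost surely. -/
lemma ae_exists_emptyCore_of_meanPassage (hU : IsRetrialInput μ M.lam M.alpha M.F U)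
    (h : meanPassage M.transition 0 0 < ⊤) :
    ∀ᵐ ω ∂μ, ∃ m, (step^[m] (view (U ω) (initial (U ω)))).1 ∈ emptyCore := by
  have hv : Measurable visits := Measurable.tsum fun n =>
    measurable_one.indicator (measurableSet_orbits_ne 0 n)
  have hlt : ∀ᵐ ω ∂μ, visits (view (U ω) (initial (U ω))) < ⊤ :=
    ae_lt_top' (hv.comp_aemeasurable (aemeasurable_view_initial hU))
      (by rw [lintegral_visits_initial hU]; exact h.ne)
  filter_upwards [hlt, ae_regularInput hU] with ω hω hr
  by_contra hne
  have horb : ∀ n, orbits n (view (U ω) (initial (U ω))) ≠ 0 := fun n h0 =>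
    hne (exists_emptyCore_of_orbits hr.recurs h0)
  refine hω.ne ?_
  rw [visits]
  refine (tsum_congr fun n => Set.indicator_of_mem (by exact fun i _ => horb i) _).trans ?_
  exact ENNReal.tsum_const_eq_top_of_ne_zero one_ne_zero

lemma ae_exists_emptyCore_of_regenerationPeriod (hU : IsRetrialInput μ M.lam M.alpha M.F U)
    (h : ∫⁻ ω, regenerationPeriod (U ω) ∂μ < ⊤) :
    ∀ᵐ ω ∂μ, ∃ m, (step^[m] (view (U ω) (initial (U ω)))).1 ∈ emptyCore := by
  set A : Set (Core × Streams) := {p | ∃ j, (step^[j] p).1 ∈ emptyCore}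
  -- A measurable minorant of the regeneration period, so that measurability of the period itself is
  -- not needed.
  have hg : Measurable (Aᶜ.indicator fun _ : Core × Streams => (⊤ : ℝ≥0∞)) :=
    measurable_const.indicator measurableSet_exists_emptyCore.compl
  have hle : ∫⁻ ω, Aᶜ.indicator (fun _ => ⊤) (view (U ω) (initial (U ω))) ∂μ ≤
      ∫⁻ ω, regenerationPeriod (U ω) ∂μ := by
    refine lintegral_mono_ae ?_
    filter_upwards [ae_regularInput hU] with ω hr
    refine Set.indicator_apply_le' (fun hω => ?_) fun _ => zero_le
    rw [hr.regenerationPeriod_eq_top fun m hm => hω ⟨m, hm⟩]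
  filter_upwards [ae_lt_top' (hg.comp_aemeasurable (aemeasurable_view_initial hU))
    (hle.trans_lt h).ne] with ω hω
  by_contra hne
  refine hω.ne ?_
  exact Set.indicator_of_mem (show view (U ω) (initial (U ω)) ∈ Aᶜ from hne) _

lemma meanPassage_lt_top_iff (hU : IsRetrialInput μ M.lam M.alpha M.F U) :
    meanPassage M.transition 0 0 < ⊤ ↔ ∫⁻ ω, regenerationPeriod (U ω) ∂μ < ⊤ := by
  have hc0 : ENNReal.ofReal (M.lam 0) + ENNReal.ofReal (M.lam 1) ≠ 0 :=
    (add_pos_of_pos_of_nonneg (ENNReal.ofReal_pos.2 (M.lam_pos 0)) zero_le).ne'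
  have hct : ENNReal.ofReal (M.lam 0) + ENNReal.ofReal (M.lam 1) ≠ ⊤ := by simp
  constructor
  · intro h
    have h1 := rate_mul_lintegral_regenerationPeriod hU (ae_exists_emptyCore_of_meanPassage hU h)
    rw [← h1] at h
    rw [lt_top_iff_ne_top]
    intro ht
    rw [ht, ENNReal.mul_top hc0] at h
    exact lt_irrefl _ h
  · intro h
    rw [← rate_mul_lintegral_regenerationPeriod hU
      (ae_exists_emptyCore_of_regenerationPeriod hU h)]
    exact ENNReal.mul_lt_top hct.lt_top h

end MeanPeriod

end

end RetrialQueue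

open RetrialQueue

theorem lemma1 {Ω : Type*} [MeasurableSpace Ω] (μ : Measure Ω) [IsProbabilityMeasure μ]
    (lam alpha : Fin 2 → ℝ) (hlam : ∀ k, 0 < lam k) (halpha : ∀ k, 0 < alpha k)
    (F : Fin 2 → Measure ℝ) [∀ k, IsProbabilityMeasure (F k)]
    (hF_nonneg : ∀ k, F k (Set.Iio 0) = 0) (hF_pos : ∀ k, 0 < F k (Set.Ioi 0))
    (U : Ω → Input) (hU : IsRetrialInput μ lam alpha F U) :
    (∃ P : (Fin 2 → ℕ) → PMF (Fin 2 → ℕ), IsMarkovChain μ (fun n ω => embedded (U ω) n) P) ∧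
    ∀ P : (Fin 2 → ℕ) → PMF (Fin 2 → ℕ), IsMarkovChain μ (fun n ω => embedded (U ω) n) P →
      (IsPositiveRecurrent P ↔ ∫⁻ ω, regenerationPeriod (U ω) ∂μ < ⊤) := by
  let M : Model := ⟨lam, alpha, F, hlam, halpha, inferInstance, hF_nonneg, hF_pos⟩
  have hM : IsRetrialInput μ M.lam M.alpha M.F U := hU
  refine ⟨⟨M.transition, isMarkovChain_embedded hM⟩, fun P hP => ?_⟩
  rw [eq_transition_of_isMarkovChain hM hP,
    isPositiveRecurrent_iff_meanPassage M.transition 0 (transition_zero_pos M),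
    meanPassage_lt_top_iff hM]
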